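/- Let $d\ge 1$, $0<\alpha\le 2$, $0<\beta<\min(\alpha,d)$, $\sigma>0$ and $\kappa>0$. On a probability space $(\Omega,\mathcal F,\mathbf P)$ with a filtration $(\mathcal F_t)_{t\ge0}$ let $F=\{F(\varphi)\}$ be a Gaussian noise on $\mathbf R_+\times\mathbf R^d$ that is white in time with Riesz correlation in space: a centered Gaussian family indexed by smooth compactly supported functions $\varphi$ on $(0,\infty)\times\mathbf R^d$ with $$\mathbf E[F(\varphi)F(\psi)]=\langle\varphi,\psi\rangle:=\int_{\mathbf R_+\times\mathbf R^{2d}}\varphi(t,x)\,\psi(t,y)\,|x-y|^{-\beta}\,dx\,dy\,dt .$$ For measurable $\phi$ with $\int_{\mathbf R_+\times\mathbf R^{2d}}|\phi(t,x)\phi(t,y)||x-y|^{-\beta}\,dx\,dy\,dt<\infty$ the stochastic integral $\int\phi\,dF$ is defined by extending the linear isometry $\varphi\mapsto F(\varphi)\in L^2(\mathbf P)$. Let $G_\alpha(t,x,y)$ be the heat kernel on $\mathbf R^d$ of the isotropic $\alpha$-stable process with generator $-\kappa(-\Delta)^{\alpha/2}$, i.e. $$G_\alpha(t,x,y)=(2\pi)^{-d}\int_{\mathbf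 R^d}e^{i\langle x-y,\xi\rangle-\kappa t|\xi|^\alpha}\,d\xi ,\qquad t>0 .$$ Consider $$\frac{\partial u}{\partial t}(t,x)=-\kappa(-\Delta)^{\alpha/2}u(t,x)+b(u(t,x))+\sigma\dot F(t,x),\quad x\in\mathbf R^d,\ t>0,\qquad u(0,x)=u_0(x),$$ where $b:\mathbf R\to[0,\infty)$ is locally Lipschitz and nondecreasing on $(0,\infty)$, and $u_0:\mathbf R^d\to[0,\infty)$ is continuous. A local solution is a pair $(u,\tau)$ of a jointly measurable adapted real-valued random field $u=\{u(t,x)\}_{t\ge0,\,x\in\mathbf R^d}$ and a stopping time $\tau$ with values in $[0,\infty]$ such that for all $t>0$ and $x\in\mathbf R^d$, almost surely on $\{t<\tau\}$, the first two integrals below are finite and $$u(t,x)=\int_{\mathbf R^d}G_\alpha(t,x,y)u_0(y)\,dy+\int_0^t\!\int_{\mathbf R^d}G_\alpha(t-s,x,y)\,b(u(s,y))\,dy\,ds+\sigma\int_0^t\!\int_{\mathbf R^d}G_\alpha(t-s,x,y)\,F(dy\,ds).$$ The solution is global on the event $\{\tau=\infty\}$. Suppose that $b$ satisfies the Osgood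 condition: $\int_a^\infty\frac{ds}{b(s)}<\infty$ for some $a>0$, where $1/0=\infty$. Then almost surely there is no global solution: every local solution $(u,\tau)$ satisfies $\mathbf P(\tau=\infty)=0$. -/

import Mathlib

open MeasureTheory ProbabilityTheory Set Filter Topology
open scoped NNReal ENNReal Distributions

/-- The Euclidean space `ℝ^d`. -/
abbrev Space (d : ℕ) : Type := EuclideanSpace ℝ (Fin d)

/-- The open half space `(0, ∞) × ℝ^d` of space-time. -/
def posSpaceTime (d : ℕ) : TopologicalSpace.Opens (ℝ × Space d) :=
  ⟨Ioi 0 ×ˢ univ, isOpen_Ioi.prod isOpen_univ⟩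

/-- The real integrand `φ(t,x) ψ(t,y) |x - y|^{-β}` at the point `(t, x, y)`. -/
noncomputable def rieszIntegrand {d : ℕ} (β : ℝ) (φ ψ : ℝ × Space d → ℝ)
    (p : ℝ × Space d × Space d) : ℝ :=
  φ (p.1, p.2.1) * ψ (p.1, p.2.2) * ‖p.2.1 - p.2.2‖ ^ (-β)

/-- The inner product
`⟨φ, ψ⟩ = ∫_{ℝ₊ × ℝ^d × ℝ^d} φ(t,x) ψ(t,y) |x - y|^{-β} dx dy dt`. -/
noncomputable def rieszInner {d : ℕ} (β : ℝ) (φ ψ : ℝ × Space d → ℝ) : ℝ :=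
  ∫ p in (Ioi (0 : ℝ) ×ˢ (univ : Set (Space d × Space d))), rieszIntegrand β φ ψ p

/-- Measurable functions `φ` with
`∫_{ℝ₊ × ℝ^d × ℝ^d} |φ(t,x) φ(t,y)| |x - y|^{-β} dx dy dt < ∞`. -/
def MemRiesz {d : ℕ} (β : ℝ) (φ : ℝ × Space d → ℝ) : Prop :=
  Measurable φ ∧
    IntegrableOn (rieszIntegrand β φ φ) (Ioi (0 : ℝ) ×ˢ (univ : Set (Space d × Space d)))

/-- `F` is a Gaussian noise, white in time, with spatial correlation given by the Riesz kernel
`|x|^{-β}`: a centered Gaussian family indexed by test functions, with covariance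
`E[F(φ) F(ψ)] = ⟨φ, ψ⟩`. -/
structure IsRieszNoise {d : ℕ} {Ω : Type*} [MeasurableSpace Ω] (P : Measure Ω) (β : ℝ)
    (F : 𝓓(posSpaceTime d, ℝ) → Ω → ℝ) : Prop where
  gaussian : IsGaussianProcess F P
  centered : ∀ φ, ∫ ω, F φ ω ∂P = 0
  covariance : ∀ φ ψ, ∫ ω, F φ ω * F ψ ω ∂P = rieszInner β φ ψ

/-- `X` is (a version of) the stochastic integral `∫∫ φ(t,x) F(dt dx)`, defined by extending the
isometry `φ ↦ F(φ)` from test functions: `X` is the `L²(P)`-limit of `F(φₙ)` for some test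
functions `φₙ` that converge to `φ` in the norm of `rieszInner`. -/
def IsNoiseIntegral {d : ℕ} {Ω : Type*} [MeasurableSpace Ω] (P : Measure Ω) (β : ℝ)
    (F : 𝓓(posSpaceTime d, ℝ) → Ω → ℝ) (φ : ℝ × Space d → ℝ) (X : Ω → ℝ) : Prop :=
  MemRiesz β φ ∧ MemLp X 2 P ∧
    ∃ φs : ℕ → 𝓓(posSpaceTime d, ℝ),
      Tendsto (fun n => rieszInner β (fun p => φs n p - φ p) (fun p => φs n p - φ p))
        atTop (𝓝 0) ∧
      Tendsto (fun n => eLpNorm (fun ω => F (φs n) ω - X ω) 2 P) atTop (𝓝 0)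

/-- The heat kernel on `ℝ^d` of the isotropic `α`-stable process with generator
`-κ (-Δ)^{α/2}`: for `t > 0`, the function of `z = x - y` whose Fourier transform is
`ξ ↦ exp(-κ t |ξ|^α)`. -/
noncomputable def stableKernel {d : ℕ} (α κ t : ℝ) (z : Space d) : ℝ :=
  ((2 * Real.pi) ^ d)⁻¹ *
    ∫ ξ : Space d, Real.cos (inner ℝ z ξ) * Real.exp (-(κ * t * ‖ξ‖ ^ α))

/-- The integrand `(s, y) ↦ 1_{0 < s < t} G(t - s, x - y)` of the stochastic convolution. -/
noncomputable def convolutionKernel {d : ℕ} (α κ t : ℝ) (x : Space d) :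
    ℝ × Space d → ℝ :=
  (Ioo 0 t ×ˢ univ).indicator fun p => stableKernel α κ (t - p.1) (x - p.2)

/-- The Osgood condition `∫_a^∞ 1 / b(s) ds < ∞` for some `a > 0`, with `1 / 0 = ∞`. -/
def OsgoodCondition (b : ℝ → ℝ) : Prop :=
  ∃ a : ℝ, 0 < a ∧ ∫⁻ s in Ioi a, (ENNReal.ofReal (b s))⁻¹ < ∞

/-- The pair `(u, τ)` is a local random field solution of
`∂ₜ u = -κ (-Δ)^{α/2} u + b(u) + σ Ḟ`, `u(0, ·) = u₀`: the random field `u` is jointly measurable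
and adapted, `τ` is a stopping time, and the mild equation holds up to time `τ`; the finiteness of
the two Lebesgue integrals is part of the equation. The identity is asked at every point `(t, x)`
almost surely on `{t < τ}`, which is weaker than asking it almost surely at all points together.
The solution is global on the event `{τ = ∞}`. -/
structure IsLocalSolution {d : ℕ} {Ω : Type*} {mΩ : MeasurableSpace Ω} (P : Measure Ω)
    (ℱ : Filtration ℝ≥0 mΩ) (α β κ σ : ℝ)
    (F : 𝓓(posSpaceTime d, ℝ) → Ω → ℝ) (b : ℝ → ℝ) (u₀ : Space d → ℝ)
    (u : ℝ≥0 → Space d → Ω → ℝ) (τ : Ω → WithTop ℝ≥0) : Prop where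
  measurable : Measurable fun p : ℝ≥0 × Space d × Ω => u p.1 p.2.1 p.2.2
  adapted : ∀ x, Adapted ℱ fun t => u t x
  stopping : IsStoppingTime ℱ τ
  mild : ∀ (t : ℝ≥0) (x : Space d), 0 < t →
    ∃ X : Ω → ℝ, IsNoiseIntegral P β F (convolutionKernel α κ t x) X ∧
      ∀ᵐ ω ∂P, (t : WithTop ℝ≥0) < τ ω →
        Integrable (fun y => stableKernel α κ t (x - y) * u₀ y) ∧
        IntegrableOn (fun p : ℝ × Space d =>
          stableKernel α κ (t - p.1) (x - p.2) * b (u p.1.toNNReal p.2 ω))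
          (Ioo (0 : ℝ) t ×ˢ univ) ∧
        u t x ω = (∫ y, stableKernel α κ t (x - y) * u₀ y)
          + (∫ p in (Ioo (0 : ℝ) t ×ˢ (univ : Set (Space d))),
              stableKernel α κ (t - p.1) (x - p.2) * b (u p.1.toNNReal p.2 ω))
          + σ * X ω

/-! ### Gaussian integrals -/

section GaussianIntegrals

variable {d : ℕ}

/-! Let `X t x` be the stochastic convolution and `E` the event that the solution is global. On `E`,
dropping the nonnegative contribution of `u₀`, the solution satisfies `u ≥ ∫∫ G b(u) + σ X`.

Deterministic part. The mass that the stable kernel sends from a point of the unit cube back into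
the cube is at least some `c > 0`, for all times in `(0, 1]`
(`exists_lower_bound_stableKernel_unitCube`). If `σ X ≥ L` on a box `[T, T+1) × [0,1)^d`, then `u`
lies there above the flow of `c b` started at `L`. By the Osgood condition and the monotonicity of
`b`, that flow explodes before time `T + 1/2` once `L` is large (`exists_blowUp_level`). So on `E`
the noise term never reaches the level `L/σ` on a whole such box.

Oscillation. A spectral formula for the covariance (`rieszInner_convolutionKernel`) gives Hölder
bounds on the variance of increments (`exists_convCov_increment_le`). Chaining then shows that `X`
stays within `Λ` of `X T 0` on the box, outside an event of probability at most `ε`, where `Λ` does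
not depend on `T` (`exists_chaining_bound`). Hence `E ∩ {X n 0 ≥ L/σ + Λ}` has probability at most
`ε` for every positive integer `n` (`measure_inter_le_of_blowUp_level`).

Growth and decorrelation. The variance `V n` of `X n 0` tends to infinity, because the limiting
spectral integral is that of a pure power of `|ξ|` over the whole space. For fixed `m`, the
covariance of `X n 0` and `X m 0` is at most `V m`. The variables `Z n = X n 0 / √(V n)` are thus
eventually standard Gaussian and asymptotically orthogonal, so they tend weakly to `0` in `L²` and
`∫_E Z n → 0`. The thresholds `(L/σ + Λ)/√(V n)` also tend to `0`, so on `E` the positive part of `Z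
n` becomes negligible. Then `∫_E |Z n|` is small as well, which a standard Gaussian allows only if
`P E = 0` (`measure_eq_zero_of_gaussian_nonpos`). No ergodic theorem, zero-one law or continuous
version of `X` is used. -/

lemma integrable_exp_neg_mul_norm_sq {δ : ℝ} (hδ : 0 < δ) :
    Integrable fun ξ : Space d => Real.exp (-δ * ‖ξ‖ ^ 2) := by
  have h := (GaussianFourier.integrable_cexp_neg_mul_sq_norm_add (V := Space d) (b := (δ : ℂ))
    (by simpa using hδ) 0 0).norm
  refine h.congr (ae_of_all _ fun ξ => ?_)
  simp only [Complex.norm_exp]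
  congr 1
  simp [← Complex.ofReal_pow]

lemma integral_exp_neg_mul_norm_sq {δ : ℝ} (hδ : 0 < δ) :
    ∫ ξ : Space d, Real.exp (-δ * ‖ξ‖ ^ 2) = (Real.pi / δ) ^ ((d : ℝ) / 2) := by
  have := GaussianFourier.integral_rexp_neg_mul_sq_norm (V := Space d) hδ
  simpa using this

lemma integral_cos_mul_exp_neg_mul_norm_sq {δ : ℝ} (hδ : 0 < δ) (x : Space d) :
    ∫ ξ : Space d, Real.cos (inner ℝ x ξ) * Real.exp (-δ * ‖ξ‖ ^ 2) =
      (Real.pi / δ) ^ ((d : ℝ) / 2) * Real.exp (-‖x‖ ^ 2 / (4 * δ)) := by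
  have hδ' : 0 < (δ : ℂ).re := by simpa using hδ
  have h := GaussianFourier.integral_cexp_neg_mul_sq_norm_add (V := Space d) hδ' Complex.I x
  have hi := GaussianFourier.integrable_cexp_neg_mul_sq_norm_add (V := Space d) hδ' Complex.I x
  have h2 := congrArg Complex.re h
  rw [← RCLike.re_eq_complex_re, ← integral_re hi] at h2
  have e1 : ∀ ξ : Space d, RCLike.re (Complex.exp (-(δ : ℂ) * (‖ξ‖ : ℂ) ^ 2
      + Complex.I * ((inner ℝ x ξ : ℝ) : ℂ))) =
      Real.cos (inner ℝ x ξ) * Real.exp (-δ * ‖ξ‖ ^ 2) := by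
    intro ξ
    rw [RCLike.re_eq_complex_re, Complex.exp_re]
    simp [← Complex.ofReal_pow, mul_comm]
  simp_rw [e1] at h2
  rw [h2]
  have e2 : ((Real.pi : ℂ) / (δ : ℂ)) ^ ((Module.finrank ℝ (Space d) : ℂ) / 2) *
      Complex.exp (Complex.I ^ 2 * (‖x‖ : ℂ) ^ 2 / (4 * (δ : ℂ))) =
      (((Real.pi / δ) ^ ((d : ℝ) / 2) * Real.exp (-‖x‖ ^ 2 / (4 * δ)) : ℝ) : ℂ) := by
    rw [Complex.I_sq]
    push_cast
    rw [Complex.ofReal_cpow (by positivity)]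
    simp
  rw [e2, RCLike.re_eq_complex_re, Complex.ofReal_re]

end GaussianIntegrals

/-! ### Nonnegativity of the stable kernel -/

section Positivity

variable {d : ℕ}

/-- Bounded functions `ψ` such that `e^{-δ|ξ|²} ψ(ξ)` has a nonnegative cosine transform for
every `δ > 0`. -/
structure HasNonnegCosTransform (ψ : Space d → ℝ) : Prop where
  measurable : Measurable ψ
  bounded : ∃ C, ∀ ξ, |ψ ξ| ≤ C
  nonneg : ∀ δ : ℝ, 0 < δ → ∀ x : Space d,
    0 ≤ ∫ ξ : Space d, Real.cos (inner ℝ x ξ) * (Real.exp (-δ * ‖ξ‖ ^ 2) * ψ ξ)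

lemma measurable_cos_inner (x : Space d) : Measurable fun ξ : Space d => Real.cos (inner ℝ x ξ) := by
  fun_prop

lemma abs_cos_mul_exp_mul_le {δ C r : ℝ} (θ : ℝ) (ξ : Space d) (h : |r| ≤ C) :
    ‖Real.cos θ * (Real.exp (-δ * ‖ξ‖ ^ 2) * r)‖ ≤ C * Real.exp (-δ * ‖ξ‖ ^ 2) := by
  rw [norm_mul, norm_mul, Real.norm_eq_abs, Real.norm_eq_abs, Real.norm_eq_abs, Real.abs_exp]
  calc |Real.cos θ| * (Real.exp (-δ * ‖ξ‖ ^ 2) * |r|)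
      ≤ 1 * (Real.exp (-δ * ‖ξ‖ ^ 2) * C) := by
        gcongr
        exact Real.abs_cos_le_one _
    _ = _ := by ring

lemma integrable_cos_mul_exp_mul {ψ : Space d → ℝ} (hm : Measurable ψ) {C : ℝ}
    (hC : ∀ ξ, |ψ ξ| ≤ C) {δ : ℝ} (hδ : 0 < δ) (x : Space d) :
    Integrable fun ξ : Space d =>
      Real.cos (inner ℝ x ξ) * (Real.exp (-δ * ‖ξ‖ ^ 2) * ψ ξ) := by
  refine ((integrable_exp_neg_mul_norm_sq hδ).const_mul C).mono' ?_
    (ae_of_all _ fun ξ => abs_cos_mul_exp_mul_le _ ξ (hC ξ))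
  have := measurable_cos_inner x
  exact Measurable.aestronglyMeasurable (by fun_prop)

namespace HasNonnegCosTransform

lemma one : HasNonnegCosTransform (fun _ : Space d => (1 : ℝ)) where
  measurable := measurable_const
  bounded := ⟨1, by simp⟩
  nonneg δ hδ x := by
    simp only [mul_one]
    rw [integral_cos_mul_exp_neg_mul_norm_sq hδ]
    positivity

lemma add {ψ₁ ψ₂ : Space d → ℝ} (h₁ : HasNonnegCosTransform ψ₁) (h₂ : HasNonnegCosTransform ψ₂) :
    HasNonnegCosTransform fun ξ => ψ₁ ξ + ψ₂ ξ where
  measurable := h₁.measurable.add h₂.measurable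
  bounded := by
    obtain ⟨C₁, hC₁⟩ := h₁.bounded
    obtain ⟨C₂, hC₂⟩ := h₂.bounded
    exact ⟨C₁ + C₂, fun ξ => (abs_add_le _ _).trans (add_le_add (hC₁ ξ) (hC₂ ξ))⟩
  nonneg δ hδ x := by
    obtain ⟨C₁, hC₁⟩ := h₁.bounded
    obtain ⟨C₂, hC₂⟩ := h₂.bounded
    have := integral_add (integrable_cos_mul_exp_mul h₁.measurable hC₁ hδ x)
      (integrable_cos_mul_exp_mul h₂.measurable hC₂ hδ x)
    simp only [mul_add]
    rw [this]
    exact add_nonneg (h₁.nonneg δ hδ x) (h₂.nonneg δ hδ x)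

lemma const_mul {ψ : Space d → ℝ} (h : HasNonnegCosTransform ψ) {c : ℝ} (hc : 0 ≤ c) :
    HasNonnegCosTransform fun ξ => c * ψ ξ where
  measurable := h.measurable.const_mul c
  bounded := by
    obtain ⟨C, hC⟩ := h.bounded
    refine ⟨c * C, fun ξ => ?_⟩
    rw [abs_mul, abs_of_nonneg hc]
    gcongr
    exact hC ξ
  nonneg δ hδ x := by
    have : ∀ ξ : Space d, Real.cos (inner ℝ x ξ) * (Real.exp (-δ * ‖ξ‖ ^ 2) * (c * ψ ξ)) =
        c * (Real.cos (inner ℝ x ξ) * (Real.exp (-δ * ‖ξ‖ ^ 2) * ψ ξ)) := fun ξ => by ring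
    simp only [this]
    rw [integral_const_mul]
    exact mul_nonneg hc (h.nonneg δ hδ x)

lemma of_tendsto {ψs : ℕ → Space d → ℝ} {ψ : Space d → ℝ} {C : ℝ}
    (h : ∀ n, HasNonnegCosTransform (ψs n)) (hC : ∀ n ξ, |ψs n ξ| ≤ C)
    (hlim : ∀ ξ, Tendsto (fun n => ψs n ξ) atTop (𝓝 (ψ ξ))) : HasNonnegCosTransform ψ where
  measurable := measurable_of_tendsto_metrizable (fun n => (h n).measurable)
    (tendsto_pi_nhds.2 hlim)
  bounded := ⟨C, fun ξ => le_of_tendsto (hlim ξ).abs (Eventually.of_forall fun n => hC n ξ)⟩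
  nonneg δ hδ x := by
    refine ge_of_tendsto (tendsto_integral_of_dominated_convergence
      (F := fun n ξ => Real.cos (inner ℝ x ξ) * (Real.exp (-δ * ‖ξ‖ ^ 2) * ψs n ξ))
      (fun ξ => C * Real.exp (-δ * ‖ξ‖ ^ 2))
      (fun n => (integrable_cos_mul_exp_mul (h n).measurable (hC n) hδ x).aestronglyMeasurable)
      ((integrable_exp_neg_mul_norm_sq hδ).const_mul C)
      (fun n => ae_of_all _ fun ξ => abs_cos_mul_exp_mul_le _ ξ (hC n ξ))
      (ae_of_all _ fun ξ => ((hlim ξ).const_mul _).const_mul _))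
      (Eventually.of_forall fun n => (h n).nonneg δ hδ x)

/-- The factor `e^{-s|ξ|²}` is absorbed into the regularizer `e^{-δ|ξ|²}`. By Fubini the transform
becomes an average, with weight `g`, of the transforms of `ψ` at `δ + s`; this is why the class asks
for every `δ > 0`. -/
lemma mul_laplace {ψ : Space d → ℝ} (h : HasNonnegCosTransform ψ) {ε : ℝ} (hε : 0 ≤ ε)
    {g : ℝ → ℝ} (hg : ∀ s ∈ Ioi ε, 0 ≤ g s) (hgi : IntegrableOn g (Ioi ε)) :
    HasNonnegCosTransform fun ξ => (∫ s in Ioi ε, Real.exp (-s * ‖ξ‖ ^ 2) * g s) * ψ ξ := by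
  obtain ⟨C, hC⟩ := h.bounded
  have hC0 : 0 ≤ C := (abs_nonneg _).trans (hC 0)
  have hbd : ∀ ξ : Space d, |∫ s in Ioi ε, Real.exp (-s * ‖ξ‖ ^ 2) * g s| ≤
      ∫ s in Ioi ε, g s := fun ξ => by
    rw [abs_of_nonneg (setIntegral_nonneg measurableSet_Ioi fun s hs =>
      mul_nonneg (Real.exp_nonneg _) (hg s hs))]
    refine integral_mono_of_nonneg ?_ hgi ?_
    · filter_upwards [ae_restrict_mem measurableSet_Ioi] with s hs
      exact mul_nonneg (Real.exp_nonneg _) (hg s hs)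
    · filter_upwards [ae_restrict_mem measurableSet_Ioi] with s hs
      have : Real.exp (-s * ‖ξ‖ ^ 2) ≤ 1 := by
        rw [Real.exp_le_one_iff]
        have : 0 ≤ s := hε.trans (le_of_lt hs)
        nlinarith [mul_nonneg this (sq_nonneg ‖ξ‖)]
      exact mul_le_of_le_one_left (hg s hs) this
  have hsm : AEStronglyMeasurable (fun q : Space d × ℝ => g q.2)
      ((volume : Measure (Space d)).prod (volume.restrict (Ioi ε))) :=
    hgi.aestronglyMeasurable.comp_snd
  have hgm : Measurable fun ξ : Space d => ∫ s in Ioi ε, Real.exp (-s * ‖ξ‖ ^ 2) * g s := by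
    have hmk : ∀ ξ : Space d, ∫ s in Ioi ε, Real.exp (-s * ‖ξ‖ ^ 2) * g s =
        ∫ s in Ioi ε, Real.exp (-s * ‖ξ‖ ^ 2) * hgi.aestronglyMeasurable.mk g s := fun ξ => by
      refine integral_congr_ae ?_
      filter_upwards [hgi.aestronglyMeasurable.ae_eq_mk] with s hs
      rw [← hs]
    simp_rw [hmk]
    refine StronglyMeasurable.measurable (StronglyMeasurable.integral_prod_right'
      (f := fun q : Space d × ℝ => Real.exp (-q.2 * ‖q.1‖ ^ 2) *
        hgi.aestronglyMeasurable.mk g q.2) ?_)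
    have := hgi.aestronglyMeasurable.stronglyMeasurable_mk.measurable
    exact Measurable.stronglyMeasurable (by fun_prop)
  refine ⟨hgm.mul h.measurable, ⟨(∫ s in Ioi ε, g s) * C, fun ξ => ?_⟩, fun δ hδ x => ?_⟩
  · rw [abs_mul]
    exact mul_le_mul (hbd ξ) (hC ξ) (abs_nonneg _) ((abs_nonneg _).trans (hbd ξ))
  · have hint : Integrable (Function.uncurry fun (ξ : Space d) (s : ℝ) =>
        Real.cos (inner ℝ x ξ) * (Real.exp (-(δ + s) * ‖ξ‖ ^ 2) * ψ ξ) * g s)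
        ((volume : Measure (Space d)).prod (volume.restrict (Ioi ε))) := by
      refine Integrable.mono' (((integrable_exp_neg_mul_norm_sq hδ).const_mul C).mul_prod hgi)
        ?_ ?_
      · have := measurable_cos_inner x
        have := h.measurable
        refine AEStronglyMeasurable.mul (Measurable.aestronglyMeasurable ?_) hsm
        fun_prop
      · have : ∀ᵐ q : Space d × ℝ ∂((volume : Measure (Space d)).prod (volume.restrict (Ioi ε))),
            q.2 ∈ Ioi ε := Measure.quasiMeasurePreserving_snd.ae
              (ae_restrict_mem measurableSet_Ioi)
        filter_upwards [this] with q hq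
        have hs : 0 ≤ q.2 := hε.trans (le_of_lt hq)
        simp only [Function.uncurry]
        rw [norm_mul, Real.norm_of_nonneg (hg _ hq)]
        refine mul_le_mul_of_nonneg_right ?_ (hg _ hq)
        refine (abs_cos_mul_exp_mul_le _ q.1 (hC q.1)).trans ?_
        gcongr
        nlinarith [sq_nonneg ‖q.1‖]
    have heq : ∫ ξ : Space d, Real.cos (inner ℝ x ξ) * (Real.exp (-δ * ‖ξ‖ ^ 2) *
        ((∫ s in Ioi ε, Real.exp (-s * ‖ξ‖ ^ 2) * g s) * ψ ξ)) =
        ∫ s in Ioi ε, (∫ ξ : Space d,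
          Real.cos (inner ℝ x ξ) * (Real.exp (-(δ + s) * ‖ξ‖ ^ 2) * ψ ξ)) * g s := by
      simp_rw [← integral_mul_const]
      rw [← integral_integral_swap hint]
      refine integral_congr_ae (ae_of_all _ fun ξ => ?_)
      simp only
      rw [← integral_const_mul, ← integral_const_mul]
      refine integral_congr_ae (ae_of_all _ fun s => ?_)
      simp only
      rw [show -(δ + s) * ‖ξ‖ ^ 2 = -δ * ‖ξ‖ ^ 2 + -s * ‖ξ‖ ^ 2 by ring, Real.exp_add]
      ring
    rw [heq]
    refine setIntegral_nonneg measurableSet_Ioi fun s hs => mul_nonneg ?_ (hg s hs)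
    exact h.nonneg _ (by have : ε < s := hs; linarith) x

/-- All powers of a Laplace transform in `|ξ|²` stay in the class, hence so do the partial sums of
the exponential series. These are bounded uniformly, so the limit stays too. -/
lemma exp_laplace {ε : ℝ} (hε : 0 ≤ ε) {g : ℝ → ℝ} (hg : ∀ s ∈ Ioi ε, 0 ≤ g s)
    (hgi : IntegrableOn g (Ioi ε)) :
    HasNonnegCosTransform fun ξ : Space d =>
      Real.exp (∫ s in Ioi ε, Real.exp (-s * ‖ξ‖ ^ 2) * g s) := by
  set L : Space d → ℝ := fun ξ => ∫ s in Ioi ε, Real.exp (-s * ‖ξ‖ ^ 2) * g s with hL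
  have hpow : ∀ k : ℕ, HasNonnegCosTransform fun ξ : Space d => L ξ ^ k := by
    intro k
    induction k with
    | zero => simpa using one
    | succ k ih =>
      have := ih.mul_laplace hε hg hgi
      simp only [pow_succ' (L _)]
      exact this
  obtain ⟨C, hC⟩ := (hpow 1).bounded
  simp only [pow_one] at hC
  have hsum : ∀ n : ℕ, HasNonnegCosTransform fun ξ : Space d =>
      ∑ k ∈ Finset.range n, L ξ ^ k / (k.factorial : ℝ) := by
    intro n
    induction n with
    | zero => simpa using one.const_mul (le_refl (0 : ℝ))
    | succ n ih =>
      simp only [Finset.sum_range_succ]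
      refine ih.add ?_
      have := (hpow n).const_mul (c := ((n.factorial : ℝ))⁻¹) (by positivity)
      simpa only [div_eq_inv_mul] using this
  refine of_tendsto (C := Real.exp C) hsum (fun n ξ => ?_) fun ξ => ?_
  · have hC0 : 0 ≤ C := (abs_nonneg _).trans (hC ξ)
    calc |∑ k ∈ Finset.range n, L ξ ^ k / (k.factorial : ℝ)|
        ≤ ∑ k ∈ Finset.range n, |L ξ ^ k / (k.factorial : ℝ)| := Finset.abs_sum_le_sum_abs _ _
      _ ≤ ∑ k ∈ Finset.range n, C ^ k / (k.factorial : ℝ) := by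
          refine Finset.sum_le_sum fun k _ => ?_
          rw [abs_div, abs_pow, Nat.abs_cast]
          gcongr
          exact hC ξ
      _ ≤ Real.exp C := Real.sum_le_exp_of_nonneg hC0 n
  · have := (NormedSpace.expSeries_div_hasSum_exp (L ξ)).tendsto_sum_nat
    rwa [← Real.exp_eq_exp_ℝ] at this

end HasNonnegCosTransform

end Positivity

/-! ### The Bernstein representation of the power `r^γ`, `0 < γ < 1`. -/

section Bernstein

lemma integrableOn_one_sub_exp_mul_rpow {γ r : ℝ} (hγ : 0 < γ) (hγ1 : γ < 1) (hr : 0 ≤ r) :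
    IntegrableOn (fun s : ℝ => (1 - Real.exp (-s * r)) * s ^ (-1 - γ)) (Ioi 0) := by
  have hmeas : Measurable fun s : ℝ => (1 - Real.exp (-s * r)) * s ^ (-1 - γ) := by fun_prop
  rw [← Ioc_union_Ioi_eq_Ioi (zero_le_one (α := ℝ))]
  refine IntegrableOn.union ?_ ?_
  · have h1 : IntegrableOn (fun s : ℝ => r * s ^ (-γ)) (Ioc 0 1) := by
      have := (intervalIntegral.intervalIntegrable_rpow' (a := 0) (b := 1) (r := -γ)
        (by linarith)).const_mul r
      rwa [intervalIntegrable_iff_integrableOn_Ioc_of_le zero_le_one] at this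
    refine Integrable.mono' h1 hmeas.aestronglyMeasurable ?_
    filter_upwards [ae_restrict_mem measurableSet_Ioc] with s hs
    have h2 : 1 - Real.exp (-s * r) ≤ s * r := by
      have := Real.add_one_le_exp (-s * r); linarith
    have h3 : 0 ≤ 1 - Real.exp (-s * r) := by
      have : Real.exp (-s * r) ≤ 1 := Real.exp_le_one_iff.2 (by nlinarith [hs.1])
      linarith
    have h4 : (0 : ℝ) ≤ s ^ (-1 - γ) := Real.rpow_nonneg hs.1.le _
    rw [Real.norm_of_nonneg (mul_nonneg h3 h4)]
    calc (1 - Real.exp (-s * r)) * s ^ (-1 - γ) ≤ (s * r) * s ^ (-1 - γ) := by gcongr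
      _ = r * s ^ (-γ) := by
        rw [show -γ = 1 + (-1 - γ) by ring, Real.rpow_add hs.1, Real.rpow_one]
        ring_nf
  · have h1 : IntegrableOn (fun s : ℝ => s ^ (-1 - γ)) (Ioi 1) :=
      integrableOn_Ioi_rpow_of_lt (by linarith) zero_lt_one
    refine Integrable.mono' h1 hmeas.aestronglyMeasurable ?_
    filter_upwards [ae_restrict_mem measurableSet_Ioi] with s hs
    have hs0 : (0 : ℝ) < s := zero_lt_one.trans hs
    have h3 : 0 ≤ 1 - Real.exp (-s * r) := by
      have : Real.exp (-s * r) ≤ 1 := Real.exp_le_one_iff.2 (by nlinarith)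
      linarith
    have h4 : (0 : ℝ) ≤ s ^ (-1 - γ) := Real.rpow_nonneg hs0.le _
    rw [Real.norm_of_nonneg (mul_nonneg h3 h4)]
    exact mul_le_of_le_one_left h4 (by linarith [Real.exp_pos (-s * r)])

/-- The substitution `s ↦ r s` extracts the power of `r`. With `r = |ξ|²` and `γ = α/2` this writes
`|ξ|^α` as a mixture of the functions `1 - e^{-s|ξ|²}`. -/
lemma integral_one_sub_exp_mul_rpow {γ r : ℝ} (hγ : 0 < γ) (hr : 0 ≤ r) :
    ∫ s in Ioi (0 : ℝ), (1 - Real.exp (-s * r)) * s ^ (-1 - γ) =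
      r ^ γ * ∫ s in Ioi (0 : ℝ), (1 - Real.exp (-s)) * s ^ (-1 - γ) := by
  rcases hr.eq_or_lt with rfl | hr
  · simp [Real.zero_rpow hγ.ne']
  have h := integral_comp_mul_left_Ioi (fun s : ℝ => (1 - Real.exp (-s)) * s ^ (-1 - γ)) 0 hr
  rw [mul_zero, smul_eq_mul] at h
  have h1 : r ^ γ * ∫ s in Ioi (0 : ℝ), (1 - Real.exp (-s)) * s ^ (-1 - γ) =
      r ^ (1 + γ) * ∫ s in Ioi (0 : ℝ), (1 - Real.exp (-(r * s))) * (r * s) ^ (-1 - γ) := by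
    rw [h, Real.rpow_add hr, Real.rpow_one]
    field_simp
  rw [h1, ← integral_const_mul]
  refine setIntegral_congr_fun measurableSet_Ioi fun s hs => ?_
  rw [Real.mul_rpow hr.le (le_of_lt hs), show -1 - γ = -(1 + γ) by ring, Real.rpow_neg hr.le]
  have := (Real.rpow_pos_of_pos hr (1 + γ)).ne'
  rw [show -s * r = -(r * s) by ring]
  field_simp

lemma integral_one_sub_exp_mul_rpow_pos {γ : ℝ} (hγ : 0 < γ) (hγ1 : γ < 1) :
    0 < ∫ s in Ioi (0 : ℝ), (1 - Real.exp (-s)) * s ^ (-1 - γ) := by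
  have hi := integrableOn_one_sub_exp_mul_rpow hγ hγ1 zero_le_one
  simp only [mul_one] at hi
  have hpos : ∀ s ∈ Ioi (0 : ℝ), 0 < (1 - Real.exp (-s)) * s ^ (-1 - γ) := fun s hs =>
    mul_pos (by have : Real.exp (-s) < 1 := (Real.exp_lt_one_iff (x := -s)).2 (by simpa using hs)
                linarith) (Real.rpow_pos_of_pos hs _)
  rw [setIntegral_pos_iff_support_of_nonneg_ae _ hi]
  · refine lt_of_lt_of_le ?_ (measure_mono (s := Ioi (0 : ℝ)) fun s hs =>
      ⟨(hpos s hs).ne', hs⟩)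
    simp
  · filter_upwards [ae_restrict_mem measurableSet_Ioi] with s hs
    exact (hpos s hs).le

end Bernstein

/-! ### Positive definiteness of the stable characteristic function, by subordination. -/

section StablePositivity

variable {d : ℕ}

/-- Subordination: in the Bernstein representation of `|ξ|^α`, cut off at `s > ε`, the exponential
is a positive constant times the exponential of a Laplace transform. The case `α = 2` is separate,
since the representation diverges for `γ = 1` and the function is already Gaussian. -/
lemma HasNonnegCosTransform.exp_neg_norm_rpow {α A : ℝ} (hα : 0 < α) (hα2 : α ≤ 2) (hA : 0 ≤ A) :
    HasNonnegCosTransform fun ξ : Space d => Real.exp (-(A * ‖ξ‖ ^ α)) := by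
  rcases hα2.eq_or_lt with rfl | hα2
  · refine ⟨by fun_prop, ⟨1, fun ξ => ?_⟩, fun δ hδ x => ?_⟩
    · rw [Real.abs_exp, Real.exp_le_one_iff]
      have : 0 ≤ A * ‖ξ‖ ^ (2 : ℝ) := by positivity
      linarith
    · have h := HasNonnegCosTransform.one.nonneg (δ + A) (by linarith) x
      refine h.trans_eq (integral_congr_ae (ae_of_all _ fun ξ => ?_))
      simp only [Real.rpow_two]
      rw [← Real.exp_add, mul_one]
      ring_nf
  set γ := α / 2 with hγ
  have hγ0 : 0 < γ := by positivity
  have hγ1 : γ < 1 := by linarith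
  set c := ∫ s in Ioi (0 : ℝ), (1 - Real.exp (-s)) * s ^ (-1 - γ) with hc
  have hcpos : 0 < c := integral_one_sub_exp_mul_rpow_pos hγ0 hγ1
  set g : ℝ → ℝ := fun s => A / c * s ^ (-1 - γ) with hg
  -- The cutoff makes `s^{-1-γ}` integrable, so that the terms `1` and `e^{-s|ξ|²}` can be
  -- integrated separately; monotone exhaustion of `(0, ∞)` removes it at the end.
  set ε : ℕ → ℝ := fun n => ((n : ℝ) + 1)⁻¹ with hε
  have hε0 : ∀ n, 0 < ε n := fun n => by positivity
  have hg0 : ∀ n, ∀ s ∈ Ioi (ε n), 0 ≤ g s := fun n s hs =>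
    mul_nonneg (by positivity) (Real.rpow_nonneg ((hε0 n).le.trans (le_of_lt hs)) _)
  have hgi : ∀ n, IntegrableOn g (Ioi (ε n)) := fun n =>
    (integrableOn_Ioi_rpow_of_lt (by linarith) (hε0 n)).const_mul _
  have key : ∀ n (ξ : Space d), Real.exp (-∫ s in Ioi (ε n), g s) *
      Real.exp (∫ s in Ioi (ε n), Real.exp (-s * ‖ξ‖ ^ 2) * g s) =
      Real.exp (-(A / c * ∫ s in Ioi (ε n), (1 - Real.exp (-s * ‖ξ‖ ^ 2)) * s ^ (-1 - γ))) := by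
    intro n ξ
    have hexp : IntegrableOn (fun s => Real.exp (-s * ‖ξ‖ ^ 2) * g s) (Ioi (ε n)) := by
      refine Integrable.mono' (hgi n) ?_ ?_
      · exact Measurable.aestronglyMeasurable (by fun_prop)
      · filter_upwards [ae_restrict_mem measurableSet_Ioi] with s hs
        rw [norm_mul, Real.norm_of_nonneg (hg0 n s hs), Real.norm_of_nonneg (Real.exp_nonneg _)]
        refine mul_le_of_le_one_left (hg0 n s hs) (Real.exp_le_one_iff.2 ?_)
        have : 0 < s := (hε0 n).trans hs
        nlinarith [mul_nonneg this.le (sq_nonneg ‖ξ‖)]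
    rw [← Real.exp_add]
    congr 1
    rw [← integral_const_mul, neg_add_eq_sub, ← neg_sub, ← integral_sub (hgi n) hexp]
    congr 1
    refine integral_congr_ae (ae_of_all _ fun s => ?_)
    simp only [hg]
    ring
  have hn0 : ∀ (ξ : Space d), ∀ s ∈ Ioi (0 : ℝ), 0 ≤ (1 - Real.exp (-s * ‖ξ‖ ^ 2)) * s ^ (-1 - γ) := by
    intro ξ s hs
    have hs : 0 < s := hs
    refine mul_nonneg ?_ (Real.rpow_nonneg hs.le _)
    have : Real.exp (-s * ‖ξ‖ ^ 2) ≤ 1 :=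
      Real.exp_le_one_iff.2 (by nlinarith [mul_nonneg hs.le (sq_nonneg ‖ξ‖)])
    linarith
  refine HasNonnegCosTransform.of_tendsto (C := 1) (ψs := fun n ξ => Real.exp (-∫ s in Ioi (ε n), g s) *
      Real.exp (∫ s in Ioi (ε n), Real.exp (-s * ‖ξ‖ ^ 2) * g s))
      (fun n => (HasNonnegCosTransform.exp_laplace (hε0 n).le (hg0 n) (hgi n)).const_mul (Real.exp_nonneg _)) (fun n ξ => ?_)
      (fun ξ => ?_)
  · rw [key, Real.abs_exp, Real.exp_le_one_iff, neg_nonpos]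
    refine mul_nonneg (by positivity) (setIntegral_nonneg measurableSet_Ioi fun s hs => ?_)
    exact hn0 ξ s ((hε0 n).trans hs)
  · simp only [key]
    have hlim : Tendsto (fun n => ∫ s in Ioi (ε n), (1 - Real.exp (-s * ‖ξ‖ ^ 2)) * s ^ (-1 - γ))
        atTop (𝓝 (∫ s in ⋃ n, Ioi (ε n), (1 - Real.exp (-s * ‖ξ‖ ^ 2)) * s ^ (-1 - γ))) := by
      refine tendsto_setIntegral_of_monotone (fun n => measurableSet_Ioi) ?_ ?_
      · intro m n hmn
        refine Ioi_subset_Ioi ?_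
        simp only [hε]
        gcongr
      · refine (integrableOn_one_sub_exp_mul_rpow hγ0 hγ1 (sq_nonneg ‖ξ‖)).mono_set ?_
        exact iUnion_subset fun n => Ioi_subset_Ioi (hε0 n).le
    have hU : ⋃ n, Ioi (ε n) = Ioi (0 : ℝ) := by
      refine Subset.antisymm (iUnion_subset fun n => Ioi_subset_Ioi (hε0 n).le) fun s hs => ?_
      obtain ⟨n, hn⟩ := exists_nat_one_div_lt (show (0 : ℝ) < s from hs)
      exact mem_iUnion.2 ⟨n, by simpa [hε] using hn⟩
    rw [hU, integral_one_sub_exp_mul_rpow hγ0 (sq_nonneg _), ← hc] at hlim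
    have h2 : (‖ξ‖ ^ 2) ^ γ = ‖ξ‖ ^ α := by
      rw [← Real.rpow_natCast, ← Real.rpow_mul (norm_nonneg _)]
      congr 1
      rw [hγ]
      push_cast
      ring
    have h3 := ((hlim.const_mul (A / c)).neg).rexp
    rw [h2] at h3
    convert h3 using 3
    field_simp

end StablePositivity

/-! ### The stable kernel: positivity, integrability, Fourier transform. -/

section StableKernel

variable {d : ℕ}

lemma Space.nontrivial (hd : 0 < d) : Nontrivial (Space d) := by
  have : Nonempty (Fin d) := ⟨⟨0, hd⟩⟩
  infer_instance

lemma integrable_norm_rpow_mul_exp (hd : 0 < d) {α A q : ℝ} (hα : 0 < α) (hA : 0 < A)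
    (hq : -(d : ℝ) < q) :
    Integrable fun ξ : Space d => ‖ξ‖ ^ q * Real.exp (-(A * ‖ξ‖ ^ α)) := by
  have := Space.nontrivial hd
  refine (integrable_fun_norm_addHaar (volume : Measure (Space d))
    (f := fun r : ℝ => r ^ q * Real.exp (-(A * r ^ α)))).2 ?_
  have hpos : (-1 : ℝ) < ((d : ℝ) - 1) + q := by linarith
  have h := integral_rpow_mul_exp_neg_mul_rpow hα hpos hA
  have hi : IntegrableOn (fun x : ℝ => x ^ (((d : ℝ) - 1) + q) * Real.exp (-A * x ^ α)) (Ioi 0) := by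
    -- A nonintegrable function has Bochner integral `0`, so the positive Gamma value itself
    -- certifies integrability. The same device recurs below.
    refine Integrable.of_integral_ne_zero ?_
    rw [h]
    have := Real.Gamma_pos_of_pos (s := ((d : ℝ) - 1 + q + 1) / α)
      (div_pos (by linarith) hα)
    positivity
  refine hi.congr_fun (fun r hr => ?_) measurableSet_Ioi
  have hr : 0 < r := hr
  simp only [finrank_euclideanSpace, Fintype.card_fin, smul_eq_mul]
  rw [Real.rpow_add hr, ← Real.rpow_natCast, Nat.cast_sub (by omega)]
  push_cast
  ring_nf

lemma integrable_exp_neg_norm_rpow (hd : 0 < d) {α A : ℝ} (hα : 0 < α) (hA : 0 < A) :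
    Integrable fun ξ : Space d => Real.exp (-(A * ‖ξ‖ ^ α)) := by
  have := integrable_norm_rpow_mul_exp hd (q := 0) hα hA (by simpa using hd)
  simpa using this

lemma integrable_cos_mul_of_integrable {f : Space d → ℝ} (hf : Integrable f) (x : Space d) :
    Integrable fun ξ : Space d => Real.cos (inner ℝ x ξ) * f ξ := by
  refine hf.norm.mono' ?_ (ae_of_all _ fun ξ => ?_)
  · exact (measurable_cos_inner x).aestronglyMeasurable.mul hf.aestronglyMeasurable
  · rw [norm_mul]
    exact mul_le_of_le_one_left (norm_nonneg _) (Real.abs_cos_le_one _)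

lemma continuous_exp_neg_norm_rpow {α A : ℝ} (hα : 0 < α) :
    Continuous fun ξ : Space d => Real.exp (-(A * ‖ξ‖ ^ α)) := by
  have : Continuous fun ξ : Space d => ‖ξ‖ ^ α := continuous_norm.rpow_const fun _ => Or.inr hα.le
  fun_prop

lemma stableKernel_nonneg (hd : 0 < d) {α κ t : ℝ} (hα : 0 < α) (hα2 : α ≤ 2) (hκ : 0 < κ)
    (ht : 0 < t) (z : Space d) : 0 ≤ stableKernel α κ t z := by
  have hA : 0 < κ * t := mul_pos hκ ht
  refine mul_nonneg (by positivity) ?_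
  have hi := integrable_exp_neg_norm_rpow hd (d := d) hα hA
  have hlim : Tendsto (fun n : ℕ => ∫ ξ : Space d, Real.cos (inner ℝ z ξ) *
      (Real.exp (-((n : ℝ) + 1)⁻¹ * ‖ξ‖ ^ 2) * Real.exp (-(κ * t * ‖ξ‖ ^ α)))) atTop
      (𝓝 (∫ ξ : Space d, Real.cos (inner ℝ z ξ) * Real.exp (-(κ * t * ‖ξ‖ ^ α)))) := by
    refine tendsto_integral_of_dominated_convergence
      (fun ξ => Real.exp (-(κ * t * ‖ξ‖ ^ α))) (fun n => ?_) hi (fun n => ae_of_all _ fun ξ => ?_)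
      (ae_of_all _ fun ξ => ?_)
    · have := measurable_cos_inner z
      exact Measurable.aestronglyMeasurable (by fun_prop)
    · rw [norm_mul, norm_mul, Real.norm_eq_abs, Real.norm_eq_abs, Real.norm_eq_abs, Real.abs_exp,
        Real.abs_exp]
      have h1 : Real.exp (-((n : ℝ) + 1)⁻¹ * ‖ξ‖ ^ 2) ≤ 1 := by
        rw [Real.exp_le_one_iff, neg_mul, neg_nonpos]
        positivity
      calc _ ≤ 1 * (1 * Real.exp (-(κ * t * ‖ξ‖ ^ α))) := by
            gcongr
            exact Real.abs_cos_le_one _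
        _ = _ := by ring
    · have h1 : Tendsto (fun n : ℕ => -((n : ℝ) + 1)⁻¹ * ‖ξ‖ ^ 2) atTop (𝓝 (-0 * ‖ξ‖ ^ 2)) := by
        have := tendsto_one_div_add_atTop_nhds_zero_nat (𝕜 := ℝ)
        simp only [one_div] at this
        exact this.neg.mul_const _
      have h2 := (h1.rexp.mul_const (Real.exp (-(κ * t * ‖ξ‖ ^ α)))).const_mul
        (Real.cos (inner ℝ z ξ))
      simpa using h2
  refine ge_of_tendsto hlim (Eventually.of_forall fun n => ?_)
  exact (HasNonnegCosTransform.exp_neg_norm_rpow hα hα2 hA.le).nonneg _ (by positivity) z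

lemma measurable_stableKernel {α κ : ℝ} :
    Measurable fun q : ℝ × Space d => stableKernel α κ q.1 q.2 := by
  unfold stableKernel
  refine Measurable.const_mul ?_ _
  refine (StronglyMeasurable.integral_prod_right' (f := fun q : (ℝ × Space d) × Space d =>
    Real.cos (inner ℝ q.1.2 q.2) * Real.exp (-(κ * q.1.1 * ‖q.2‖ ^ α))) ?_).measurable
  have : Measurable fun q : (ℝ × Space d) × Space d => inner ℝ q.1.2 q.2 :=
    (measurable_fst.snd).inner measurable_snd
  exact Measurable.stronglyMeasurable (by fun_prop)

lemma continuous_stableKernel (hd : 0 < d) {α κ t : ℝ} (hα : 0 < α) (hκ : 0 < κ) (ht : 0 < t) :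
    Continuous fun z : Space d => stableKernel α κ t z := by
  refine Continuous.mul continuous_const ?_
  refine continuous_of_dominated (bound := fun ξ => Real.exp (-(κ * t * ‖ξ‖ ^ α))) (fun z => ?_)
    (fun z => ae_of_all _ fun ξ => ?_) (integrable_exp_neg_norm_rpow hd hα (mul_pos hκ ht))
    (ae_of_all _ fun ξ => ?_)
  · exact (integrable_cos_mul_of_integrable
      (integrable_exp_neg_norm_rpow hd hα (mul_pos hκ ht)) z).aestronglyMeasurable
  · rw [norm_mul, Real.norm_eq_abs, Real.norm_eq_abs, Real.abs_exp]
    exact mul_le_of_le_one_left (Real.exp_nonneg _) (Real.abs_cos_le_one _)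
  · fun_prop

/-- Fubini replaces the Gaussian damping by its transform, a Gaussian in `ξ` of total mass `(2π)^d`,
while the stable factor is at most `1`. Because the bound is uniform in `δ`, the damping can be
removed by Fatou's lemma. -/
lemma integral_exp_mul_stableKernel_le (hd : 0 < d) {α κ t δ : ℝ} (hα : 0 < α) (hκ : 0 < κ)
    (ht : 0 < t) (hδ : 0 < δ) :
    Integrable (fun z : Space d => stableKernel α κ t z * Real.exp (-δ * ‖z‖ ^ 2)) ∧
    ∫ z : Space d, stableKernel α κ t z * Real.exp (-δ * ‖z‖ ^ 2) ≤ 1 := by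
  have hA : 0 < κ * t := mul_pos hκ ht
  have hi := integrable_exp_neg_norm_rpow hd (d := d) hα hA
  have hg := integrable_exp_neg_mul_norm_sq (d := d) hδ
  have hint : Integrable (Function.uncurry fun (z ξ : Space d) =>
      ((2 * Real.pi) ^ d)⁻¹ * (Real.cos (inner ℝ z ξ) * Real.exp (-(κ * t * ‖ξ‖ ^ α))) *
        Real.exp (-δ * ‖z‖ ^ 2)) (volume.prod volume) := by
    refine Integrable.mono' ((hg.mul_prod hi).const_mul ((2 * Real.pi) ^ d)⁻¹) ?_
      (ae_of_all _ fun q => ?_)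
    · have : Measurable fun q : Space d × Space d => inner ℝ q.1 q.2 :=
        measurable_fst.inner measurable_snd
      exact Measurable.aestronglyMeasurable (by unfold Function.uncurry; fun_prop)
    · simp only [Function.uncurry]
      rw [norm_mul, norm_mul, norm_mul, Real.norm_of_nonneg (Real.exp_nonneg _),
        Real.norm_of_nonneg (Real.exp_nonneg _), Real.norm_of_nonneg (by positivity :
        0 ≤ ((2 * Real.pi) ^ d)⁻¹), mul_assoc]
      refine mul_le_mul_of_nonneg_left ?_ (by positivity)
      calc _ ≤ 1 * Real.exp (-(κ * t * ‖q.2‖ ^ α)) * Real.exp (-δ * ‖q.1‖ ^ 2) := by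
            gcongr
            exact Real.abs_cos_le_one _
        _ = _ := by ring
  have heq : ∀ z : Space d, stableKernel α κ t z * Real.exp (-δ * ‖z‖ ^ 2) =
      ∫ ξ : Space d, ((2 * Real.pi) ^ d)⁻¹ *
        (Real.cos (inner ℝ z ξ) * Real.exp (-(κ * t * ‖ξ‖ ^ α))) * Real.exp (-δ * ‖z‖ ^ 2) := by
    intro z
    rw [integral_mul_const, integral_const_mul, stableKernel]
  constructor
  · simp_rw [heq]
    exact hint.integral_prod_left
  · simp_rw [heq]
    rw [integral_integral_swap hint]
    have h1 : ∀ ξ : Space d, ∫ z : Space d, ((2 * Real.pi) ^ d)⁻¹ *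
        (Real.cos (inner ℝ z ξ) * Real.exp (-(κ * t * ‖ξ‖ ^ α))) * Real.exp (-δ * ‖z‖ ^ 2) =
        ((2 * Real.pi) ^ d)⁻¹ * ((Real.pi / δ) ^ ((d : ℝ) / 2) *
          (Real.exp (-(κ * t * ‖ξ‖ ^ α)) * Real.exp (-(4 * δ)⁻¹ * ‖ξ‖ ^ 2))) := by
      intro ξ
      have := integral_cos_mul_exp_neg_mul_norm_sq hδ ξ
      rw [show -‖ξ‖ ^ 2 / (4 * δ) = -(4 * δ)⁻¹ * ‖ξ‖ ^ 2 by field_simp] at this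
      rw [mul_left_comm ((Real.pi / δ) ^ ((d : ℝ) / 2)), ← this, ← integral_const_mul,
        ← integral_const_mul]
      refine integral_congr_ae (ae_of_all _ fun z => ?_)
      simp only [real_inner_comm]
      ring
    simp_rw [h1]
    rw [integral_const_mul, integral_const_mul]
    have h4 : 0 < (4 * δ)⁻¹ := by positivity
    have h2 : ∫ ξ : Space d, Real.exp (-(κ * t * ‖ξ‖ ^ α)) * Real.exp (-(4 * δ)⁻¹ * ‖ξ‖ ^ 2) ≤
        (Real.pi / (4 * δ)⁻¹) ^ ((d : ℝ) / 2) := by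
      rw [← integral_exp_neg_mul_norm_sq h4]
      refine integral_mono_of_nonneg (ae_of_all _ fun ξ => by positivity)
        (integrable_exp_neg_mul_norm_sq h4) (ae_of_all _ fun ξ => ?_)
      refine mul_le_of_le_one_left (Real.exp_nonneg _) (Real.exp_le_one_iff.2 ?_)
      rw [neg_nonpos]
      positivity
    calc _ ≤ ((2 * Real.pi) ^ d)⁻¹ * ((Real.pi / δ) ^ ((d : ℝ) / 2) *
          (Real.pi / (4 * δ)⁻¹) ^ ((d : ℝ) / 2)) := by gcongr
      _ = 1 := by
        rw [← Real.mul_rpow (by positivity) (by positivity)]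
        have : Real.pi / δ * (Real.pi / (4 * δ)⁻¹) = (2 * Real.pi) ^ 2 := by
          field_simp; ring
        rw [this, ← Real.rpow_natCast (2 * Real.pi) 2, ← Real.rpow_mul (by positivity)]
        have : ((2 : ℕ) : ℝ) * ((d : ℝ) / 2) = d := by push_cast; ring
        rw [this, Real.rpow_natCast, inv_mul_cancel₀ (by positivity)]

lemma integrable_stableKernel (hd : 0 < d) {α κ t : ℝ} (hα : 0 < α) (hα2 : α ≤ 2) (hκ : 0 < κ)
    (ht : 0 < t) : Integrable fun z : Space d => stableKernel α κ t z := by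
  have hm := (continuous_stableKernel hd hα hκ ht (d := d)).measurable
  have h0 := stableKernel_nonneg hd hα hα2 hκ ht (d := d)
  refine ⟨hm.aestronglyMeasurable, ?_⟩
  rw [hasFiniteIntegral_iff_ofReal (ae_of_all _ h0)]
  have hlim : ∀ z : Space d, Tendsto (fun n : ℕ => ENNReal.ofReal (stableKernel α κ t z *
      Real.exp (-((n : ℝ) + 1)⁻¹ * ‖z‖ ^ 2))) atTop (𝓝 (ENNReal.ofReal (stableKernel α κ t z))) := by
    intro z
    refine ENNReal.tendsto_ofReal ?_
    have h1 : Tendsto (fun n : ℕ => -((n : ℝ) + 1)⁻¹ * ‖z‖ ^ 2) atTop (𝓝 (-0 * ‖z‖ ^ 2)) := by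
      have := tendsto_one_div_add_atTop_nhds_zero_nat (𝕜 := ℝ)
      simp only [one_div] at this
      exact this.neg.mul_const _
    simpa using h1.rexp.const_mul (stableKernel α κ t z)
  have hle : ∫⁻ z : Space d, ENNReal.ofReal (stableKernel α κ t z) ≤ 1 := by
    calc ∫⁻ z : Space d, ENNReal.ofReal (stableKernel α κ t z)
        = ∫⁻ z : Space d, liminf (fun n : ℕ => ENNReal.ofReal (stableKernel α κ t z *
      Real.exp (-((n : ℝ) + 1)⁻¹ * ‖z‖ ^ 2))) atTop := by
          refine lintegral_congr fun z => ((hlim z).liminf_eq).symm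
      _ ≤ liminf (fun n : ℕ => ∫⁻ z : Space d, ENNReal.ofReal (stableKernel α κ t z *
      Real.exp (-((n : ℝ) + 1)⁻¹ * ‖z‖ ^ 2))) atTop :=
          lintegral_liminf_le fun n => (by fun_prop)
      _ ≤ liminf (fun n : ℕ => (1 : ℝ≥0∞)) atTop := by
          refine liminf_le_liminf (Eventually.of_forall fun n => ?_)
          obtain ⟨h1, h2⟩ := integral_exp_mul_stableKernel_le hd hα hκ ht (d := d)
            (δ := ((n : ℝ) + 1)⁻¹) (by positivity)
          rw [← ofReal_integral_eq_lintegral_ofReal h1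
            (ae_of_all _ fun z => mul_nonneg (h0 z) (Real.exp_nonneg _))]
          exact ENNReal.ofReal_le_one.2 h2
      _ = 1 := by simp
  exact hle.trans_lt ENNReal.one_lt_top

lemma stableKernel_neg {α κ t : ℝ} (z : Space d) :
    stableKernel α κ t (-z) = stableKernel α κ t z := by
  simp [stableKernel, inner_neg_left]

lemma integral_eq_zero_of_odd {f : Space d → ℝ} (h : ∀ x, f (-x) = -f x) : ∫ x, f x = 0 := by
  have h1 : ∫ x, f (-x) = ∫ x, f x := integral_neg_eq_self f volume
  simp_rw [h, integral_neg] at h1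
  linarith

/-- The library transform uses `e^{-2πi⟨v,w⟩}`, whence the argument `2πw` and the factor `(2π)^d`.
The imaginary part vanishes because its integrand is odd. -/
lemma fourier_exp_neg_norm_rpow (hd : 0 < d) {α κ t : ℝ} (hα : 0 < α) (hκ : 0 < κ) (ht : 0 < t)
    (w : Space d) :
    FourierTransform.fourier
      (fun v : Space d => ((Real.exp (-(κ * t * ‖v‖ ^ α)) : ℝ) : ℂ)) w =
      (((2 * Real.pi) ^ d * stableKernel α κ t ((2 * Real.pi) • w) : ℝ) : ℂ) := by
  have hi := integrable_exp_neg_norm_rpow hd (d := d) hα (mul_pos hκ ht)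
  have hint : Integrable fun v : Space d =>
      Complex.exp ((↑(-2 * Real.pi * inner ℝ v w) * Complex.I)) •
        ((Real.exp (-(κ * t * ‖v‖ ^ α)) : ℝ) : ℂ) := by
    refine hi.mono' ?_ (ae_of_all _ fun v => ?_)
    · have : Measurable fun v : Space d => inner ℝ v w := measurable_id.inner measurable_const
      exact Measurable.aestronglyMeasurable (by fun_prop)
    · rw [norm_smul, Complex.norm_exp_ofReal_mul_I, one_mul, Complex.norm_real,
        Real.norm_of_nonneg (Real.exp_nonneg _)]
  rw [Real.fourier_eq']
  apply Complex.ext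
  · rw [Complex.ofReal_re, ← RCLike.re_eq_complex_re, ← integral_re hint, stableKernel,
      mul_inv_cancel_left₀ (by positivity)]
    refine integral_congr_ae (ae_of_all _ fun v => ?_)
    simp only [RCLike.re_eq_complex_re, smul_eq_mul, Complex.re_mul_ofReal,
      Complex.exp_ofReal_mul_I_re]
    congr 1
    rw [inner_smul_left, real_inner_comm, neg_mul, neg_mul, Real.cos_neg]
    simp
  · rw [Complex.ofReal_im, ← RCLike.im_eq_complex_im, ← integral_im hint]
    refine integral_eq_zero_of_odd fun v => ?_
    simp only [RCLike.im_eq_complex_im, smul_eq_mul, Complex.im_mul_ofReal,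
      Complex.exp_ofReal_mul_I_im, inner_neg_left, norm_neg]
    rw [mul_neg, Real.sin_neg, neg_mul]

/-- Fourier inversion, available because the kernel has been shown to be integrable. -/
lemma integral_stableKernel_mul_cos (hd : 0 < d) {α κ t : ℝ} (hα : 0 < α) (hα2 : α ≤ 2)
    (hκ : 0 < κ) (ht : 0 < t) (ξ : Space d) :
    ∫ z : Space d, stableKernel α κ t z * Real.cos (inner ℝ ξ z) =
      Real.exp (-(κ * t * ‖ξ‖ ^ α)) := by
  set f : Space d → ℂ := fun v => ((Real.exp (-(κ * t * ‖v‖ ^ α)) : ℝ) : ℂ) with hf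
  have hG := integrable_stableKernel hd hα hα2 hκ ht (d := d)
  have hfi : Integrable f := (integrable_exp_neg_norm_rpow hd (d := d) hα (mul_pos hκ ht)).ofReal
  have hfc : Continuous f := Complex.continuous_ofReal.comp (continuous_exp_neg_norm_rpow hα)
  have hF := funext fun w => fourier_exp_neg_norm_rpow hd hα hκ ht (d := d) w
  have hpi : (2 * Real.pi) ≠ 0 := by positivity
  have hG2 : Integrable fun w : Space d => (2 * Real.pi) ^ d * stableKernel α κ t ((2 * Real.pi) • w) :=
    (hG.comp_smul hpi).const_mul _
  have hFi : Integrable (FourierTransform.fourier f) := by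
    rw [hF]; exact hG2.ofReal
  have hinv := congrFun (hfc.fourierInv_fourier_eq hfi hFi) ξ
  rw [hF, Real.fourierInv_eq'] at hinv
  have hint : Integrable fun v : Space d =>
      Complex.exp ((↑(2 * Real.pi * inner ℝ v ξ) * Complex.I)) •
        (((2 * Real.pi) ^ d * stableKernel α κ t ((2 * Real.pi) • v) : ℝ) : ℂ) := by
    refine hG2.norm.mono' ?_ (ae_of_all _ fun v => ?_)
    · have : Measurable fun v : Space d => inner ℝ v ξ := measurable_id.inner measurable_const
      have := (continuous_stableKernel hd hα hκ ht (d := d)).measurable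
      exact Measurable.aestronglyMeasurable (by fun_prop)
    · rw [norm_smul, Complex.norm_exp_ofReal_mul_I, one_mul, Complex.norm_real]
  have hre := congrArg Complex.re hinv
  rw [← RCLike.re_eq_complex_re, ← integral_re hint] at hre
  simp only [RCLike.re_eq_complex_re, smul_eq_mul, Complex.re_mul_ofReal,
      Complex.exp_ofReal_mul_I_re, hf, Complex.ofReal_re] at hre
  rw [← hre]
  have hs := Measure.integral_comp_smul (volume : Measure (Space d))
    (fun z : Space d => (2 * Real.pi) ^ d * (stableKernel α κ t z * Real.cos (inner ℝ ξ z)))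
    (2 * Real.pi)
  rw [integral_const_mul, integral_const_mul, finrank_euclideanSpace, Fintype.card_fin, abs_of_nonneg (by positivity),
    smul_eq_mul, inv_mul_cancel_left₀ (by positivity), ← integral_const_mul] at hs
  rw [← hs]
  refine integral_congr_ae (ae_of_all _ fun v => ?_)
  simp only [inner_smul_right, real_inner_comm]
  ring

/-- The addition formula leaves a cosine part, known by inversion, and an odd sine part. The free
phase `c` allows the identity to be applied twice when a double convolution is computed. -/
lemma integral_stableKernel_sub_mul_cos (hd : 0 < d) {α κ t : ℝ} (hα : 0 < α) (hα2 : α ≤ 2)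
    (hκ : 0 < κ) (ht : 0 < t) (ξ x : Space d) (c : ℝ) :
    ∫ z : Space d, stableKernel α κ t (x - z) * Real.cos (inner ℝ ξ z + c) =
      Real.cos (inner ℝ ξ x + c) * Real.exp (-(κ * t * ‖ξ‖ ^ α)) := by
  have hG := integrable_stableKernel hd hα hα2 hκ ht (d := d)
  rw [← integral_sub_left_eq_self _ volume x]
  simp only [sub_sub_cancel]
  have hcos : Integrable fun z : Space d => stableKernel α κ t z * Real.cos (inner ℝ ξ z) := by
    simpa only [mul_comm] using integrable_cos_mul_of_integrable hG ξ
  have hsin : Integrable fun z : Space d => stableKernel α κ t z * Real.sin (inner ℝ ξ z) := by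
    refine hG.norm.mono' ?_ (ae_of_all _ fun z => ?_)
    · refine hG.aestronglyMeasurable.mul (Measurable.aestronglyMeasurable ?_)
      fun_prop
    · rw [norm_mul]
      exact mul_le_of_le_one_right (norm_nonneg _) (Real.abs_sin_le_one _)
  have heq : ∀ z : Space d, stableKernel α κ t z * Real.cos (inner ℝ ξ (x - z) + c) =
      Real.cos (inner ℝ ξ x + c) * (stableKernel α κ t z * Real.cos (inner ℝ ξ z)) +
      Real.sin (inner ℝ ξ x + c) * (stableKernel α κ t z * Real.sin (inner ℝ ξ z)) := by
    intro z
    rw [inner_sub_right, show inner ℝ ξ x - inner ℝ ξ z + c = (inner ℝ ξ x + c) - inner ℝ ξ z by ring,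
      Real.cos_sub]
    ring
  simp_rw [heq]
  rw [integral_add (hcos.const_mul _) (hsin.const_mul _), integral_const_mul, integral_const_mul,
    integral_stableKernel_mul_cos hd hα hα2 hκ ht, integral_eq_zero_of_odd (fun z => ?_), mul_zero,
    add_zero]
  rw [stableKernel_neg, inner_neg_right, Real.sin_neg, mul_neg]

end StableKernel

/-! ### A lower bound for the kernel mass retained by the unit cube. -/

section CubeBound

variable {d : ℕ}

/-- The unit cube `[0, 1)^d`. -/
def unitCube (d : ℕ) : Set (Space d) := {x | ∀ i, x i ∈ Ico (0 : ℝ) 1}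

/-- The closed cube `[0, 1/2]^d`. -/
def halfCube (d : ℕ) : Set (Space d) := {x | ∀ i, x i ∈ Icc (0 : ℝ) (1 / 2)}

lemma measurableSet_unitCube : MeasurableSet (unitCube d) := by
  have : unitCube d = ⋂ i, (fun x : Space d => x i) ⁻¹' Ico (0 : ℝ) 1 := by
    ext x; simp [unitCube]
  rw [this]
  exact MeasurableSet.iInter fun i => measurableSet_Ico.preimage (by fun_prop)

lemma measurableSet_halfCube : MeasurableSet (halfCube d) := by
  have : halfCube d = ⋂ i, (fun x : Space d => x i) ⁻¹' Icc (0 : ℝ) (1 / 2) := by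
    ext x; simp [halfCube]
  rw [this]
  exact MeasurableSet.iInter fun i => measurableSet_Icc.preimage (by fun_prop)

lemma stableKernel_comp_linearIsometryEquiv {α κ t : ℝ} (L : Space d ≃ₗᵢ[ℝ] Space d)
    (z : Space d) : stableKernel α κ t (L z) = stableKernel α κ t z := by
  unfold stableKernel
  congr 1
  rw [← L.measurePreserving.integral_comp L.toHomeomorph.measurableEmbedding]
  simp [L.inner_map_map, L.norm_map]

lemma stableKernel_eq_scaled {α κ t : ℝ} (hα : 0 < α) (ht : 0 < t) (z : Space d) :
    stableKernel α κ t z =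
      ((t ^ α⁻¹) ^ d)⁻¹ * stableKernel α κ 1 ((t ^ α⁻¹)⁻¹ • z) := by
  have hr : 0 < t ^ α⁻¹ := Real.rpow_pos_of_pos ht _
  unfold stableKernel
  rw [mul_left_comm]
  congr 1
  have hs := Measure.integral_comp_smul (volume : Measure (Space d)) (fun ξ : Space d =>
    Real.cos (inner ℝ ((t ^ α⁻¹)⁻¹ • z) ξ) * Real.exp (-(κ * 1 * ‖ξ‖ ^ α))) (t ^ α⁻¹)
  rw [finrank_euclideanSpace, Fintype.card_fin, abs_of_nonneg (by positivity), smul_eq_mul] at hs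
  rw [← hs]
  refine integral_congr_ae (ae_of_all _ fun ξ => ?_)
  simp only
  rw [inner_smul_left, inner_smul_right, norm_smul, Real.norm_of_nonneg hr.le,
    Real.mul_rpow hr.le (norm_nonneg _), ← Real.rpow_mul ht.le, inv_mul_cancel₀ hα.ne',
    Real.rpow_one]
  simp only [map_inv₀, conj_trivial, inv_mul_cancel_left₀ hr.ne']
  ring_nf

lemma stableKernel_zero_pos (hd : 0 < d) {α κ t : ℝ} (hα : 0 < α) (hκ : 0 < κ) (ht : 0 < t) :
    0 < stableKernel α κ t (0 : Space d) := by
  unfold stableKernel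
  refine mul_pos (by positivity) ?_
  simp only [inner_zero_left, Real.cos_zero, one_mul]
  exact integral_exp_pos (integrable_exp_neg_norm_rpow hd hα (mul_pos hκ ht))

lemma setIntegral_halfCube_stableKernel_pos (hd : 0 < d) {α κ t : ℝ} (hα : 0 < α) (hα2 : α ≤ 2)
    (hκ : 0 < κ) (ht : 0 < t) : 0 < ∫ z in halfCube d, stableKernel α κ t z := by
  have hG := integrable_stableKernel hd hα hα2 hκ ht (d := d)
  rw [setIntegral_pos_iff_support_of_nonneg_ae
    (ae_of_all _ (stableKernel_nonneg hd hα hα2 hκ ht)) hG.integrableOn]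
  have hopen : IsOpen {z : Space d | 0 < stableKernel α κ t z} :=
    isOpen_lt continuous_const (continuous_stableKernel hd hα hκ ht)
  have hopen2 : IsOpen {z : Space d | ∀ i, z i ∈ Ioo (0 : ℝ) (1 / 2)} := by
    have : {z : Space d | ∀ i, z i ∈ Ioo (0 : ℝ) (1 / 2)} =
        ⋂ i, (fun x : Space d => x i) ⁻¹' Ioo (0 : ℝ) (1 / 2) := by ext; simp
    rw [this]
    exact isOpen_iInter_of_finite fun i => isOpen_Ioo.preimage (by fun_prop)
  have hsub : {z : Space d | 0 < stableKernel α κ t z} ∩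
      {z : Space d | ∀ i, z i ∈ Ioo (0 : ℝ) (1 / 2)} ⊆
      Function.support (fun z => stableKernel α κ t z) ∩ halfCube d := fun z hz =>
    ⟨(ne_of_gt hz.1), fun i => Ioo_subset_Icc_self (hz.2 i)⟩
  refine lt_of_lt_of_le ((hopen.inter hopen2).measure_pos volume ?_) (measure_mono hsub)
  -- The origin, where the kernel is known to be positive, is only a corner of the cube. Diagonal
  -- points tending to it lie in the open cube and still see a positive kernel by continuity.
  have hlim : Tendsto (fun r : ℝ => r • (WithLp.toLp 2 (fun _ => (1 : ℝ)) : Space d)) (𝓝[>] 0)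
      (𝓝 0) := by
    have : Continuous fun r : ℝ => r • (WithLp.toLp 2 (fun _ => (1 : ℝ)) : Space d) := by fun_prop
    have h := this.tendsto 0
    rw [zero_smul] at h
    exact h.mono_left nhdsWithin_le_nhds
  have h1 := hlim.eventually (hopen.mem_nhds (stableKernel_zero_pos hd hα hκ ht))
  have h2 : ∀ᶠ r : ℝ in 𝓝[>] 0, r ∈ Ioo (0 : ℝ) (1 / 2) := Ioo_mem_nhdsGT (by norm_num)
  obtain ⟨r, hr1, hr2⟩ := (h1.and h2).exists
  exact ⟨_, hr1, fun i => by simpa using hr2⟩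

/-- In each coordinate one of the two directions has room `1/2` inside `[0, 1)`: downwards if `x i ≥
1/2`, upwards otherwise. -/
lemma exists_sign_flip (x : Space d) (hx : x ∈ unitCube d) :
    ∃ L : Space d ≃ₗᵢ[ℝ] Space d, ∀ z ∈ halfCube d, x - L z ∈ unitCube d := by
  classical
  refine ⟨LinearIsometryEquiv.piLpCongrRight 2 fun i =>
    if (2⁻¹ : ℝ) ≤ x i then LinearIsometryEquiv.refl ℝ ℝ else LinearIsometryEquiv.neg ℝ,
    fun z hz i => ?_⟩
  have h1 := hz i
  have h2 := hx i
  simp only [mem_Icc, mem_Ico] at h1 h2 ⊢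
  by_cases h : (2⁻¹ : ℝ) ≤ x i
  · simp only [PiLp.sub_apply, LinearIsometryEquiv.piLpCongrRight_apply, h, if_true,
      LinearIsometryEquiv.coe_refl, id_eq]
    constructor <;> linarith
  · simp only [PiLp.sub_apply, LinearIsometryEquiv.piLpCongrRight_apply, h, if_false,
      LinearIsometryEquiv.coe_neg]
    push Not at h
    constructor <;> linarith

/-- The constant is the mass of the half cube at time `1`. Scaling handles smaller times, since
contraction by `t^{1/α} ≤ 1` maps the half cube into itself. Invariance of the kernel under sign
flips then places a reflected half cube, based at `x`, inside the unit cube. -/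
theorem exists_lower_bound_stableKernel_unitCube (hd : 0 < d) {α κ : ℝ} (hα : 0 < α)
    (hα2 : α ≤ 2) (hκ : 0 < κ) :
    ∃ c : ℝ, 0 < c ∧ ∀ t ∈ Ioc (0 : ℝ) 1, ∀ x ∈ unitCube d,
      c ≤ ∫ y in unitCube d, stableKernel α κ t (x - y) := by
  refine ⟨∫ z in halfCube d, stableKernel α κ 1 z,
    setIntegral_halfCube_stableKernel_pos hd hα hα2 hκ zero_lt_one, fun t ht x hx => ?_⟩
  obtain ⟨L, hL⟩ := exists_sign_flip x hx
  have hG := integrable_stableKernel hd hα hα2 hκ ht.1 (d := d)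
  have hG1 := integrable_stableKernel hd hα hα2 hκ zero_lt_one (d := d)
  have hr : 0 < t ^ α⁻¹ := Real.rpow_pos_of_pos ht.1 _
  have hr1 : t ^ α⁻¹ ≤ 1 := Real.rpow_le_one ht.1.le ht.2 (by positivity)
  calc ∫ z in halfCube d, stableKernel α κ 1 z
      = ∫ w, (halfCube d).indicator (fun z => stableKernel α κ 1 z) w :=
        (integral_indicator measurableSet_halfCube).symm
    _ ≤ ∫ w, (halfCube d).indicator (fun z => stableKernel α κ 1 ((t ^ α⁻¹)⁻¹ • z))
          ((t ^ α⁻¹) • w) := by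
        have hi2 : Integrable fun w : Space d => (halfCube d).indicator
            (fun z => stableKernel α κ 1 ((t ^ α⁻¹)⁻¹ • z)) ((t ^ α⁻¹) • w) := by
          refine Integrable.comp_smul (f := (halfCube d).indicator
            (fun z => stableKernel α κ 1 ((t ^ α⁻¹)⁻¹ • z))) ?_ hr.ne'
          exact (hG1.comp_smul (inv_ne_zero hr.ne')).indicator measurableSet_halfCube
        refine integral_mono (hG1.indicator measurableSet_halfCube) hi2 fun w => ?_
        by_cases hw : w ∈ halfCube d
        · have hw' : (t ^ α⁻¹) • w ∈ halfCube d := fun i => by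
            have := hw i
            simp only [mem_Icc, PiLp.smul_apply, smul_eq_mul] at this ⊢
            exact ⟨mul_nonneg hr.le this.1, (mul_le_of_le_one_left this.1 hr1).trans this.2⟩
          simp [hw, hw', smul_smul, inv_mul_cancel₀ hr.ne']
        · rw [indicator_of_notMem hw]
          exact indicator_nonneg (fun _ _ => stableKernel_nonneg hd hα hα2 hκ zero_lt_one _) _
    _ = ((t ^ α⁻¹) ^ d)⁻¹ * ∫ w, (halfCube d).indicator
          (fun z => stableKernel α κ 1 ((t ^ α⁻¹)⁻¹ • z)) w := by
        rw [Measure.integral_comp_smul, finrank_euclideanSpace, Fintype.card_fin,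
          abs_of_nonneg (by positivity), smul_eq_mul]
    _ = ∫ w, (halfCube d).indicator (fun z => stableKernel α κ t z) w := by
        rw [← integral_const_mul]
        refine integral_congr_ae (ae_of_all _ fun w => ?_)
        by_cases hw : w ∈ halfCube d
        · simp only [indicator_of_mem hw]
          rw [stableKernel_eq_scaled hα ht.1 w]
        · simp [indicator_of_notMem hw]
    _ ≤ ∫ w, (unitCube d).indicator (fun y => stableKernel α κ t (x - y)) (x - L w) := by
        have hi2 : Integrable fun w : Space d =>
            (unitCube d).indicator (fun y => stableKernel α κ t (x - y)) (x - L w) := by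
          have h1 : Integrable fun w : Space d =>
              (unitCube d).indicator (fun y => stableKernel α κ t (x - y)) w :=
            (hG.comp_sub_left x).indicator measurableSet_unitCube
          exact (L.measurePreserving.integrable_comp_emb
            L.toHomeomorph.measurableEmbedding).2 (h1.comp_sub_left x)
        refine integral_mono (hG.indicator measurableSet_halfCube) hi2 fun w => ?_
        by_cases hw : w ∈ halfCube d
        · simp [hw, hL w hw, stableKernel_comp_linearIsometryEquiv]
        · rw [indicator_of_notMem hw]
          exact indicator_nonneg (fun _ _ => stableKernel_nonneg hd hα hα2 hκ ht.1 _) _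
    _ = ∫ w, (unitCube d).indicator (fun y => stableKernel α κ t (x - y)) w := by
        rw [L.measurePreserving.integral_comp L.toHomeomorph.measurableEmbedding
          (fun w => (unitCube d).indicator (fun y => stableKernel α κ t (x - y)) (x - w)),
          integral_sub_left_eq_self
            (fun w => (unitCube d).indicator (fun y => stableKernel α κ t (x - y)) w)]
    _ = _ := integral_indicator measurableSet_unitCube

end CubeBound

/-! ### The Riesz form -/

section RieszKernel

variable {d : ℕ}

/-- The Gamma integral exhibits the Riesz kernel as a positive mixture of Gaussians. Both its
positive definiteness and its spectral density are derived from this. -/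
lemma rpow_neg_eq_integral_exp {β r : ℝ} (hβ : 0 < β) (hr : 0 < r) :
    IntegrableOn (fun l : ℝ => (Real.Gamma (β / 2))⁻¹ * l ^ (β / 2 - 1) * Real.exp (-l * r ^ 2))
      (Ioi 0) ∧
    ∫ l in Ioi (0 : ℝ), (Real.Gamma (β / 2))⁻¹ * l ^ (β / 2 - 1) * Real.exp (-l * r ^ 2) =
      r ^ (-β) := by
  have hΓ := Real.Gamma_pos_of_pos (half_pos hβ)
  have h := Real.integral_rpow_mul_exp_neg_mul_Ioi (half_pos hβ) (pow_pos hr 2)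
  have heq : ∫ l in Ioi (0 : ℝ), (Real.Gamma (β / 2))⁻¹ * l ^ (β / 2 - 1) *
      Real.exp (-l * r ^ 2) = r ^ (-β) := by
    simp_rw [mul_assoc, integral_const_mul]
    have h1 : ∫ l in Ioi (0 : ℝ), l ^ (β / 2 - 1) * Real.exp (-l * r ^ 2) =
        ∫ l in Ioi (0 : ℝ), l ^ (β / 2 - 1) * Real.exp (-(r ^ 2 * l)) := by
      congr 1; ext l; ring_nf
    rw [h1, h, one_div, ← inv_pow, mul_comm ((r⁻¹ ^ 2) ^ (β / 2)), inv_mul_cancel_left₀ hΓ.ne',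
      ← Real.rpow_natCast, ← Real.rpow_mul (by positivity), Real.inv_rpow hr.le,
      ← Real.rpow_neg hr.le]
    congr 1
    push_cast
    ring
  refine ⟨Integrable.of_integral_ne_zero ?_, heq⟩
  rw [heq]
  positivity

lemma ofReal_rpow_neg_eq_lintegral {β r : ℝ} (hβ : 0 < β) (hr : 0 < r) :
    ENNReal.ofReal (r ^ (-β)) = ∫⁻ l in Ioi (0 : ℝ),
      ENNReal.ofReal ((Real.Gamma (β / 2))⁻¹ * l ^ (β / 2 - 1) * Real.exp (-l * r ^ 2)) := by
  obtain ⟨hi, h⟩ := rpow_neg_eq_integral_exp hβ hr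
  rw [← h, ofReal_integral_eq_lintegral_ofReal hi]
  filter_upwards [ae_restrict_mem measurableSet_Ioi] with l hl
  have hl : 0 < l := hl
  have hΓ := Real.Gamma_pos_of_pos (half_pos hβ)
  simp only [Pi.zero_apply]
  positivity

/-- By the parallelogram law around the midpoint of `x` and `y`, a Gaussian is a convolution square:
this is the square root that makes the Riesz form positive. -/
lemma exp_neg_norm_sub_sq_eq_integral {l : ℝ} (hl : 0 < l) (x y : Space d) :
    Integrable (fun z : Space d => Real.exp (-(2 * l) * ‖x - z‖ ^ 2) *
      Real.exp (-(2 * l) * ‖y - z‖ ^ 2)) ∧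
    (4 * l / Real.pi) ^ ((d : ℝ) / 2) * ∫ z : Space d, Real.exp (-(2 * l) * ‖x - z‖ ^ 2) *
      Real.exp (-(2 * l) * ‖y - z‖ ^ 2) = Real.exp (-l * ‖x - y‖ ^ 2) := by
  have key : ∀ z : Space d, Real.exp (-(2 * l) * ‖x - z‖ ^ 2) *
      Real.exp (-(2 * l) * ‖y - z‖ ^ 2) =
      Real.exp (-l * ‖x - y‖ ^ 2) *
        Real.exp (-(4 * l) * ‖((1 / 2 : ℝ) • (x + y)) - z‖ ^ 2) := by
    intro z
    rw [← Real.exp_add, ← Real.exp_add]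
    congr 1
    have h := parallelogram_law_with_norm ℝ (x - z) (y - z)
    have e1 : x - z + (y - z) = (2 : ℝ) • (((1 / 2 : ℝ) • (x + y)) - z) := by
      rw [smul_sub, smul_smul, two_smul ℝ z]
      norm_num
      abel
    have e2 : x - z - (y - z) = x - y := by abel
    rw [e1, e2, norm_smul] at h
    simp only [Real.norm_ofNat] at h
    nlinarith
  have h4 : 0 < 4 * l := by positivity
  have hi := (integrable_exp_neg_mul_norm_sq (d := d) h4).comp_sub_left ((1 / 2 : ℝ) • (x + y))
  constructor
  · simp_rw [key]
    exact hi.const_mul _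
  · simp_rw [key]
    rw [integral_const_mul, integral_sub_left_eq_self
      (fun z : Space d => Real.exp (-(4 * l) * ‖z‖ ^ 2)) volume,
      integral_exp_neg_mul_norm_sq h4, mul_left_comm, ← Real.mul_rpow (by positivity)
      (by positivity)]
    have : 4 * l / Real.pi * (Real.pi / (4 * l)) = 1 := by field_simp
    rw [this, Real.one_rpow, mul_one]

/-- The Gaussian weight in the factorization of the Riesz kernel. -/
noncomputable def rieszWeight (d : ℕ) (β l : ℝ) : ℝ :=
  (Real.Gamma (β / 2))⁻¹ * l ^ (β / 2 - 1) * (4 * l / Real.pi) ^ ((d : ℝ) / 2)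

lemma ofReal_norm_rpow_neg_eq_lintegral {β : ℝ} (hβ : 0 < β) {x y : Space d} (hxy : x ≠ y) :
    ENNReal.ofReal (‖x - y‖ ^ (-β)) =
      ∫⁻ q : ℝ × Space d, ENNReal.ofReal (rieszWeight d β q.1) *
        (ENNReal.ofReal (Real.exp (-(2 * q.1) * ‖x - q.2‖ ^ 2)) *
        ENNReal.ofReal (Real.exp (-(2 * q.1) * ‖y - q.2‖ ^ 2)))
        ∂((volume.restrict (Ioi (0 : ℝ))).prod volume) := by
  rw [ofReal_rpow_neg_eq_lintegral hβ (norm_pos_iff.2 (sub_ne_zero.2 hxy)), lintegral_prod]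
  · refine setLIntegral_congr_fun measurableSet_Ioi fun l hl => ?_
    have hl : 0 < l := hl
    have hΓ := Real.Gamma_pos_of_pos (half_pos hβ)
    obtain ⟨h1, h2⟩ := exp_neg_norm_sub_sq_eq_integral hl x y
    simp only
    rw [lintegral_const_mul _ (by fun_prop)]
    simp_rw [← ENNReal.ofReal_mul (Real.exp_nonneg _)]
    rw [← ofReal_integral_eq_lintegral_ofReal h1 (ae_of_all _ fun z => by positivity),
      ← ENNReal.ofReal_mul (by unfold rieszWeight; positivity), ← h2, rieszWeight]
    congr 1
    ring
  · have : Measurable (rieszWeight d β) := by unfold rieszWeight; fun_prop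
    exact Measurable.aemeasurable (by fun_prop)

lemma ENNReal.two_mul_mul_le_add_sq (a b : ℝ≥0∞) : 2 * (a * b) ≤ a * a + b * b := by
  wlog h : a ≤ b generalizing a b
  · rw [mul_comm a b, add_comm]
    exact this b a (le_of_not_ge h)
  obtain ⟨c, rfl⟩ := le_iff_exists_add.1 h
  calc 2 * (a * (a + c)) ≤ 2 * (a * (a + c)) + c * c := le_self_add
    _ = _ := by ring

lemma ae_fst_ne_snd (hd : 0 < d) : ∀ᵐ q : Space d × Space d, q.1 ≠ q.2 := by
  have := Space.nontrivial hd
  have hm : MeasurableSet {q : Space d × Space d | ¬ q.1 ≠ q.2} := by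
    simp only [ne_eq, not_not]
    exact measurableSet_eq_fun measurable_fst measurable_snd
  rw [ae_iff, Measure.volume_eq_prod, Measure.measure_prod_null hm]
  refine ae_of_all _ fun x => ?_
  have : Prod.mk x ⁻¹' {q : Space d × Space d | ¬ q.1 ≠ q.2} = {x} := by
    ext y; simp [eq_comm]
  beta_reduce
  rw [this]
  simp

/-- Factoring the Riesz kernel through the auxiliary variable `θ = (l, z)` turns the bilinear form
into a weighted integral of products. Working in `ℝ≥0∞` lets Tonelli apply before any integrability
is known. -/
lemma lintegral_mul_riesz_eq (hd : 0 < d) {β : ℝ} (hβ : 0 < β) {f g : Space d → ℝ≥0∞}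
    (hf : Measurable f) (hg : Measurable g) :
    ∫⁻ q : Space d × Space d, f q.1 * g q.2 * ENNReal.ofReal (‖q.1 - q.2‖ ^ (-β)) =
    ∫⁻ θ : ℝ × Space d, ENNReal.ofReal (rieszWeight d β θ.1) *
      ((∫⁻ x, f x * ENNReal.ofReal (Real.exp (-(2 * θ.1) * ‖x - θ.2‖ ^ 2))) *
        (∫⁻ y, g y * ENNReal.ofReal (Real.exp (-(2 * θ.1) * ‖y - θ.2‖ ^ 2))))
        ∂((volume.restrict (Ioi (0 : ℝ))).prod volume) := by
  have hW : Measurable (rieszWeight d β) := by unfold rieszWeight; fun_prop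
  calc ∫⁻ q : Space d × Space d, f q.1 * g q.2 * ENNReal.ofReal (‖q.1 - q.2‖ ^ (-β))
      = ∫⁻ q : Space d × Space d, ∫⁻ θ : ℝ × Space d, f q.1 * g q.2 *
          (ENNReal.ofReal (rieszWeight d β θ.1) *
        (ENNReal.ofReal (Real.exp (-(2 * θ.1) * ‖q.1 - θ.2‖ ^ 2)) *
        ENNReal.ofReal (Real.exp (-(2 * θ.1) * ‖q.2 - θ.2‖ ^ 2))))
        ∂((volume.restrict (Ioi (0 : ℝ))).prod volume) := by
        refine lintegral_congr_ae ?_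
        filter_upwards [ae_fst_ne_snd hd] with q hq
        rw [ofReal_norm_rpow_neg_eq_lintegral hβ hq, lintegral_const_mul _ (by fun_prop)]
    _ = _ := by
        rw [lintegral_lintegral_swap (by
          refine Measurable.aemeasurable ?_
          unfold Function.uncurry
          fun_prop)]
        refine lintegral_congr fun θ => ?_
        rw [Measure.volume_eq_prod (Space d) (Space d), ← lintegral_prod_mul (by fun_prop)
          (by fun_prop), ← lintegral_const_mul _ (by fun_prop)]
        refine lintegral_congr fun q => ?_
        ring

/-- The inequality `2ab ≤ a² + b²` at each `θ`. This is positivity of the form in a version free of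
subtraction, so it also makes sense for infinite values. -/
lemma two_mul_lintegral_riesz_le (hd : 0 < d) {β : ℝ} (hβ : 0 < β) {f g : Space d → ℝ≥0∞}
    (hf : Measurable f) (hg : Measurable g) :
    2 * ∫⁻ q : Space d × Space d, f q.1 * g q.2 * ENNReal.ofReal (‖q.1 - q.2‖ ^ (-β)) ≤
    (∫⁻ q : Space d × Space d, f q.1 * f q.2 * ENNReal.ofReal (‖q.1 - q.2‖ ^ (-β))) +
    ∫⁻ q : Space d × Space d, g q.1 * g q.2 * ENNReal.ofReal (‖q.1 - q.2‖ ^ (-β)) := by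
  have hW : Measurable (rieszWeight d β) := by unfold rieszWeight; fun_prop
  have hmeas : ∀ {h : Space d → ℝ≥0∞}, Measurable h → Measurable fun θ : ℝ × Space d =>
      ∫⁻ x, h x * ENNReal.ofReal (Real.exp (-(2 * θ.1) * ‖x - θ.2‖ ^ 2)) := fun {h} hh =>
    Measurable.lintegral_prod_right' (f := fun q : (ℝ × Space d) × Space d =>
      h q.2 * ENNReal.ofReal (Real.exp (-(2 * q.1.1) * ‖q.2 - q.1.2‖ ^ 2))) (by fun_prop)
  have hf' := hmeas hf
  have hg' := hmeas hg
  rw [lintegral_mul_riesz_eq hd hβ hf hg, lintegral_mul_riesz_eq hd hβ hf hf,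
    lintegral_mul_riesz_eq hd hβ hg hg, ← lintegral_const_mul _ (by fun_prop),
    ← lintegral_add_left (by fun_prop)]
  refine lintegral_mono fun θ => ?_
  beta_reduce
  rw [mul_left_comm, ← mul_add]
  gcongr
  exact ENNReal.two_mul_mul_le_add_sq _ _

end RieszKernel

/-! ### The space-time Riesz form as a semi-inner product. -/

section RieszInner

variable {d : ℕ} {β : ℝ}

lemma volume_restrict_Ioi_prod_univ :
    (volume : Measure (ℝ × Space d × Space d)).restrict
      (Ioi (0 : ℝ) ×ˢ (univ : Set (Space d × Space d))) =
      (volume.restrict (Ioi (0 : ℝ))).prod volume := by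
  rw [Measure.volume_eq_prod, ← Measure.prod_restrict, Measure.restrict_univ]

lemma measurable_rieszIntegrand {f g : ℝ × Space d → ℝ} (hf : Measurable f) (hg : Measurable g) :
    Measurable (rieszIntegrand β f g) := by
  unfold rieszIntegrand
  fun_prop

lemma lintegral_ofReal_rieszIntegrand {f g : ℝ × Space d → ℝ} (hf : Measurable f)
    (hg : Measurable g) (hf0 : ∀ p, 0 ≤ f p) (hg0 : ∀ p, 0 ≤ g p) :
    ∫⁻ p in Ioi (0 : ℝ) ×ˢ (univ : Set (Space d × Space d)),
      ENNReal.ofReal (rieszIntegrand β f g p) =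
    ∫⁻ t in Ioi (0 : ℝ), ∫⁻ q : Space d × Space d, ENNReal.ofReal (f (t, q.1)) *
      ENNReal.ofReal (g (t, q.2)) * ENNReal.ofReal (‖q.1 - q.2‖ ^ (-β)) := by
  rw [volume_restrict_Ioi_prod_univ, lintegral_prod]
  · refine lintegral_congr fun t => lintegral_congr fun q => ?_
    rw [rieszIntegrand, ENNReal.ofReal_mul (mul_nonneg (hf0 _) (hg0 _)),
      ENNReal.ofReal_mul (hf0 _)]
  · exact (measurable_rieszIntegrand hf hg).ennreal_ofReal.aemeasurable

lemma two_mul_lintegral_rieszIntegrand_le (hd : 0 < d) (hβ : 0 < β) {f g : ℝ × Space d → ℝ}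
    (hf : Measurable f) (hg : Measurable g) (hf0 : ∀ p, 0 ≤ f p) (hg0 : ∀ p, 0 ≤ g p) :
    2 * ∫⁻ p in Ioi (0 : ℝ) ×ˢ (univ : Set (Space d × Space d)),
      ENNReal.ofReal (rieszIntegrand β f g p) ≤
    (∫⁻ p in Ioi (0 : ℝ) ×ˢ (univ : Set (Space d × Space d)),
      ENNReal.ofReal (rieszIntegrand β f f p)) +
    ∫⁻ p in Ioi (0 : ℝ) ×ˢ (univ : Set (Space d × Space d)),
      ENNReal.ofReal (rieszIntegrand β g g p) := by
  have hmeas : ∀ {h k : ℝ × Space d → ℝ}, Measurable h → Measurable k → Measurable fun t : ℝ =>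
      ∫⁻ q : Space d × Space d, ENNReal.ofReal (h (t, q.1)) *
      ENNReal.ofReal (k (t, q.2)) * ENNReal.ofReal (‖q.1 - q.2‖ ^ (-β)) := fun {h k} hh hk =>
    Measurable.lintegral_prod_right' (f := fun p : ℝ × (Space d × Space d) =>
      ENNReal.ofReal (h (p.1, p.2.1)) *
      ENNReal.ofReal (k (p.1, p.2.2)) * ENNReal.ofReal (‖p.2.1 - p.2.2‖ ^ (-β))) (by fun_prop)
  rw [lintegral_ofReal_rieszIntegrand hf hg hf0 hg0, lintegral_ofReal_rieszIntegrand hf hf hf0 hf0,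
    lintegral_ofReal_rieszIntegrand hg hg hg0 hg0, ← lintegral_const_mul _ (hmeas hf hg),
    ← lintegral_add_left (hmeas hf hf)]
  refine lintegral_mono fun t => ?_
  exact two_mul_lintegral_riesz_le hd hβ (f := fun x => ENNReal.ofReal (f (t, x)))
    (g := fun x => ENNReal.ofReal (g (t, x))) (by fun_prop) (by fun_prop)

lemma rieszIntegrand_nonneg {f g : ℝ × Space d → ℝ} (hf0 : ∀ p, 0 ≤ f p) (hg0 : ∀ p, 0 ≤ g p)
    (p : ℝ × Space d × Space d) : 0 ≤ rieszIntegrand β f g p :=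
  mul_nonneg (mul_nonneg (hf0 _) (hg0 _)) (Real.rpow_nonneg (norm_nonneg _) _)

lemma norm_rieszIntegrand (f g : ℝ × Space d → ℝ) (p : ℝ × Space d × Space d) :
    ‖rieszIntegrand β f g p‖ = rieszIntegrand β (fun q => |f q|) (fun q => |g q|) p := by
  simp only [rieszIntegrand, norm_mul, Real.norm_eq_abs]
  rw [abs_of_nonneg (Real.rpow_nonneg (norm_nonneg _) _)]

namespace MemRiesz

lemma integrableOn (hd : 0 < d) (hβ : 0 < β) {f g : ℝ × Space d → ℝ} (hf : MemRiesz β f)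
    (hg : MemRiesz β g) : IntegrableOn (rieszIntegrand β f g)
      (Ioi (0 : ℝ) ×ˢ (univ : Set (Space d × Space d))) := by
  refine ⟨(measurable_rieszIntegrand hf.1 hg.1).aestronglyMeasurable, ?_⟩
  have hfin : ∀ {h : ℝ × Space d → ℝ}, MemRiesz β h →
      ∫⁻ p in Ioi (0 : ℝ) ×ˢ (univ : Set (Space d × Space d)),
      ENNReal.ofReal (rieszIntegrand β (fun q => |h q|) (fun q => |h q|) p) < ∞ := fun {h} hh => by
    have := hh.2.2
    rw [hasFiniteIntegral_iff_norm] at this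
    simpa only [norm_rieszIntegrand] using this
  rw [hasFiniteIntegral_iff_norm]
  simp only [norm_rieszIntegrand]
  have h := two_mul_lintegral_rieszIntegrand_le hd hβ (f := fun q => |f q|) (g := fun q => |g q|)
    (by have := hf.1; fun_prop) (by have := hg.1; fun_prop) (fun _ => abs_nonneg _)
    (fun _ => abs_nonneg _)
  refine lt_of_le_of_lt ?_ (ENNReal.add_lt_top.2 ⟨hfin hf, hfin hg⟩)
  refine le_trans ?_ h
  rw [two_mul]
  exact le_self_add

lemma const_mul {f : ℝ × Space d → ℝ} (hf : MemRiesz β f) (c : ℝ) :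
    MemRiesz β fun p => c * f p := by
  refine ⟨hf.1.const_mul c, (hf.2.const_mul (c * c)).congr (ae_of_all _ fun p => ?_)⟩
  simp only [rieszIntegrand]
  ring

lemma add (hd : 0 < d) (hβ : 0 < β) {f g : ℝ × Space d → ℝ} (hf : MemRiesz β f)
    (hg : MemRiesz β g) : MemRiesz β fun p => f p + g p := by
  refine ⟨hf.1.add hg.1, Integrable.congr
    (((hf.integrableOn hd hβ hf).add (hf.integrableOn hd hβ hg)).add
    ((hg.integrableOn hd hβ hf).add (hg.integrableOn hd hβ hg))) (ae_of_all _ fun p => ?_)⟩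
  simp only [rieszIntegrand, Pi.add_apply]
  ring

lemma sub (hd : 0 < d) (hβ : 0 < β) {f g : ℝ × Space d → ℝ} (hf : MemRiesz β f)
    (hg : MemRiesz β g) : MemRiesz β fun p => f p - g p := by
  have := hf.add hd hβ (hg.const_mul (-1))
  simpa only [neg_one_mul, ← sub_eq_add_neg] using this

lemma of_abs_le {f g : ℝ × Space d → ℝ} (hf : Measurable f)
    (hg : MemRiesz β g) (h : ∀ p, |f p| ≤ |g p|) : MemRiesz β f := by
  refine ⟨hf, hg.2.norm.mono' (measurable_rieszIntegrand hf hf).aestronglyMeasurable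
    (ae_of_all _ fun p => ?_)⟩
  rw [norm_rieszIntegrand, norm_rieszIntegrand]
  unfold rieszIntegrand
  gcongr
  · exact h _
  · exact h _

end MemRiesz

lemma rieszInner_add_left (hd : 0 < d) (hβ : 0 < β) {f g h : ℝ × Space d → ℝ}
    (hf : MemRiesz β f) (hg : MemRiesz β g) (hh : MemRiesz β h) :
    rieszInner β (fun p => f p + g p) h = rieszInner β f h + rieszInner β g h := by
  unfold rieszInner
  rw [← integral_add (hf.integrableOn hd hβ hh) (hg.integrableOn hd hβ hh)]
  congr 1; ext p
  simp only [rieszIntegrand]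
  ring

lemma rieszInner_const_mul_left (c : ℝ) (f h : ℝ × Space d → ℝ) :
    rieszInner β (fun p => c * f p) h = c * rieszInner β f h := by
  unfold rieszInner
  rw [← integral_const_mul]
  congr 1; ext p
  simp only [rieszIntegrand]
  ring

lemma rieszInner_comm (f g : ℝ × Space d → ℝ) : rieszInner β f g = rieszInner β g f := by
  unfold rieszInner
  rw [volume_restrict_Ioi_prod_univ]
  have hmp : MeasurePreserving (Prod.map id Prod.swap : ℝ × Space d × Space d → ℝ × Space d × Space d)
      ((volume.restrict (Ioi (0 : ℝ))).prod volume)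
      ((volume.restrict (Ioi (0 : ℝ))).prod volume) :=
    (MeasurePreserving.id _).prod (Measure.measurePreserving_swap)
  have hemb : MeasurableEmbedding
      (Prod.map id Prod.swap : ℝ × Space d × Space d → ℝ × Space d × Space d) :=
    ((MeasurableEquiv.refl ℝ).prodCongr MeasurableEquiv.prodComm).measurableEmbedding
  rw [← hmp.integral_comp hemb]
  congr 1; ext p
  simp only [rieszIntegrand, Prod.map_fst, Prod.map_snd, id_eq, Prod.fst_swap, Prod.snd_swap]
  rw [norm_sub_rev]
  ring

lemma rieszInner_sub_left (hd : 0 < d) (hβ : 0 < β) {f g h : ℝ × Space d → ℝ}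
    (hf : MemRiesz β f) (hg : MemRiesz β g) (hh : MemRiesz β h) :
    rieszInner β (fun p => f p - g p) h = rieszInner β f h - rieszInner β g h := by
  have := rieszInner_add_left hd hβ hf (hg.const_mul (-1)) hh
  rw [rieszInner_const_mul_left] at this
  simp only [neg_one_mul, ← sub_eq_add_neg] at this
  exact this

/-- The available inequality concerns nonnegative functions; applied to the positive and negative
parts `u`, `v` of `f`, it bounds the cross term `2⟨u, v⟩` by `⟨u, u⟩ + ⟨v, v⟩`. -/
lemma rieszInner_self_nonneg (hd : 0 < d) (hβ : 0 < β) {f : ℝ × Space d → ℝ}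
    (hf : MemRiesz β f) : 0 ≤ rieszInner β f f := by
  set u : ℝ × Space d → ℝ := fun p => max (f p) 0 with hu
  set v : ℝ × Space d → ℝ := fun p => max (-f p) 0 with hv
  have hfm := hf.1
  have hum : MemRiesz β u := MemRiesz.of_abs_le (by fun_prop) hf fun p => by
    rw [hu, abs_of_nonneg (le_max_right _ _)]
    exact max_le (le_abs_self _) (abs_nonneg _)
  have hvm : MemRiesz β v := MemRiesz.of_abs_le (by fun_prop) hf fun p => by
    rw [hv, abs_of_nonneg (le_max_right _ _)]
    exact max_le (neg_le_abs _) (abs_nonneg _)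
  have hu0 : ∀ p, 0 ≤ u p := fun p => le_max_right _ _
  have hv0 : ∀ p, 0 ≤ v p := fun p => le_max_right _ _
  have hfuv : f = fun p => u p - v p := by
    ext p
    rcases le_total (f p) 0 with h | h
    · simp [hu, hv, h]
    · simp [hu, hv, h]
  have hexp : rieszInner β f f = rieszInner β u u - 2 * rieszInner β u v + rieszInner β v v := by
    have h1 : rieszInner β f f = rieszInner β u f - rieszInner β v f := by
      conv_lhs => rw [hfuv]
      rw [rieszInner_sub_left hd hβ hum hvm (by rwa [hfuv] at hf), ← hfuv]
    have h2 : ∀ h, MemRiesz β h → rieszInner β h f = rieszInner β h u - rieszInner β h v := by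
      intro h hh
      rw [rieszInner_comm h f, rieszInner_comm h u, rieszInner_comm h v]
      conv_lhs => rw [hfuv]
      exact rieszInner_sub_left hd hβ hum hvm hh
    rw [h1, h2 u hum, h2 v hvm, rieszInner_comm v u]
    ring
  have hform : ∀ {g h : ℝ × Space d → ℝ}, MemRiesz β g → MemRiesz β h → (∀ p, 0 ≤ g p) →
      (∀ p, 0 ≤ h p) → ENNReal.ofReal (rieszInner β g h) =
        ∫⁻ p in Ioi (0 : ℝ) ×ˢ (univ : Set (Space d × Space d)),
          ENNReal.ofReal (rieszIntegrand β g h p) := fun {g h} hg hh hg0 hh0 =>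
    ofReal_integral_eq_lintegral_ofReal (hg.integrableOn hd hβ hh)
      (ae_of_all _ fun p => rieszIntegrand_nonneg hg0 hh0 p)
  have hnn : ∀ {g h : ℝ × Space d → ℝ}, (∀ p, 0 ≤ g p) →
      (∀ p, 0 ≤ h p) → 0 ≤ rieszInner β g h := fun {g h} hg0 hh0 =>
    integral_nonneg fun p => rieszIntegrand_nonneg hg0 hh0 p
  have hkey := two_mul_lintegral_rieszIntegrand_le hd hβ (β := β) hum.1 hvm.1 hu0 hv0
  rw [← hform hum hvm hu0 hv0, ← hform hum hum hu0 hu0, ← hform hvm hvm hv0 hv0,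
    ← ENNReal.ofReal_add (hnn hu0 hu0) (hnn hv0 hv0),
    show (2 : ℝ≥0∞) = ENNReal.ofReal 2 by simp, ← ENNReal.ofReal_mul (by norm_num),
    ENNReal.ofReal_le_ofReal_iff (add_nonneg (hnn hu0 hu0) (hnn hv0 hv0))] at hkey
  rw [hexp]
  linarith

lemma rieszInner_sq_le (hd : 0 < d) (hβ : 0 < β) {f g : ℝ × Space d → ℝ}
    (hf : MemRiesz β f) (hg : MemRiesz β g) :
    rieszInner β f g ^ 2 ≤ rieszInner β f f * rieszInner β g g := by
  have h : ∀ s : ℝ, 0 ≤ rieszInner β g g * (s * s) + 2 * rieszInner β f g * s +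
      rieszInner β f f := by
    intro s
    have hsg := hg.const_mul s
    have h0 := rieszInner_self_nonneg hd hβ (hf.add hd hβ hsg)
    rw [rieszInner_add_left hd hβ hf hsg (hf.add hd hβ hsg), rieszInner_comm f,
      rieszInner_comm (fun p => s * g p), rieszInner_add_left hd hβ hf hsg hf,
      rieszInner_add_left hd hβ hf hsg hsg, rieszInner_const_mul_left, rieszInner_const_mul_left,
      rieszInner_comm f (fun p => s * g p), rieszInner_const_mul_left,
      rieszInner_comm g (fun p => s * g p), rieszInner_const_mul_left, rieszInner_comm g f] at h0
    linarith
  have := discrim_le_zero h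
  unfold discrim at this
  nlinarith

lemma tendsto_rieszInner (hd : 0 < d) (hβ : 0 < β) {f g : ℝ × Space d → ℝ}
    {fs gs : ℕ → ℝ × Space d → ℝ} (hf : MemRiesz β f) (hg : MemRiesz β g)
    (hfs : ∀ n, MemRiesz β (fs n)) (hgs : ∀ n, MemRiesz β (gs n))
    (hfl : Tendsto (fun n => rieszInner β (fun p => fs n p - f p) (fun p => fs n p - f p))
      atTop (𝓝 0))
    (hgl : Tendsto (fun n => rieszInner β (fun p => gs n p - g p) (fun p => gs n p - g p))
      atTop (𝓝 0)) :
    Tendsto (fun n => rieszInner β (fs n) (gs n)) atTop (𝓝 (rieszInner β f g)) := by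
  have hzero : ∀ {u v : ℕ → ℝ × Space d → ℝ}, (∀ n, MemRiesz β (u n)) →
      (∀ n, MemRiesz β (v n)) →
      Tendsto (fun n => rieszInner β (u n) (u n) * rieszInner β (v n) (v n)) atTop (𝓝 0) →
      Tendsto (fun n => rieszInner β (u n) (v n)) atTop (𝓝 0) := by
    intro u v hu hv h
    have h1 : Tendsto (fun n => rieszInner β (u n) (v n) ^ 2) atTop (𝓝 0) :=
      squeeze_zero (fun n => sq_nonneg _) (fun n => rieszInner_sq_le hd hβ (hu n) (hv n)) h
    have h2 := h1.sqrt
    simp only [Real.sqrt_sq_eq_abs, Real.sqrt_zero] at h2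
    exact (tendsto_zero_iff_abs_tendsto_zero _).2 h2
  have hfd : ∀ n, MemRiesz β fun p => fs n p - f p := fun n => (hfs n).sub hd hβ hf
  have hgd : ∀ n, MemRiesz β fun p => gs n p - g p := fun n => (hgs n).sub hd hβ hg
  -- The difference of the two inner products splits into `⟨fs - f, gs - g⟩`, `⟨fs - f, g⟩` and `⟨f,
  -- gs - g⟩`, each small by Cauchy–Schwarz.
  have h1 := hzero hfd hgd (by simpa using hfl.mul hgl)
  have h2 := hzero hfd (fun _ => hg) (by simpa using hfl.mul_const (rieszInner β g g))
  have h3 := hzero (fun _ => hf) hgd (by simpa using hgl.const_mul (rieszInner β f f))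
  have h4 := ((h1.add h2).add h3).add_const (rieszInner β f g)
  simp only [add_zero, zero_add] at h4
  refine h4.congr fun n => ?_
  rw [rieszInner_sub_left hd hβ (hfs n) hf (hgd n), rieszInner_sub_left hd hβ (hfs n) hf hg,
    rieszInner_comm (fs n) (fun p => gs n p - g p), rieszInner_sub_left hd hβ (hgs n) hg (hfs n),
    rieszInner_comm f (fun p => gs n p - g p), rieszInner_sub_left hd hβ (hgs n) hg hf,
    rieszInner_comm g f, rieszInner_comm (gs n) (fs n), rieszInner_comm g (fs n)]
  ring

lemma memRiesz_of_continuous_hasCompactSupport (hβ : 0 < β) (hβd : β < d)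
    {f : ℝ × Space d → ℝ} (hf : Continuous f) (hs : HasCompactSupport f) : MemRiesz β f := by
  have hd : 0 < d := by
    have : (0 : ℝ) < d := hβ.trans hβd
    exact_mod_cast this
  obtain ⟨C, hC⟩ := hs.exists_bound_of_continuous hf
  have hC0 : 0 ≤ C := (norm_nonneg _).trans (hC 0)
  obtain ⟨A, hA⟩ := hs.isCompact.isBounded.subset_closedBall 0
  have hzero : ∀ p, A < ‖p‖ → f p = 0 := fun p hp => by
    by_contra h
    have := hA (subset_tsupport f h)
    rw [mem_closedBall_zero_iff] at this
    linarith
  refine ⟨hf.measurable, (measurable_rieszIntegrand hf.measurable hf.measurable).aestronglyMeasurable,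
    ?_⟩
  have hk := integrable_norm_rpow_mul_exp hd (α := 1) (A := 1) (q := -β) one_pos one_pos
    (by linarith)
  -- The factor `e^{-|z|}` makes the singular kernel integrable over the whole space. It costs only
  -- the constant `e^{2A}`, because `|x - y| ≤ 2A` wherever the integrand is nonzero.
  set k : Space d → ℝ := fun z => ‖z‖ ^ (-β) * Real.exp (-(1 * ‖z‖ ^ (1 : ℝ))) with hkdef
  have hkm : Measurable k := by fun_prop
  have hk0 : ∀ z, 0 ≤ k z := fun z => by positivity
  have hbound : ∀ p : ℝ × Space d × Space d, ‖rieszIntegrand β f f p‖ ≤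
      C * C * Real.exp (2 * A) * ((Metric.closedBall (0 : ℝ) A).indicator 1 p.1 *
        ((Metric.closedBall (0 : Space d) A).indicator 1 p.2.1 * k (p.2.1 - p.2.2))) := by
    intro p
    have hR0 : 0 ≤ C * C * Real.exp (2 * A) * ((Metric.closedBall (0 : ℝ) A).indicator 1 p.1 *
        ((Metric.closedBall (0 : Space d) A).indicator 1 p.2.1 * k (p.2.1 - p.2.2))) := by
      have h1 : (0 : ℝ) ≤ (Metric.closedBall (0 : ℝ) A).indicator 1 p.1 :=
        indicator_nonneg (fun _ _ => by simp) _
      have h2 : (0 : ℝ) ≤ (Metric.closedBall (0 : Space d) A).indicator 1 p.2.1 :=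
        indicator_nonneg (fun _ _ => by simp) _
      have := hk0 (p.2.1 - p.2.2)
      positivity
    by_cases h : f (p.1, p.2.1) = 0 ∨ f (p.1, p.2.2) = 0
    · have : rieszIntegrand β f f p = 0 := by
        rcases h with h | h <;> simp [rieszIntegrand, h]
      rw [this, norm_zero]
      exact hR0
    · push Not at h
      have h1 : ‖(p.1, p.2.1)‖ ≤ A := not_lt.1 fun hlt => h.1 (hzero _ hlt)
      have h2 : ‖(p.1, p.2.2)‖ ≤ A := not_lt.1 fun hlt => h.2 (hzero _ hlt)
      have h11 := (norm_fst_le (p.1, p.2.1)).trans h1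
      have h12 := (norm_snd_le (p.1, p.2.1)).trans h1
      have h22 := (norm_snd_le (p.1, p.2.2)).trans h2
      simp only at h11 h12 h22
      rw [indicator_of_mem (by simpa using h11), indicator_of_mem (by simpa using h12)]
      simp only [Pi.one_apply, one_mul, rieszIntegrand, hkdef, Real.rpow_one]
      rw [norm_mul, norm_mul, Real.norm_of_nonneg (Real.rpow_nonneg (norm_nonneg _) _)]
      have h3 : ‖p.2.1 - p.2.2‖ ≤ 2 * A := (norm_sub_le _ _).trans (by linarith)
      have h4 : 1 ≤ Real.exp (2 * A) * Real.exp (-‖p.2.1 - p.2.2‖) := by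
        rw [← Real.exp_add]
        exact Real.one_le_exp (by linarith)
      calc ‖f (p.1, p.2.1)‖ * ‖f (p.1, p.2.2)‖ * ‖p.2.1 - p.2.2‖ ^ (-β)
          ≤ C * C * (‖p.2.1 - p.2.2‖ ^ (-β) * 1) := by
            rw [mul_one]
            gcongr
            · exact hC _
            · exact hC _
        _ ≤ C * C * (‖p.2.1 - p.2.2‖ ^ (-β) *
              (Real.exp (2 * A) * Real.exp (-‖p.2.1 - p.2.2‖))) := by gcongr
        _ = _ := by ring
  have hint1 : Integrable ((Metric.closedBall (0 : ℝ) A).indicator (1 : ℝ → ℝ)) :=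
    (integrable_indicator_iff measurableSet_closedBall).2
      (integrableOn_const (isCompact_closedBall _ _).measure_lt_top.ne)
  have hint2 : Integrable ((Metric.closedBall (0 : Space d) A).indicator (1 : Space d → ℝ)) :=
    (integrable_indicator_iff measurableSet_closedBall).2
      (integrableOn_const (isCompact_closedBall _ _).measure_lt_top.ne)
  have hint3 : Integrable fun q : Space d × Space d =>
      (Metric.closedBall (0 : Space d) A).indicator 1 q.1 * k (q.1 - q.2) := by
    rw [Measure.volume_eq_prod, integrable_prod_iff]
    · constructor
      · exact ae_of_all _ fun x => (hk.comp_sub_left x).const_mul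
          ((Metric.closedBall (0 : Space d) A).indicator 1 x)
      · have : ∀ x : Space d, ∫ y, ‖(Metric.closedBall (0 : Space d) A).indicator 1 x * k (x - y)‖ =
            ‖(Metric.closedBall (0 : Space d) A).indicator (1 : Space d → ℝ) x‖ * ∫ y, ‖k y‖ := by
          intro x
          simp_rw [norm_mul]
          rw [integral_const_mul, integral_sub_left_eq_self (fun z => ‖k z‖) volume]
        simp only [this]
        exact hint2.norm.mul_const _
    · have : Measurable ((Metric.closedBall (0 : Space d) A).indicator (1 : Space d → ℝ)) :=
        measurable_one.indicator measurableSet_closedBall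
      exact Measurable.aestronglyMeasurable (by fun_prop)
  have hint4 := ((hint1.mul_prod hint3).const_mul (C * C * Real.exp (2 * A)))
  rw [← Measure.volume_eq_prod] at hint4
  exact (hint4.mono' (measurable_rieszIntegrand hf.measurable hf.measurable).aestronglyMeasurable
    (ae_of_all _ hbound)).integrableOn.2

end RieszInner

/-! ### Spectral form of the covariance -/

section Spectral

variable {d : ℕ} {α β κ : ℝ}

/-- The constant `W` such that the spectral density of the Riesz kernel is `W |ξ|^{β-d}`. -/
noncomputable def spectralConst (d : ℕ) (β : ℝ) : ℝ :=
  (Real.Gamma (β / 2))⁻¹ * ((4 * Real.pi) ^ (-(d : ℝ) / 2) *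
    (4 ^ (((d : ℝ) - β) / 2) * Real.Gamma (((d : ℝ) - β) / 2)))

lemma spectralConst_pos (hβ : 0 < β) (hβd : β < d) : 0 < spectralConst d β := by
  have h1 := Real.Gamma_pos_of_pos (half_pos hβ)
  have h2 := Real.Gamma_pos_of_pos (s := ((d : ℝ) - β) / 2) (by linarith)
  unfold spectralConst
  positivity

/-- Mixing the Fourier transforms of the Gaussians that build `|x|^{-β}` gives its spectral density;
the substitution `l = 1/m` reduces the mixture to a Gamma integral. -/
lemma integral_gaussian_mixture (hβd : β < d) {r : ℝ} (hr : 0 < r) :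
    ∫ l in Ioi (0 : ℝ), (Real.Gamma (β / 2))⁻¹ * l ^ (β / 2 - 1) *
      ((4 * Real.pi * l) ^ (-(d : ℝ) / 2) * Real.exp (-(4 * l)⁻¹ * r ^ 2)) =
      spectralConst d β * r ^ (β - d) := by
  have h := integral_comp_rpow_Ioi (fun l : ℝ => (Real.Gamma (β / 2))⁻¹ * l ^ (β / 2 - 1) *
      ((4 * Real.pi * l) ^ (-(d : ℝ) / 2) * Real.exp (-(4 * l)⁻¹ * r ^ 2)))
      (p := -1) (by norm_num)
  rw [← h]
  have h2 := Real.integral_rpow_mul_exp_neg_mul_Ioi (a := ((d : ℝ) - β) / 2) (r := r ^ 2 / 4)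
    (by linarith) (by positivity)
  have e : ∀ m ∈ Ioi (0 : ℝ), (|(-1 : ℝ)| * m ^ ((-1 : ℝ) - 1)) • ((Real.Gamma (β / 2))⁻¹ *
      (m ^ (-1 : ℝ)) ^ (β / 2 - 1) * ((4 * Real.pi * m ^ (-1 : ℝ)) ^ (-(d : ℝ) / 2) *
        Real.exp (-(4 * m ^ (-1 : ℝ))⁻¹ * r ^ 2))) =
      (Real.Gamma (β / 2))⁻¹ * (4 * Real.pi) ^ (-(d : ℝ) / 2) *
      (m ^ (((d : ℝ) - β) / 2 - 1) * Real.exp (-(r ^ 2 / 4 * m))) := by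
    intro m hm
    have hm : 0 < m := hm
    rw [Real.mul_rpow (by positivity) (by positivity), ← Real.rpow_mul hm.le, ← Real.rpow_mul hm.le]
    have e1 : Real.exp (-(4 * m ^ (-1 : ℝ))⁻¹ * r ^ 2) = Real.exp (-(r ^ 2 / 4 * m)) := by
      congr 1
      rw [Real.rpow_neg_one]
      field_simp
    have e2 : m ^ (((d : ℝ) - β) / 2 - 1) = m ^ ((-1 : ℝ) - 1) * m ^ (-1 * (β / 2 - 1)) *
        m ^ (-1 * (-(d : ℝ) / 2)) := by
      rw [← Real.rpow_add hm, ← Real.rpow_add hm]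
      congr 1
      ring
    rw [e1, e2, smul_eq_mul]
    simp only [abs_neg, abs_one]
    ring
  rw [setIntegral_congr_fun measurableSet_Ioi e, integral_const_mul, h2, spectralConst]
  have e3 : (1 / (r ^ 2 / 4)) ^ (((d : ℝ) - β) / 2) =
      4 ^ (((d : ℝ) - β) / 2) * r ^ (β - d) := by
    rw [show 1 / (r ^ 2 / 4) = 4 * (r ^ 2)⁻¹ by field_simp, Real.mul_rpow (by norm_num)
      (by positivity), Real.inv_rpow (by positivity), ← Real.rpow_neg (by positivity),
      ← Real.rpow_natCast r 2, ← Real.rpow_mul hr.le]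
    congr 2
    push_cast
    ring
  rw [e3]
  ring

lemma integrable_stableKernel_prod (hd : 0 < d) (hα : 0 < α) (hα2 : α ≤ 2) (hκ : 0 < κ)
    {t s : ℝ} (ht : 0 < t) (hs : 0 < s) (x y : Space d) :
    Integrable fun q : Space d × Space d =>
      stableKernel α κ t (x - q.1) * stableKernel α κ s (y - q.2) :=
  ((integrable_stableKernel hd hα hα2 hκ ht).comp_sub_left x).mul_prod
    ((integrable_stableKernel hd hα hα2 hκ hs).comp_sub_left y)

lemma integral_stableKernel_prod_mul_cos (hd : 0 < d) (hα : 0 < α) (hα2 : α ≤ 2) (hκ : 0 < κ)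
    {t s : ℝ} (ht : 0 < t) (hs : 0 < s) (x y ξ : Space d) :
    ∫ q : Space d × Space d, stableKernel α κ t (x - q.1) * stableKernel α κ s (y - q.2) *
      Real.cos (inner ℝ (q.1 - q.2) ξ) =
      Real.cos (inner ℝ ξ (x - y)) * Real.exp (-(κ * (t + s) * ‖ξ‖ ^ α)) := by
  have hi : Integrable fun q : Space d × Space d =>
      stableKernel α κ t (x - q.1) * stableKernel α κ s (y - q.2) *
      Real.cos (inner ℝ (q.1 - q.2) ξ) := by
    have h := integrable_stableKernel_prod hd hα hα2 hκ ht hs x y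
    refine h.norm.mono' (h.aestronglyMeasurable.mul ?_) (ae_of_all _ fun q => ?_)
    · have : Measurable fun q : Space d × Space d => inner ℝ (q.1 - q.2) ξ :=
        (measurable_fst.sub measurable_snd).inner measurable_const
      exact Measurable.aestronglyMeasurable (by fun_prop)
    · rw [norm_mul]
      exact mul_le_of_le_one_right (norm_nonneg _) (Real.abs_cos_le_one _)
  rw [Measure.volume_eq_prod] at hi ⊢
  rw [integral_prod _ hi]
  have h1 : ∀ z : Space d, ∫ w : Space d, stableKernel α κ t (x - z) * stableKernel α κ s (y - w) *
      Real.cos (inner ℝ (z - w) ξ) = stableKernel α κ t (x - z) *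
      Real.cos (inner ℝ ξ z + -inner ℝ ξ y) * Real.exp (-(κ * s * ‖ξ‖ ^ α)) := by
    intro z
    have := integral_stableKernel_sub_mul_cos hd hα hα2 hκ hs ξ y (-inner ℝ ξ z)
    rw [← Real.cos_neg, show -(inner ℝ ξ y + -inner ℝ ξ z) = inner ℝ ξ z + -inner ℝ ξ y by ring]
      at this
    rw [mul_assoc, ← this, ← integral_const_mul]
    refine integral_congr_ae (ae_of_all _ fun w => ?_)
    beta_reduce
    rw [inner_sub_left, real_inner_comm, real_inner_comm ξ w, ← Real.cos_neg]
    ring_nf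
  simp only [h1]
  rw [integral_mul_const, integral_stableKernel_sub_mul_cos hd hα hα2 hκ ht, mul_assoc,
    ← Real.exp_add, inner_sub_right]
  ring_nf

/-- The mixed Gaussian-stable integral
`(4πl)^{-d/2} ∫ cos⟨ξ, z⟩ e^{-|ξ|²/(4l)} e^{-κ τ |ξ|^α} dξ`. -/
noncomputable def gaussStable (d : ℕ) (α κ l τ : ℝ) (z : Space d) : ℝ :=
  ∫ ξ : Space d, (4 * Real.pi * l) ^ (-(d : ℝ) / 2) * Real.exp (-(4 * l)⁻¹ * ‖ξ‖ ^ 2) *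
    (Real.cos (inner ℝ ξ z) * Real.exp (-(κ * τ * ‖ξ‖ ^ α)))

lemma exp_neg_norm_sq_eq_integral {l : ℝ} (hl : 0 < l) (z : Space d) :
    Real.exp (-l * ‖z‖ ^ 2) = ∫ ξ : Space d, (4 * Real.pi * l) ^ (-(d : ℝ) / 2) *
      Real.exp (-(4 * l)⁻¹ * ‖ξ‖ ^ 2) * Real.cos (inner ℝ z ξ) := by
  have h := integral_cos_mul_exp_neg_mul_norm_sq (δ := (4 * l)⁻¹) (by positivity) z
  have e : ∀ ξ : Space d, (4 * Real.pi * l) ^ (-(d : ℝ) / 2) *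
      Real.exp (-(4 * l)⁻¹ * ‖ξ‖ ^ 2) * Real.cos (inner ℝ z ξ) =
      (4 * Real.pi * l) ^ (-(d : ℝ) / 2) *
        (Real.cos (inner ℝ z ξ) * Real.exp (-(4 * l)⁻¹ * ‖ξ‖ ^ 2)) := fun ξ => by ring
  simp_rw [e]
  rw [integral_const_mul, h, show Real.pi / (4 * l)⁻¹ = 4 * Real.pi * l by field_simp, ← mul_assoc,
    ← Real.rpow_add (by positivity), show -(d : ℝ) / 2 + (d : ℝ) / 2 = 0 by ring, Real.rpow_zero,
    one_mul]
  congr 1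
  field_simp

lemma integral_stableKernel_prod_mul_exp (hd : 0 < d) (hα : 0 < α) (hα2 : α ≤ 2) (hκ : 0 < κ)
    {t s l : ℝ} (ht : 0 < t) (hs : 0 < s) (hl : 0 < l) (x y : Space d) :
    ∫ q : Space d × Space d, stableKernel α κ t (x - q.1) * stableKernel α κ s (y - q.2) *
      Real.exp (-l * ‖q.1 - q.2‖ ^ 2) = gaussStable d α κ l (t + s) (x - y) := by
  have hG := integrable_stableKernel_prod hd hα hα2 hκ ht hs x y
  have hl4 : 0 < (4 * l)⁻¹ := by positivity
  have hint : Integrable (Function.uncurry fun (q : Space d × Space d) (ξ : Space d) =>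
      stableKernel α κ t (x - q.1) * stableKernel α κ s (y - q.2) *
      ((4 * Real.pi * l) ^ (-(d : ℝ) / 2) *
      Real.exp (-(4 * l)⁻¹ * ‖ξ‖ ^ 2) * Real.cos (inner ℝ (q.1 - q.2) ξ)))
      ((volume : Measure (Space d × Space d)).prod volume) := by
    have h := hG.mul_prod ((integrable_exp_neg_mul_norm_sq (d := d) hl4).const_mul
      ((4 * Real.pi * l) ^ (-(d : ℝ) / 2)))
    have hm : Measurable fun q : (Space d × Space d) × Space d =>
        inner ℝ (q.1.1 - q.1.2) q.2 :=
      (measurable_fst.fst.sub measurable_fst.snd).inner measurable_snd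
    refine (h.mul_bdd (c := 1) (g := fun q : (Space d × Space d) × Space d =>
      Real.cos (inner ℝ (q.1.1 - q.1.2) q.2)) ?_ ?_).congr (ae_of_all _ fun q => ?_)
    · exact Measurable.aestronglyMeasurable (by fun_prop)
    · exact ae_of_all _ fun q => Real.abs_cos_le_one _
    · simp only [Function.uncurry]
      ring
  calc ∫ q : Space d × Space d, stableKernel α κ t (x - q.1) * stableKernel α κ s (y - q.2) *
      Real.exp (-l * ‖q.1 - q.2‖ ^ 2)
      = ∫ q : Space d × Space d, ∫ ξ : Space d,
        stableKernel α κ t (x - q.1) * stableKernel α κ s (y - q.2) *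
      ((4 * Real.pi * l) ^ (-(d : ℝ) / 2) *
      Real.exp (-(4 * l)⁻¹ * ‖ξ‖ ^ 2) * Real.cos (inner ℝ (q.1 - q.2) ξ)) := by
        refine integral_congr_ae (ae_of_all _ fun q => ?_)
        beta_reduce
        rw [integral_const_mul, ← exp_neg_norm_sq_eq_integral hl]
    _ = _ := by
        rw [integral_integral_swap hint, gaussStable]
        refine integral_congr_ae (ae_of_all _ fun ξ => ?_)
        beta_reduce
        rw [← integral_stableKernel_prod_mul_cos hd hα hα2 hκ ht hs x y ξ, ← integral_const_mul]
        refine integral_congr_ae (ae_of_all _ fun q => ?_)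
        beta_reduce
        ring

/-- The covariance `W ∫ |ξ|^{β-d} cos⟨ξ, z⟩ e^{-κ τ |ξ|^α} dξ` of the smoothed noise. -/
noncomputable def spectralCov (d : ℕ) (α β κ τ : ℝ) (z : Space d) : ℝ :=
  ∫ ξ : Space d, spectralConst d β * ‖ξ‖ ^ (β - d) *
    (Real.cos (inner ℝ ξ z) * Real.exp (-(κ * τ * ‖ξ‖ ^ α)))

/-- Fubini in `(l, ξ)`: without the bounded cosine the integrand is nonnegative, and its integral is
that of `|ξ|^{β-d} e^{-κτ|ξ|^α}`, finite because `β > 0` controls the origin. -/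
lemma integral_gaussStable (hβ : 0 < β) (hβd : β < d) (hα : 0 < α) (hκ : 0 < κ)
    {τ : ℝ} (hτ : 0 < τ) (z : Space d) :
    IntegrableOn (fun l : ℝ => (Real.Gamma (β / 2))⁻¹ * l ^ (β / 2 - 1) *
      gaussStable d α κ l τ z) (Ioi 0) ∧
    ∫ l in Ioi (0 : ℝ), (Real.Gamma (β / 2))⁻¹ * l ^ (β / 2 - 1) * gaussStable d α κ l τ z =
      spectralCov d α β κ τ z := by
  have hd : 0 < d := by
    have : (0 : ℝ) < d := hβ.trans hβd
    exact_mod_cast this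
  have := Space.nontrivial hd
  have hW := spectralConst_pos hβ hβd
  have hΓ := Real.Gamma_pos_of_pos (half_pos hβ)
  have hmain : Integrable (Function.uncurry fun (l : ℝ) (ξ : Space d) =>
      (Real.Gamma (β / 2))⁻¹ * l ^ (β / 2 - 1) * ((4 * Real.pi * l) ^ (-(d : ℝ) / 2) *
        Real.exp (-(4 * l)⁻¹ * ‖ξ‖ ^ 2)) * Real.exp (-(κ * τ * ‖ξ‖ ^ α)))
      ((volume.restrict (Ioi (0 : ℝ))).prod volume) := by
    have hmeas : Measurable (Function.uncurry fun (l : ℝ) (ξ : Space d) =>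
      (Real.Gamma (β / 2))⁻¹ * l ^ (β / 2 - 1) * ((4 * Real.pi * l) ^ (-(d : ℝ) / 2) *
        Real.exp (-(4 * l)⁻¹ * ‖ξ‖ ^ 2)) * Real.exp (-(κ * τ * ‖ξ‖ ^ α))) := by
      unfold Function.uncurry
      fun_prop
    have hne : ∀ᵐ ξ : Space d, ξ ≠ 0 := by simp [ae_iff]
    rw [integrable_prod_iff' hmeas.aestronglyMeasurable]
    constructor
    · filter_upwards [hne] with ξ hξ
      have hint : IntegrableOn (fun l : ℝ => (Real.Gamma (β / 2))⁻¹ * l ^ (β / 2 - 1) *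
          ((4 * Real.pi * l) ^ (-(d : ℝ) / 2) * Real.exp (-(4 * l)⁻¹ * ‖ξ‖ ^ 2))) (Ioi 0) := by
        refine Integrable.of_integral_ne_zero ?_
        rw [integral_gaussian_mixture hβd (norm_pos_iff.2 hξ)]
        have := norm_pos_iff.2 hξ
        positivity
      exact hint.mul_const (Real.exp (-(κ * τ * ‖ξ‖ ^ α)))
    · refine ((integrable_norm_rpow_mul_exp hd hα (mul_pos hκ hτ)
        (q := β - d) (by linarith)).const_mul (spectralConst d β)).congr ?_
      filter_upwards [hne] with ξ hξ
      have h1 : ∫ l in Ioi (0 : ℝ), ‖Function.uncurry (fun (l : ℝ) (ξ : Space d) =>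
          (Real.Gamma (β / 2))⁻¹ * l ^ (β / 2 - 1) * ((4 * Real.pi * l) ^ (-(d : ℝ) / 2) *
        Real.exp (-(4 * l)⁻¹ * ‖ξ‖ ^ 2)) * Real.exp (-(κ * τ * ‖ξ‖ ^ α))) (l, ξ)‖ =
          ∫ l in Ioi (0 : ℝ), (Real.Gamma (β / 2))⁻¹ * l ^ (β / 2 - 1) *
          ((4 * Real.pi * l) ^ (-(d : ℝ) / 2) *
        Real.exp (-(4 * l)⁻¹ * ‖ξ‖ ^ 2)) * Real.exp (-(κ * τ * ‖ξ‖ ^ α)) := by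
        refine setIntegral_congr_fun measurableSet_Ioi fun l hl => ?_
        have hl : 0 < l := hl
        simp only [Function.uncurry]
        rw [Real.norm_of_nonneg (by positivity)]
      rw [h1, integral_mul_const, integral_gaussian_mixture hβd (norm_pos_iff.2 hξ)]
      ring
  have hm : Measurable fun q : ℝ × Space d => inner ℝ q.2 z := measurable_snd.inner measurable_const
  have hint := hmain.mul_bdd (c := 1) (g := fun q : ℝ × Space d => Real.cos (inner ℝ q.2 z))
    (Measurable.aestronglyMeasurable (by fun_prop)) (ae_of_all _ fun q => Real.abs_cos_le_one _)
  have heq : ∀ l : ℝ, (Real.Gamma (β / 2))⁻¹ * l ^ (β / 2 - 1) * gaussStable d α κ l τ z =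
      ∫ ξ : Space d, (Real.Gamma (β / 2))⁻¹ * l ^ (β / 2 - 1) * ((4 * Real.pi * l) ^ (-(d : ℝ) / 2) *
        Real.exp (-(4 * l)⁻¹ * ‖ξ‖ ^ 2)) * Real.exp (-(κ * τ * ‖ξ‖ ^ α)) *
          Real.cos (inner ℝ ξ z) := by
    intro l
    rw [gaussStable, ← integral_const_mul]
    refine integral_congr_ae (ae_of_all _ fun ξ => ?_)
    beta_reduce
    ring
  simp_rw [heq]
  refine ⟨hint.integral_prod_left, ?_⟩
  rw [integral_integral_swap hint, spectralCov]
  have hne : ∀ᵐ ξ : Space d, ξ ≠ 0 := by simp [ae_iff]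
  refine integral_congr_ae ?_
  filter_upwards [hne] with ξ hξ
  rw [integral_mul_const, integral_mul_const, integral_gaussian_mixture hβd (norm_pos_iff.2 hξ)]
  ring

/-- Positivity of the stable kernel is essential here: the equality of lower integrals then gives
finiteness and the value at once, and shows that the spectral expression is nonnegative although its
integrand oscillates. -/
lemma lintegral_stableKernel_riesz (hβ : 0 < β) (hβd : β < d) (hα : 0 < α) (hα2 : α ≤ 2)
    (hκ : 0 < κ) {t s : ℝ} (ht : 0 < t) (hs : 0 < s) (x y : Space d) :
    0 ≤ spectralCov d α β κ (t + s) (x - y) ∧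
    ∫⁻ q : Space d × Space d, ENNReal.ofReal (stableKernel α κ t (x - q.1)) *
      ENNReal.ofReal (stableKernel α κ s (y - q.2)) * ENNReal.ofReal (‖q.1 - q.2‖ ^ (-β)) =
      ENNReal.ofReal (spectralCov d α β κ (t + s) (x - y)) := by
  have hd : 0 < d := by
    have : (0 : ℝ) < d := hβ.trans hβd
    exact_mod_cast this
  have hΓ := Real.Gamma_pos_of_pos (half_pos hβ)
  have hGm1 := (continuous_stableKernel hd hα hκ ht (d := d)).measurable
  have hGm2 := (continuous_stableKernel hd hα hκ hs (d := d)).measurable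
  have hG1 := stableKernel_nonneg hd hα hα2 hκ ht (d := d)
  have hG2 := stableKernel_nonneg hd hα hα2 hκ hs (d := d)
  have hG := integrable_stableKernel_prod hd hα hα2 hκ ht hs x y
  obtain ⟨hi, hS⟩ := integral_gaussStable hβ hβd hα hκ (add_pos ht hs) (x - y)
  have hΦ : ∀ l : ℝ, 0 < l → 0 ≤ gaussStable d α κ l (t + s) (x - y) := fun l hl => by
    rw [← integral_stableKernel_prod_mul_exp hd hα hα2 hκ ht hs hl]
    exact integral_nonneg fun q => mul_nonneg (mul_nonneg (hG1 _) (hG2 _)) (Real.exp_nonneg _)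
  have h0 : ∀ l ∈ Ioi (0 : ℝ), 0 ≤ (Real.Gamma (β / 2))⁻¹ * l ^ (β / 2 - 1) *
      gaussStable d α κ l (t + s) (x - y) := fun l hl =>
    mul_nonneg (mul_nonneg (by positivity) (Real.rpow_nonneg (le_of_lt hl) _)) (hΦ l hl)
  refine ⟨hS ▸ setIntegral_nonneg measurableSet_Ioi h0, ?_⟩
  rw [← hS, ofReal_integral_eq_lintegral_ofReal hi]
  · calc _ = ∫⁻ q : Space d × Space d, ∫⁻ l in Ioi (0 : ℝ),
          ENNReal.ofReal (stableKernel α κ t (x - q.1)) *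
          ENNReal.ofReal (stableKernel α κ s (y - q.2)) *
          ENNReal.ofReal ((Real.Gamma (β / 2))⁻¹ * l ^ (β / 2 - 1) *
            Real.exp (-l * ‖q.1 - q.2‖ ^ 2)) := by
          refine lintegral_congr_ae ?_
          filter_upwards [ae_fst_ne_snd hd] with q hq
          rw [ofReal_rpow_neg_eq_lintegral hβ (norm_pos_iff.2 (sub_ne_zero.2 hq)),
            lintegral_const_mul _ (by fun_prop)]
      _ = _ := by
          rw [lintegral_lintegral_swap (by
            refine Measurable.aemeasurable ?_
            unfold Function.uncurry
            fun_prop)]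
          refine setLIntegral_congr_fun measurableSet_Ioi fun l hl => ?_
          have hl : 0 < l := hl
          beta_reduce
          rw [ENNReal.ofReal_mul (mul_nonneg (by positivity) (Real.rpow_nonneg hl.le _)),
            ← integral_stableKernel_prod_mul_exp hd hα hα2 hκ ht hs hl,
            ofReal_integral_eq_lintegral_ofReal, ← lintegral_const_mul _ (by fun_prop)]
          · refine lintegral_congr fun q => ?_
            rw [ENNReal.ofReal_mul (mul_nonneg (by positivity) (Real.rpow_nonneg hl.le _)),
              ENNReal.ofReal_mul (mul_nonneg (hG1 _) (hG2 _)), ENNReal.ofReal_mul (hG1 _)]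
            ring
          · refine hG.mul_bdd (c := 1) (Measurable.aestronglyMeasurable (by fun_prop))
              (ae_of_all _ fun q => ?_)
            rw [Real.norm_of_nonneg (Real.exp_nonneg _), Real.exp_le_one_iff]
            have : 0 ≤ l * ‖q.1 - q.2‖ ^ 2 := by positivity
            linarith
          · exact ae_of_all _ fun q =>
              mul_nonneg (mul_nonneg (hG1 _) (hG2 _)) (Real.exp_nonneg _)
  · filter_upwards [ae_restrict_mem measurableSet_Ioi] with l hl
    exact h0 l hl

end Spectral

/-! ### The covariance of the stochastic convolution. -/

section Covariance

variable {d : ℕ} {α β κ : ℝ}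

/-- The integral `∫_0^s e^{-a(t+s-2r)} dr`, for `a > 0`. -/
noncomputable def timeFactor (a t s : ℝ) : ℝ :=
  (Real.exp (-(a * (t - s))) - Real.exp (-(a * (t + s)))) / (2 * a)

lemma setIntegral_exp_eq_timeFactor {a t s : ℝ} (ha : a ≠ 0) (hs : 0 ≤ s) :
    ∫ r in Ioo (0 : ℝ) s, Real.exp (-(a * (t + s - 2 * r))) = timeFactor a t s := by
  rw [← integral_Ioc_eq_integral_Ioo, ← intervalIntegral.integral_of_le hs]
  have hderiv : ∀ r ∈ uIcc 0 s, HasDerivAt (fun r => Real.exp (-(a * (t + s - 2 * r))) / (2 * a))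
      (Real.exp (-(a * (t + s - 2 * r)))) r := by
    intro r _
    have h1 : HasDerivAt (fun r : ℝ => -(a * (t + s - 2 * r))) (2 * a) r := by
      have h := ((hasDerivAt_id' r).const_mul (2 * a)).add_const (-(a * (t + s)))
      rw [mul_one] at h
      exact h.congr_of_eventuallyEq (Eventually.of_forall fun r => by ring)
    have h2 := h1.exp.div_const (2 * a)
    rwa [mul_div_cancel_right₀ _ (by simpa using ha)] at h2
  rw [intervalIntegral.integral_eq_sub_of_hasDerivAt hderiv
    (Continuous.intervalIntegrable (by fun_prop) _ _), timeFactor, sub_div]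
  ring_nf

lemma timeFactor_eq (a t s : ℝ) :
    timeFactor a t s = Real.exp (-(a * (t - s))) * ((1 - Real.exp (-(2 * a * s))) / (2 * a)) := by
  have e : Real.exp (-(a * (t + s))) = Real.exp (-(a * (t - s))) * Real.exp (-(2 * a * s)) := by
    rw [← Real.exp_add]
    ring_nf
  rw [timeFactor, e]
  ring

lemma timeFactor_nonneg {a t s : ℝ} (ha : 0 < a) (hs : 0 ≤ s) : 0 ≤ timeFactor a t s := by
  rw [timeFactor_eq]
  have : Real.exp (-(2 * a * s)) ≤ 1 := by
    rw [Real.exp_le_one_iff, neg_nonpos]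
    positivity
  exact mul_nonneg (Real.exp_nonneg _) (div_nonneg (by linarith) (by positivity))

lemma timeFactor_le_self {a t s : ℝ} (ha : 0 < a) (hs : 0 ≤ s) (hst : s ≤ t) :
    timeFactor a t s ≤ timeFactor a s s := by
  have h := timeFactor_nonneg (t := s) ha hs
  rw [timeFactor_eq a t s]
  rw [timeFactor_eq a s s, sub_self, mul_zero, neg_zero, Real.exp_zero, one_mul] at h ⊢
  refine mul_le_of_le_one_left h (Real.exp_le_one_iff.2 ?_)
  rw [neg_nonpos]
  exact mul_nonneg ha.le (by linarith)

lemma timeFactor_self_le {a s : ℝ} (ha : 0 < a) : timeFactor a s s ≤ s := by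
  rw [timeFactor_eq, sub_self, mul_zero, neg_zero, Real.exp_zero, one_mul, div_le_iff₀ (by positivity)]
  have := Real.add_one_le_exp (-(2 * a * s))
  linarith

lemma timeFactor_self_le' {a s : ℝ} (ha : 0 < a) : timeFactor a s s ≤ 1 / (2 * a) := by
  rw [timeFactor_eq, sub_self, mul_zero, neg_zero, Real.exp_zero, one_mul]
  gcongr
  linarith [Real.exp_pos (-(2 * a * s))]

/-- The function `|ξ|^p` on the unit ball and `|ξ|^q` off it. -/
noncomputable def splitPow (p q : ℝ) (ξ : Space d) : ℝ := if ‖ξ‖ ≤ 1 then ‖ξ‖ ^ p else ‖ξ‖ ^ q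

lemma integrable_splitPow (hd : 0 < d) {p q : ℝ} (hp : -(d : ℝ) < p) (hq : q < -(d : ℝ)) :
    Integrable (splitPow p q : Space d → ℝ) := by
  have := Space.nontrivial hd
  refine (integrable_fun_norm_addHaar (volume : Measure (Space d))
    (f := fun r : ℝ => if r ≤ 1 then r ^ p else r ^ q)).2 ?_
  have hpow : ∀ (e r : ℝ), 0 < r → r ^ (d - 1) * r ^ e = r ^ ((d : ℝ) - 1 + e) := fun e r hr => by
    rw [Real.rpow_add hr, ← Real.rpow_natCast, Nat.cast_sub (by omega)]
    push_cast
    ring_nf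
  simp only [finrank_euclideanSpace, Fintype.card_fin, smul_eq_mul]
  rw [← Ioc_union_Ioi_eq_Ioi (zero_le_one (α := ℝ))]
  refine IntegrableOn.union ?_ ?_
  · have h1 : IntegrableOn (fun r : ℝ => r ^ ((d : ℝ) - 1 + p)) (Ioc 0 1) := by
      have := intervalIntegral.intervalIntegrable_rpow' (a := 0) (b := 1) (r := (d : ℝ) - 1 + p)
        (by linarith)
      rwa [intervalIntegrable_iff_integrableOn_Ioc_of_le zero_le_one] at this
    refine h1.congr_fun (fun r hr => ?_) measurableSet_Ioc
    simp only [hr.2, if_true]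
    rw [hpow p r hr.1]
  · have h1 : IntegrableOn (fun r : ℝ => r ^ ((d : ℝ) - 1 + q)) (Ioi 1) :=
      integrableOn_Ioi_rpow_of_lt (by linarith) zero_lt_one
    refine h1.congr_fun (fun r hr => ?_) measurableSet_Ioi
    have hr : 1 < r := hr
    simp only [not_le.2 hr, if_false]
    rw [hpow q r (by linarith)]

lemma ae_ne_zero (hd : 0 < d) : ∀ᵐ ξ : Space d, ξ ≠ 0 := by
  have := Space.nontrivial hd
  simp [ae_iff]

lemma mul_le_splitPow {C p q e A B : ℝ} {ξ : Space d} (hξ : ξ ≠ 0)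
    (hA : ‖ξ‖ ≤ 1 → A ≤ C * ‖ξ‖ ^ p) (hB : 1 ≤ ‖ξ‖ → A ≤ C * ‖ξ‖ ^ q) (hBe : 0 ≤ B) :
    B * ‖ξ‖ ^ e * A ≤ B * C * splitPow (e + p) (e + q) ξ := by
  have hn := norm_pos_iff.2 hξ
  unfold splitPow
  split_ifs with h
  · rw [Real.rpow_add hn]
    calc B * ‖ξ‖ ^ e * A ≤ B * ‖ξ‖ ^ e * (C * ‖ξ‖ ^ p) := by
          gcongr
          exact hA h
      _ = _ := by ring
  · rw [Real.rpow_add hn]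
    calc B * ‖ξ‖ ^ e * A ≤ B * ‖ξ‖ ^ e * (C * ‖ξ‖ ^ q) := by
          gcongr
          exact hB (not_le.1 h).le
      _ = _ := by ring

lemma measurable_timeFactor (t s : ℝ) :
    Measurable fun ξ : Space d => timeFactor (κ * ‖ξ‖ ^ α) t s := by
  unfold timeFactor
  fun_prop

/-- The time factor is at most `s` near the origin and at most `1/(2κ|ξ|^α)` far away. The exponents
become `β - d` and `β - d - α`, integrable precisely because `0 < β < α`. -/
lemma integrable_spectral_timeFactor (hβ : 0 < β) (hβd : β < d) (hβα : β < α)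
    (hκ : 0 < κ) {t s : ℝ} (hs : 0 ≤ s) (hst : s ≤ t) :
    Integrable fun ξ : Space d =>
      spectralConst d β * ‖ξ‖ ^ (β - d) * timeFactor (κ * ‖ξ‖ ^ α) t s := by
  have hd : 0 < d := by
    have : (0 : ℝ) < d := hβ.trans hβd
    exact_mod_cast this
  have hW := spectralConst_pos hβ hβd
  have hm := measurable_timeFactor (d := d) (α := α) (κ := κ) t s
  refine ((integrable_splitPow hd (p := β - d + 0) (q := β - d + -α) (by linarith)
    (by linarith)).const_mul (spectralConst d β * (s + 1 / (2 * κ)))).mono'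
    (Measurable.aestronglyMeasurable (by fun_prop)) ?_
  filter_upwards [ae_ne_zero hd] with ξ hξ
  have hn := norm_pos_iff.2 hξ
  have ha : 0 < κ * ‖ξ‖ ^ α := by positivity
  have h0 := timeFactor_nonneg (t := t) ha hs
  rw [Real.norm_of_nonneg (by positivity)]
  refine mul_le_splitPow hξ (fun _ => ?_) (fun _ => ?_) hW.le
  · rw [Real.rpow_zero, mul_one]
    refine (timeFactor_le_self ha hs hst).trans ((timeFactor_self_le ha).trans ?_)
    have : 0 < 1 / (2 * κ) := by positivity
    linarith
  · refine (timeFactor_le_self ha hs hst).trans ((timeFactor_self_le' ha).trans ?_)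
    rw [Real.rpow_neg hn.le]
    have h1 : 1 / (2 * (κ * ‖ξ‖ ^ α)) = 1 / (2 * κ) * (‖ξ‖ ^ α)⁻¹ := by field_simp
    rw [h1]
    gcongr
    linarith

lemma measurable_convolutionKernel (t : ℝ) (x : Space d) :
    Measurable (convolutionKernel α κ t x) := by
  unfold convolutionKernel
  refine Measurable.indicator ?_ (measurableSet_Ioo.prod MeasurableSet.univ)
  exact measurable_stableKernel.comp (f := fun p : ℝ × Space d => (t - p.1, x - p.2))
    (by fun_prop)

lemma convolutionKernel_nonneg (hd : 0 < d) (hα : 0 < α) (hα2 : α ≤ 2) (hκ : 0 < κ) (t : ℝ)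
    (x : Space d) (p : ℝ × Space d) : 0 ≤ convolutionKernel α κ t x p := by
  refine indicator_nonneg (fun q hq => stableKernel_nonneg hd hα hα2 hκ ?_ _) p
  linarith [hq.1.2]

lemma setIntegral_spectralCov (hβ : 0 < β) (hβd : β < d) (hβα : β < α)
    (hκ : 0 < κ) {t s : ℝ} (hs : 0 < s) (hst : s ≤ t) (z : Space d) :
    IntegrableOn (fun r : ℝ => spectralCov d α β κ (t + s - 2 * r) z) (Ioo 0 s) ∧
    ∫ r in Ioo (0 : ℝ) s, spectralCov d α β κ (t + s - 2 * r) z =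
      ∫ ξ : Space d, spectralConst d β * ‖ξ‖ ^ (β - d) * timeFactor (κ * ‖ξ‖ ^ α) t s *
        Real.cos (inner ℝ ξ z) := by
  have hd : 0 < d := by
    have : (0 : ℝ) < d := hβ.trans hβd
    exact_mod_cast this
  have hW := spectralConst_pos hβ hβd
  have hexp : ∀ ξ : Space d, ξ ≠ 0 → ∫ r in Ioo (0 : ℝ) s,
      Real.exp (-(κ * (t + s - 2 * r) * ‖ξ‖ ^ α)) = timeFactor (κ * ‖ξ‖ ^ α) t s := by
    intro ξ hξ
    have hn := norm_pos_iff.2 hξ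
    rw [← setIntegral_exp_eq_timeFactor (by positivity) hs.le]
    congr 1; ext r; ring_nf
  have hmain : Integrable (Function.uncurry fun (r : ℝ) (ξ : Space d) =>
      spectralConst d β * ‖ξ‖ ^ (β - d) * Real.exp (-(κ * (t + s - 2 * r) * ‖ξ‖ ^ α)))
      ((volume.restrict (Ioo (0 : ℝ) s)).prod volume) := by
    have hmeas : Measurable (Function.uncurry fun (r : ℝ) (ξ : Space d) =>
      spectralConst d β * ‖ξ‖ ^ (β - d) * Real.exp (-(κ * (t + s - 2 * r) * ‖ξ‖ ^ α))) := by
      unfold Function.uncurry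
      fun_prop
    rw [integrable_prod_iff' hmeas.aestronglyMeasurable]
    constructor
    · filter_upwards with ξ
      have : Continuous fun r : ℝ => spectralConst d β * ‖ξ‖ ^ (β - d) *
          Real.exp (-(κ * (t + s - 2 * r) * ‖ξ‖ ^ α)) := by fun_prop
      exact (this.integrableOn_Icc (a := 0) (b := s)).mono_set Ioo_subset_Icc_self
    · refine (integrable_spectral_timeFactor hβ hβd hβα hκ hs.le hst).congr ?_
      filter_upwards [ae_ne_zero hd] with ξ hξ
      rw [← hexp ξ hξ, ← integral_const_mul]
      refine integral_congr_ae (ae_of_all _ fun r => ?_)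
      simp only [Function.uncurry]
      rw [Real.norm_of_nonneg (by positivity)]
  have hm : Measurable fun q : ℝ × Space d => inner ℝ q.2 z := measurable_snd.inner measurable_const
  have hint := hmain.mul_bdd (c := 1) (g := fun q : ℝ × Space d => Real.cos (inner ℝ q.2 z))
    (Measurable.aestronglyMeasurable (by fun_prop)) (ae_of_all _ fun q => Real.abs_cos_le_one _)
  have heq : ∀ r : ℝ, spectralCov d α β κ (t + s - 2 * r) z = ∫ ξ : Space d,
      spectralConst d β * ‖ξ‖ ^ (β - d) * Real.exp (-(κ * (t + s - 2 * r) * ‖ξ‖ ^ α)) *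
        Real.cos (inner ℝ ξ z) := by
    intro r
    rw [spectralCov]
    refine integral_congr_ae (ae_of_all _ fun ξ => ?_)
    beta_reduce
    ring
  simp_rw [heq]
  refine ⟨hint.integral_prod_left, ?_⟩
  rw [integral_integral_swap hint]
  refine integral_congr_ae ?_
  filter_upwards [ae_ne_zero hd] with ξ hξ
  rw [integral_mul_const, integral_const_mul, hexp ξ hξ]

theorem rieszInner_convolutionKernel (hβ : 0 < β) (hβd : β < d) (hα : 0 < α) (hα2 : α ≤ 2)
    (hβα : β < α) (hκ : 0 < κ) {t s : ℝ} (hs : 0 < s) (hst : s ≤ t) (x y : Space d) :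
    rieszInner β (convolutionKernel α κ t x) (convolutionKernel α κ s y) =
      ∫ ξ : Space d, spectralConst d β * ‖ξ‖ ^ (β - d) * timeFactor (κ * ‖ξ‖ ^ α) t s *
        Real.cos (inner ℝ ξ (x - y)) := by
  have hd : 0 < d := by
    have : (0 : ℝ) < d := hβ.trans hβd
    exact_mod_cast this
  have h0t := convolutionKernel_nonneg hd hα hα2 hκ t x
  have h0s := convolutionKernel_nonneg hd hα hα2 hκ s y
  obtain ⟨hi, hI⟩ := setIntegral_spectralCov hβ hβd hβα hκ hs hst (x - y)
  -- At time `r` the two kernels have ages `t - r` and `s - r`, with sum `t + s - 2r`; integrating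
  -- the resulting exponential over `r < s` produces `timeFactor`.
  have hcov : ∀ r ∈ Ioo (0 : ℝ) s, _ := fun r hr => lintegral_stableKernel_riesz hβ hβd hα hα2 hκ
    (t := t - r) (s := s - r) (by linarith [hr.2]) (by linarith [hr.2]) x y
  rw [← hI, rieszInner, integral_eq_lintegral_of_nonneg_ae
    (ae_of_all _ fun p => rieszIntegrand_nonneg h0t h0s p)
    (measurable_rieszIntegrand (measurable_convolutionKernel t x)
      (measurable_convolutionKernel s y)).aestronglyMeasurable,
    lintegral_ofReal_rieszIntegrand (measurable_convolutionKernel t x)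
      (measurable_convolutionKernel s y) h0t h0s]
  have hinner : ∀ r ∈ Ioi (0 : ℝ), ∫⁻ q : Space d × Space d,
      ENNReal.ofReal (convolutionKernel α κ t x (r, q.1)) *
      ENNReal.ofReal (convolutionKernel α κ s y (r, q.2)) *
        ENNReal.ofReal (‖q.1 - q.2‖ ^ (-β)) =
      (Iio s).indicator
        (fun r => ENNReal.ofReal (spectralCov d α β κ (t + s - 2 * r) (x - y))) r := by
    intro r hr
    by_cases hrs : r < s
    · rw [indicator_of_mem (show r ∈ Iio s from hrs)]
      have h := (hcov r ⟨hr, hrs⟩).2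
      rw [show t - r + (s - r) = t + s - 2 * r by ring] at h
      rw [← h]
      refine lintegral_congr fun q => ?_
      rw [convolutionKernel, convolutionKernel, indicator_of_mem, indicator_of_mem]
      · exact ⟨⟨hr, hrs⟩, mem_univ _⟩
      · exact ⟨⟨hr, hrs.trans_le hst⟩, mem_univ _⟩
    · rw [indicator_of_notMem (show r ∉ Iio s from hrs)]
      simp only [convolutionKernel]
      convert lintegral_zero with q
      rw [indicator_of_notMem (s := Ioo 0 s ×ˢ univ) (fun h => hrs h.1.2)]
      simp
  rw [setLIntegral_congr_fun measurableSet_Ioi hinner, setLIntegral_indicator measurableSet_Iio,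
    inter_comm, Ioi_inter_Iio, ← ofReal_integral_eq_lintegral_ofReal hi, ENNReal.toReal_ofReal]
  · refine setIntegral_nonneg measurableSet_Ioo fun r hr => ?_
    have h := (hcov r hr).1
    rwa [show t - r + (s - r) = t + s - 2 * r by ring] at h
  · filter_upwards [ae_restrict_mem measurableSet_Ioo] with r hr
    have h := (hcov r hr).1
    rwa [show t - r + (s - r) = t + s - 2 * r by ring] at h

end Covariance

/-! ### Growth of the variance, decorrelation, and Hölder bounds for increments. -/

section Estimates

variable {d : ℕ} {α β κ : ℝ}

/-- The covariance of the stochastic convolution at `(t, x)` and `(s, y)`, for `s ≤ t`. -/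
noncomputable def convCov (d : ℕ) (α β κ t s : ℝ) (z : Space d) : ℝ :=
  ∫ ξ : Space d, spectralConst d β * ‖ξ‖ ^ (β - d) * timeFactor (κ * ‖ξ‖ ^ α) t s *
    Real.cos (inner ℝ ξ z)

lemma convCov_zero (t s : ℝ) : convCov d α β κ t s 0 =
    ∫ ξ : Space d, spectralConst d β * ‖ξ‖ ^ (β - d) * timeFactor (κ * ‖ξ‖ ^ α) t s := by
  simp [convCov]

lemma convCov_zero_nonneg (hβ : 0 < β) (hβd : β < d) (hκ : 0 < κ) {t s : ℝ} (hs : 0 ≤ s) :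
    0 ≤ convCov d α β κ t s 0 := by
  have hd : 0 < d := by
    have : (0 : ℝ) < d := hβ.trans hβd
    exact_mod_cast this
  have hW := spectralConst_pos hβ hβd
  rw [convCov_zero]
  refine integral_nonneg_of_ae ?_
  filter_upwards [ae_ne_zero hd] with ξ hξ
  have hn := norm_pos_iff.2 hξ
  have := timeFactor_nonneg (t := t) (a := κ * ‖ξ‖ ^ α) (by positivity) hs
  simp only [Pi.zero_apply]
  positivity

/-- The dependence on the later time is only through `e^{-a(t-s)} ≤ 1`. Thus the covariance with a
fixed earlier time remains bounded, which makes the normalized variables asymptotically orthogonal.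
-/
lemma convCov_zero_le (hβ : 0 < β) (hβd : β < d) (hβα : β < α) (hκ : 0 < κ) {t s : ℝ}
    (hs : 0 ≤ s) (hst : s ≤ t) : convCov d α β κ t s 0 ≤ convCov d α β κ s s 0 := by
  have hd : 0 < d := by
    have : (0 : ℝ) < d := hβ.trans hβd
    exact_mod_cast this
  have hW := spectralConst_pos hβ hβd
  rw [convCov_zero, convCov_zero]
  refine integral_mono_ae (integrable_spectral_timeFactor hβ hβd hβα hκ hs hst)
    (integrable_spectral_timeFactor hβ hβd hβα hκ hs le_rfl) ?_
  filter_upwards [ae_ne_zero hd] with ξ hξ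
  have hn := norm_pos_iff.2 hξ
  have := timeFactor_le_self (a := κ * ‖ξ‖ ^ α) (by positivity) hs hst
  gcongr

lemma timeFactor_self_eq (a t : ℝ) :
    timeFactor a t t = (1 - Real.exp (-(2 * a * t))) / (2 * a) := by
  rw [timeFactor_eq, sub_self, mul_zero, neg_zero, Real.exp_zero, one_mul]

lemma not_integrable_norm_rpow (hd : 0 < d) (q : ℝ) :
    ¬ Integrable fun ξ : Space d => ‖ξ‖ ^ q := by
  have := Space.nontrivial hd
  intro h
  have h' := (integrable_fun_norm_addHaar (volume : Measure (Space d))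
    (f := fun r : ℝ => r ^ q)).1 h
  refine not_integrableOn_Ioi_rpow ((d : ℝ) - 1 + q) (h'.congr_fun (fun r hr => ?_)
    measurableSet_Ioi)
  have hr : 0 < r := hr
  simp only [finrank_euclideanSpace, Fintype.card_fin, smul_eq_mul]
  rw [Real.rpow_add hr, ← Real.rpow_natCast, Nat.cast_sub (by omega)]
  push_cast
  ring_nf

/-- The spectral integrands increase to a multiple of `|ξ|^{β-d-α}`. If the integrals were bounded,
Fatou's lemma would make this pure power integrable on the whole space, and no pure power is. -/
theorem tendsto_convCov_atTop (hβ : 0 < β) (hβd : β < d) (hβα : β < α) (hκ : 0 < κ) :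
    Tendsto (fun n : ℕ => convCov d α β κ (n : ℝ) n 0) atTop atTop := by
  have hd : 0 < d := by
    have : (0 : ℝ) < d := hβ.trans hβd
    exact_mod_cast this
  have hW := spectralConst_pos hβ hβd
  have hint : ∀ n : ℕ, _ := fun n : ℕ => integrable_spectral_timeFactor (d := d) hβ hβd hβα hκ
    (t := n) (s := n) (Nat.cast_nonneg n) le_rfl
  refine tendsto_atTop_atTop_of_monotone (fun m n hmn => ?_) fun B => ?_
  · rw [convCov_zero, convCov_zero]
    refine integral_mono_ae (hint m) (hint n) ?_
    filter_upwards [ae_ne_zero hd] with ξ hξ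
    have hn := norm_pos_iff.2 hξ
    have hmn' : (m : ℝ) ≤ n := by exact_mod_cast hmn
    simp only [timeFactor_self_eq]
    gcongr
  · by_contra! hB
    refine not_integrable_norm_rpow hd (β - d - α) ?_
    have hlim : ∀ ξ : Space d, ξ ≠ 0 → Tendsto (fun n : ℕ => ENNReal.ofReal
        (spectralConst d β * ‖ξ‖ ^ (β - d) * timeFactor (κ * ‖ξ‖ ^ α) n n)) atTop
        (𝓝 (ENNReal.ofReal (spectralConst d β / (2 * κ) * ‖ξ‖ ^ (β - d - α)))) := by
      intro ξ hξ
      have hn := norm_pos_iff.2 hξ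
      refine ENNReal.tendsto_ofReal ?_
      have h1 : Tendsto (fun n : ℕ => -(2 * (κ * ‖ξ‖ ^ α) * (n : ℝ))) atTop atBot :=
        tendsto_neg_atTop_atBot.comp
          (tendsto_natCast_atTop_atTop.const_mul_atTop (by positivity))
      have h2 := (((Real.tendsto_exp_atBot.comp h1).const_sub 1).div_const
        (2 * (κ * ‖ξ‖ ^ α))).const_mul (spectralConst d β * ‖ξ‖ ^ (β - d))
      simp only [timeFactor_self_eq]
      have hval : spectralConst d β / (2 * κ) * ‖ξ‖ ^ (β - d - α) =
          spectralConst d β * ‖ξ‖ ^ (β - d) * ((1 - 0) / (2 * (κ * ‖ξ‖ ^ α))) := by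
        rw [Real.rpow_sub hn (β - d) α]
        field_simp
        ring
      rw [hval]
      exact h2
    have hle : ∫⁻ ξ : Space d, ENNReal.ofReal
        (spectralConst d β / (2 * κ) * ‖ξ‖ ^ (β - d - α)) ≤ ENNReal.ofReal B := by
      calc _ = ∫⁻ ξ : Space d, liminf (fun n : ℕ => ENNReal.ofReal
            (spectralConst d β * ‖ξ‖ ^ (β - d) * timeFactor (κ * ‖ξ‖ ^ α) n n)) atTop := by
            refine lintegral_congr_ae ?_
            filter_upwards [ae_ne_zero hd] with ξ hξ
            exact (hlim ξ hξ).liminf_eq.symm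
        _ ≤ liminf (fun n : ℕ => ∫⁻ ξ : Space d, ENNReal.ofReal
            (spectralConst d β * ‖ξ‖ ^ (β - d) * timeFactor (κ * ‖ξ‖ ^ α) n n)) atTop := by
            refine lintegral_liminf_le fun n => ?_
            have := measurable_timeFactor (d := d) (α := α) (κ := κ) n n
            fun_prop
        _ ≤ liminf (fun n : ℕ => ENNReal.ofReal B) atTop := by
            refine liminf_le_liminf (Eventually.of_forall fun n => ?_)
            rw [← ofReal_integral_eq_lintegral_ofReal (hint n), ← convCov_zero]
            · exact ENNReal.ofReal_le_ofReal (hB n).le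
            · filter_upwards [ae_ne_zero hd] with ξ hξ
              have hn := norm_pos_iff.2 hξ
              have := timeFactor_nonneg (t := n) (a := κ * ‖ξ‖ ^ α) (by positivity)
                (Nat.cast_nonneg n)
              simp only [Pi.zero_apply]
              positivity
        _ = _ := by simp
    have hi : Integrable fun ξ : Space d => spectralConst d β / (2 * κ) * ‖ξ‖ ^ (β - d - α) := by
      refine ⟨Measurable.aestronglyMeasurable (by fun_prop), ?_⟩
      rw [hasFiniteIntegral_iff_ofReal (ae_of_all _ fun ξ => by positivity)]
      exact hle.trans_lt ENNReal.ofReal_lt_top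
    have := hi.const_mul (spectralConst d β / (2 * κ))⁻¹
    refine this.congr (ae_of_all _ fun ξ => ?_)
    beta_reduce
    rw [inv_mul_cancel_left₀ (by positivity)]

lemma timeFactor_increment_le {a t s c : ℝ} (ha : 0 < a) (hs : 0 ≤ s) (hst : s ≤ t) (hc : c ≤ 1) :
    timeFactor a t t + timeFactor a s s - 2 * (timeFactor a t s * c) ≤
      (1 - Real.exp (-(a * (t - s)))) / a + (1 - c) / a := by
  have h1 : timeFactor a t s ≤ 1 / (2 * a) :=
    (timeFactor_le_self ha hs hst).trans (timeFactor_self_le' ha)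
  have h2 : timeFactor a t t + timeFactor a s s - 2 * timeFactor a t s ≤
      (1 - Real.exp (-(a * (t - s)))) / a := by
    rw [timeFactor_self_eq, timeFactor_self_eq, timeFactor_eq]
    have e : Real.exp (-(2 * a * t)) =
        Real.exp (-(a * (t - s))) * Real.exp (-(a * (t - s))) * Real.exp (-(2 * a * s)) := by
      rw [← Real.exp_add, ← Real.exp_add]
      ring_nf
    rw [e]
    set E := Real.exp (-(a * (t - s)))
    have hY := Real.exp_pos (-(2 * a * s))
    set Y := Real.exp (-(2 * a * s))
    -- The defect in the temporal estimate is an explicit square.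
    have : (1 - E) / a - ((1 - E * E * Y) / (2 * a) + (1 - Y) / (2 * a) -
        2 * (E * ((1 - Y) / (2 * a)))) = Y * (1 - E) ^ 2 / (2 * a) := by
      field_simp
      ring
    have h3 : 0 ≤ Y * (1 - E) ^ 2 / (2 * a) := by positivity
    linarith
  have h3 : 2 * timeFactor a t s * (1 - c) ≤ (1 - c) / a := by
    calc 2 * timeFactor a t s * (1 - c) ≤ 2 * (1 / (2 * a)) * (1 - c) := by
          have : 0 ≤ 1 - c := by linarith
          gcongr
      _ = (1 - c) / a := by field_simp
  linarith

lemma one_sub_exp_neg_le_rpow {x r : ℝ} (hx : 0 < x) (hr : 0 ≤ r) (hr1 : r ≤ 1) :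
    1 - Real.exp (-x) ≤ x ^ r := by
  rcases le_total x 1 with h | h
  · calc 1 - Real.exp (-x) ≤ x := by linarith [Real.add_one_le_exp (-x)]
      _ = x ^ (1 : ℝ) := (Real.rpow_one x).symm
      _ ≤ x ^ r := Real.rpow_le_rpow_of_exponent_ge hx h hr1
  · exact (by linarith [Real.exp_pos (-x)] : 1 - Real.exp (-x) ≤ 1).trans
      (Real.one_le_rpow h hr)

lemma one_sub_cos_le_rpow {x r : ℝ} (hr : 0 < r) (hr2 : r ≤ 2) :
    1 - Real.cos x ≤ 2 * |x| ^ r := by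
  rcases eq_or_ne x 0 with rfl | hx
  · simp [Real.zero_rpow hr.ne']
  have hx0 := abs_pos.2 hx
  rcases le_total |x| 1 with h | h
  · have h1 := Real.one_sub_sq_div_two_le_cos (x := x)
    have h2 : |x| ^ (2 : ℝ) ≤ |x| ^ r := Real.rpow_le_rpow_of_exponent_ge hx0 h hr2
    rw [Real.rpow_two, sq_abs] at h2
    nlinarith [sq_nonneg x]
  · have := Real.one_le_rpow h hr.le
    linarith [Real.neg_one_le_cos x]

theorem exists_convCov_increment_le (hβ : 0 < β) (hβd : β < d) (hα : 0 < α) (hα2 : α ≤ 2)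
    (hβα : β < α) (hκ : 0 < κ) :
    ∃ C : ℝ, 0 ≤ C ∧ ∃ ρ : ℝ, 0 < ρ ∧ ∀ (t s δ : ℝ) (z : Space d), 0 ≤ s → s ≤ t → 0 < δ → δ ≤ 1 →
      t - s ≤ δ → ‖z‖ ≤ d * δ →
      convCov d α β κ t t 0 - 2 * convCov d α β κ t s z + convCov d α β κ s s 0 ≤ C * δ ^ ρ := by
  have hd : 0 < d := by
    have : (0 : ℝ) < d := hβ.trans hβd
    exact_mod_cast this
  have hW := spectralConst_pos hβ hβd
  -- With this `r` one has `αr = (α-β)/2`, half of the spectral margin: the tail exponent `β - d +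
  -- αr - α = -d - (α-β)/2` is still integrable, and `r` powers of the time step and `αr` powers of
  -- the space step remain available.
  set r := (α - β) / (2 * α) with hr
  have hr0 : 0 < r := div_pos (by linarith) (by positivity)
  have hαr : α * r = (α - β) / 2 := by rw [hr]; field_simp
  have hr1 : r ≤ 1 := by rw [hr, div_le_one (by positivity)]; linarith
  set ρ := min r (α * r) with hρ
  have hρ0 : 0 < ρ := lt_min hr0 (by positivity)
  -- The summands bound, in order, the temporal and spatial parts for `|ξ| ≤ 1`, then the temporal
  -- and spatial parts for `|ξ| ≥ 1`.
  set C₀ : ℝ := 1 + d ^ 2 / (2 * κ) + κ ^ (r - 1) + 2 * (d : ℝ) ^ (α * r) / κ with hC₀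
  have hC₀0 : 0 ≤ C₀ := by positivity
  set Q : ℝ := ∫ ξ : Space d, splitPow (β - d + 0) (β - d + (α * r - α)) ξ with hQ
  have hQi := integrable_splitPow hd (p := β - d + 0) (q := β - d + (α * r - α)) (by linarith)
    (by linarith)
  have hQ0 : 0 ≤ Q := integral_nonneg fun ξ => by
    simp only [splitPow, Pi.zero_apply]
    split_ifs <;> positivity
  refine ⟨spectralConst d β * C₀ * Q, by positivity, ρ, hρ0, fun t s δ z hs hst hδ hδ1 hts hz => ?_⟩
  have hδρ : 0 < δ ^ ρ := Real.rpow_pos_of_pos hδ _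
  have hi1 := integrable_spectral_timeFactor (d := d) hβ hβd hβα hκ (hs.trans hst) (le_refl t)
  have hi2 := integrable_spectral_timeFactor (d := d) hβ hβd hβα hκ hs (le_refl s)
  have hi3 := (integrable_spectral_timeFactor (d := d) hβ hβd hβα hκ hs hst).mul_bdd (c := 1)
    (g := fun ξ : Space d => Real.cos (inner ℝ ξ z))
    (by
      have : Measurable fun ξ : Space d => inner ℝ ξ z := measurable_id.inner measurable_const
      exact Measurable.aestronglyMeasurable (by fun_prop))
    (ae_of_all _ fun ξ => Real.abs_cos_le_one _)
  have heq : convCov d α β κ t t 0 - 2 * convCov d α β κ t s z + convCov d α β κ s s 0 =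
      ∫ ξ : Space d, spectralConst d β * ‖ξ‖ ^ (β - d) *
        (timeFactor (κ * ‖ξ‖ ^ α) t t + timeFactor (κ * ‖ξ‖ ^ α) s s -
          2 * (timeFactor (κ * ‖ξ‖ ^ α) t s * Real.cos (inner ℝ ξ z))) := by
    have hadd := integral_add (hi1.sub (hi3.const_mul 2)) hi2
    simp only [Pi.sub_apply] at hadd
    rw [convCov_zero, convCov_zero, convCov, ← integral_const_mul,
      ← integral_sub hi1 (hi3.const_mul 2), ← hadd]
    refine integral_congr_ae (ae_of_all _ fun ξ => ?_)
    beta_reduce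
    ring
  rw [heq]
  have hbound : ∀ ξ : Space d, ξ ≠ 0 → spectralConst d β * ‖ξ‖ ^ (β - d) *
        (timeFactor (κ * ‖ξ‖ ^ α) t t + timeFactor (κ * ‖ξ‖ ^ α) s s -
          2 * (timeFactor (κ * ‖ξ‖ ^ α) t s * Real.cos (inner ℝ ξ z))) ≤
      spectralConst d β * (C₀ * δ ^ ρ) * splitPow (β - d + 0) (β - d + (α * r - α)) ξ := by
    intro ξ hξ
    have hn := norm_pos_iff.2 hξ
    have ha : 0 < κ * ‖ξ‖ ^ α := by positivity
    have hA := timeFactor_increment_le (c := Real.cos (inner ℝ ξ z)) ha hs hst (Real.cos_le_one _)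
    have hθ : |inner ℝ ξ z| ≤ ‖ξ‖ * (d * δ) :=
      (abs_real_inner_le_norm ξ z).trans (by gcongr)
    have hts0 : 0 ≤ t - s := by linarith
    refine mul_le_splitPow hξ (fun h1 => ?_) (fun h1 => ?_) hW.le
    · have e1 : (1 - Real.exp (-(κ * ‖ξ‖ ^ α * (t - s)))) / (κ * ‖ξ‖ ^ α) ≤ δ := by
        rw [div_le_iff₀ ha]
        have := Real.add_one_le_exp (-(κ * ‖ξ‖ ^ α * (t - s)))
        nlinarith
      have e2 : (1 - Real.cos (inner ℝ ξ z)) / (κ * ‖ξ‖ ^ α) ≤ d ^ 2 / (2 * κ) * δ := by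
        rw [div_le_iff₀ ha]
        have h2 := Real.one_sub_sq_div_two_le_cos (x := inner ℝ ξ z)
        have h3 : (inner ℝ ξ z) ^ 2 ≤ (‖ξ‖ * (d * δ)) ^ 2 := by
          rw [← sq_abs]
          gcongr
        have h4 : ‖ξ‖ ^ 2 ≤ ‖ξ‖ ^ α := by
          rw [← Real.rpow_two]
          exact Real.rpow_le_rpow_of_exponent_ge hn h1 hα2
        have h5 : δ ^ 2 ≤ δ := by nlinarith
        calc 1 - Real.cos (inner ℝ ξ z) ≤ (‖ξ‖ * (d * δ)) ^ 2 / 2 := by linarith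
          _ = d ^ 2 / 2 * (‖ξ‖ ^ 2 * δ ^ 2) := by ring
          _ ≤ d ^ 2 / 2 * (‖ξ‖ ^ α * δ) := by gcongr
          _ = d ^ 2 / (2 * κ) * δ * (κ * ‖ξ‖ ^ α) := by field_simp
      have e3 : δ ≤ δ ^ ρ := by
        conv_lhs => rw [← Real.rpow_one δ]
        exact Real.rpow_le_rpow_of_exponent_ge hδ hδ1 ((min_le_left _ _).trans hr1)
      have e4 : 0 ≤ κ ^ (r - 1) + 2 * (d : ℝ) ^ (α * r) / κ := by positivity
      rw [Real.rpow_zero, mul_one]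
      calc _ ≤ δ + d ^ 2 / (2 * κ) * δ := hA.trans (add_le_add e1 e2)
        _ = (1 + d ^ 2 / (2 * κ)) * δ := by ring
        _ ≤ C₀ * δ ^ ρ := by
          refine mul_le_mul ?_ e3 hδ.le hC₀0
          rw [hC₀]
          linarith
    · have hδr : δ ^ r ≤ δ ^ ρ := Real.rpow_le_rpow_of_exponent_ge hδ hδ1 (min_le_left _ _)
      have hδr2 : δ ^ (α * r) ≤ δ ^ ρ := Real.rpow_le_rpow_of_exponent_ge hδ hδ1 (min_le_right _ _)
      have e1 : (1 - Real.exp (-(κ * ‖ξ‖ ^ α * (t - s)))) / (κ * ‖ξ‖ ^ α) ≤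
          κ ^ (r - 1) * δ ^ ρ * ‖ξ‖ ^ (α * r - α) := by
        have h2 : 1 - Real.exp (-(κ * ‖ξ‖ ^ α * (t - s))) ≤ (κ * ‖ξ‖ ^ α * δ) ^ r := by
          refine le_trans ?_ (one_sub_exp_neg_le_rpow (by positivity) hr0.le hr1)
          gcongr
        rw [div_le_iff₀ ha]
        refine h2.trans ?_
        rw [Real.mul_rpow (by positivity) hδ.le, Real.mul_rpow hκ.le (by positivity),
          ← Real.rpow_mul hn.le, Real.rpow_sub hn, Real.rpow_sub hκ, Real.rpow_one]
        calc κ ^ r * ‖ξ‖ ^ (α * r) * δ ^ r ≤ κ ^ r * ‖ξ‖ ^ (α * r) * δ ^ ρ := by gcongr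
          _ = _ := by field_simp
      have e2 : (1 - Real.cos (inner ℝ ξ z)) / (κ * ‖ξ‖ ^ α) ≤
          2 * (d : ℝ) ^ (α * r) / κ * δ ^ ρ * ‖ξ‖ ^ (α * r - α) := by
        have h2 := one_sub_cos_le_rpow (x := inner ℝ ξ z) (r := α * r) (by positivity)
          (by linarith)
        rw [div_le_iff₀ ha]
        refine h2.trans ?_
        calc 2 * |inner ℝ ξ z| ^ (α * r) ≤ 2 * (‖ξ‖ * (d * δ)) ^ (α * r) := by gcongr
          _ = 2 * (‖ξ‖ ^ (α * r) * ((d : ℝ) ^ (α * r) * δ ^ (α * r))) := by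
            rw [Real.mul_rpow hn.le (by positivity), Real.mul_rpow (by positivity) hδ.le]
          _ ≤ 2 * (‖ξ‖ ^ (α * r) * ((d : ℝ) ^ (α * r) * δ ^ ρ)) := by gcongr
          _ = _ := by
            rw [Real.rpow_sub hn]
            field_simp
      have e4 : 0 ≤ 1 + (d : ℝ) ^ 2 / (2 * κ) := by positivity
      calc _ ≤ κ ^ (r - 1) * δ ^ ρ * ‖ξ‖ ^ (α * r - α) +
            2 * (d : ℝ) ^ (α * r) / κ * δ ^ ρ * ‖ξ‖ ^ (α * r - α) := hA.trans (add_le_add e1 e2)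
        _ = (κ ^ (r - 1) + 2 * (d : ℝ) ^ (α * r) / κ) * δ ^ ρ * ‖ξ‖ ^ (α * r - α) := by ring
        _ ≤ C₀ * δ ^ ρ * ‖ξ‖ ^ (α * r - α) := by
          gcongr
          rw [hC₀]
          linarith
  calc _ ≤ ∫ ξ : Space d, spectralConst d β * (C₀ * δ ^ ρ) *
        splitPow (β - d + 0) (β - d + (α * r - α)) ξ := by
        refine integral_mono_ae ?_ (hQi.const_mul _) ?_
        · refine ((hi1.sub (hi3.const_mul 2)).add hi2).congr (ae_of_all _ fun ξ => ?_)
          simp only [Pi.add_apply, Pi.sub_apply]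
          ring
        · filter_upwards [ae_ne_zero hd] with ξ hξ
          exact hbound ξ hξ
    _ = _ := by
        rw [integral_const_mul, ← hQ]
        ring

end Estimates

/-! ### Noise integrals as Gaussian variables -/

section Gaussian

variable {Ω : Type*} {mΩ : MeasurableSpace Ω} {P : Measure Ω}

lemma tendsto_integral_mul_of_tendsto_eLpNorm {fs gs : ℕ → Ω → ℝ} {f g : Ω → ℝ}
    (hfs : ∀ n, MemLp (fs n) 2 P) (hf : MemLp f 2 P) (hgs : ∀ n, MemLp (gs n) 2 P)
    (hg : MemLp g 2 P)
    (hfl : Tendsto (fun n => eLpNorm (fun ω => fs n ω - f ω) 2 P) atTop (𝓝 0))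
    (hgl : Tendsto (fun n => eLpNorm (fun ω => gs n ω - g ω) 2 P) atTop (𝓝 0)) :
    Tendsto (fun n => ∫ ω, fs n ω * gs n ω ∂P) atTop (𝓝 (∫ ω, f ω * g ω ∂P)) := by
  have hF := (Lp.tendsto_Lp_iff_tendsto_eLpNorm'' fs hfs f hf).2 hfl
  have hG := (Lp.tendsto_Lp_iff_tendsto_eLpNorm'' gs hgs g hg).2 hgl
  have key : ∀ {u v : Ω → ℝ} (hu : MemLp u 2 P) (hv : MemLp v 2 P),
      inner ℝ (hv.toLp v) (hu.toLp u) = ∫ ω, u ω * v ω ∂P := fun {u v} hu hv => by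
    rw [L2.inner_def]
    refine integral_congr_ae ?_
    filter_upwards [hu.coeFn_toLp, hv.coeFn_toLp] with ω h1 h2
    rw [h1, h2]
    rfl
  have h := hG.inner (𝕜 := ℝ) hF
  simpa only [key] using h

/-- Characteristic functions identify the limit law: they converge to that of `Z` along an almost
surely convergent subsequence, and to the Gaussian one because second moments converge. -/
lemma map_eq_gaussianReal_of_tendsto [IsProbabilityMeasure P] {Zs : ℕ → Ω → ℝ} {Z : Ω → ℝ}
    (hZs : ∀ n, HasGaussianLaw (Zs n) P) (hmean : ∀ n, ∫ ω, Zs n ω ∂P = 0) (hZ : MemLp Z 2 P)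
    (hlim : Tendsto (fun n => eLpNorm (fun ω => Zs n ω - Z ω) 2 P) atTop (𝓝 0)) :
    P.map Z = gaussianReal 0 (∫ ω, Z ω * Z ω ∂P).toNNReal := by
  have hvar := tendsto_integral_mul_of_tendsto_eLpNorm (fun n => (hZs n).memLp_two) hZ
    (fun n => (hZs n).memLp_two) hZ hlim hlim
  have hlaw : ∀ n, P.map (Zs n) = gaussianReal 0 (∫ ω, Zs n ω * Zs n ω ∂P).toNNReal := by
    intro n
    rw [(hZs n).map_eq_gaussianReal, hmean n, variance_of_integral_eq_zero
      (hZs n).aemeasurable (hmean n)]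
    simp only [sq]
  have hcf : ∀ (W : Ω → ℝ), AEMeasurable W P → ∀ θ : ℝ, charFun (P.map W) θ =
      ∫ ω, Complex.exp (θ * W ω * Complex.I) ∂P := by
    intro W hW θ
    rw [charFun_apply_real, integral_map hW (by fun_prop)]
  obtain ⟨ns, hns, hae⟩ := (tendstoInMeasure_of_tendsto_eLpNorm (p := 2) (by norm_num)
    (fun n => (hZs n).aemeasurable.aestronglyMeasurable) hZ.aestronglyMeasurable
    hlim).exists_seq_tendsto_ae
  have hprob : IsProbabilityMeasure (P.map Z) :=
    Measure.isProbabilityMeasure_map hZ.aestronglyMeasurable.aemeasurable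
  refine Measure.ext_of_charFun (funext fun θ => ?_)
  have hlim1 : Tendsto (fun i => charFun (P.map (Zs (ns i))) θ) atTop
      (𝓝 (charFun (P.map Z) θ)) := by
    simp only [hcf _ (hZs _).aemeasurable, hcf _ hZ.aestronglyMeasurable.aemeasurable]
    refine tendsto_integral_of_dominated_convergence (fun _ => (1 : ℝ)) (fun i => ?_)
      (integrable_const _) (fun i => ae_of_all _ fun ω => ?_) ?_
    · have := (hZs (ns i)).aemeasurable
      exact AEMeasurable.aestronglyMeasurable (by fun_prop)
    · rw [← Complex.ofReal_mul, Complex.norm_exp_ofReal_mul_I]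
    · filter_upwards [hae] with ω hω
      have : Continuous fun y : ℝ => Complex.exp (θ * y * Complex.I) := by fun_prop
      exact (this.tendsto (Z ω)).comp hω
  have hlim2 : Tendsto (fun i => charFun (P.map (Zs (ns i))) θ) atTop
      (𝓝 (charFun (gaussianReal 0 (∫ ω, Z ω * Z ω ∂P).toNNReal) θ)) := by
    simp only [hlaw, charFun_gaussianReal]
    have hc : Continuous fun v : ℝ => Complex.exp
        (θ * ((0 : ℝ) : ℂ) * Complex.I - ((v.toNNReal : ℝ≥0) : ℂ) * θ ^ 2 / 2) := by
      have : Continuous fun v : ℝ => (((v.toNNReal : ℝ≥0) : ℝ) : ℂ) := by fun_prop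
      have h2 : (fun v : ℝ => ((v.toNNReal : ℝ≥0) : ℂ)) =
        fun v : ℝ => (((v.toNNReal : ℝ≥0) : ℝ) : ℂ) := rfl
      fun_prop
    exact (hc.tendsto _).comp (hvar.comp hns.tendsto_atTop)
  exact tendsto_nhds_unique hlim1 hlim2

variable {d : ℕ} {β : ℝ} {F : 𝓓(posSpaceTime d, ℝ) → Ω → ℝ}

lemma memRiesz_testFunction (hβ : 0 < β) (hβd : β < d) (φ : 𝓓(posSpaceTime d, ℝ)) :
    MemRiesz β φ :=
  memRiesz_of_continuous_hasCompactSupport hβ hβd φ.continuous φ.hasCompactSupport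

lemma IsNoiseIntegral.integral_mul (hβ : 0 < β) (hβd : β < d) (hF : IsRieszNoise P β F)
    {φ ψ : ℝ × Space d → ℝ} {X Y : Ω → ℝ} (hX : IsNoiseIntegral P β F φ X)
    (hY : IsNoiseIntegral P β F ψ Y) : ∫ ω, X ω * Y ω ∂P = rieszInner β φ ψ := by
  have hd : 0 < d := by
    have : (0 : ℝ) < d := hβ.trans hβd
    exact_mod_cast this
  obtain ⟨hφ, hX2, φs, hφl, hXl⟩ := hX
  obtain ⟨hψ, hY2, ψs, hψl, hYl⟩ := hY
  have hmem : ∀ θ, MemLp (F θ) 2 P := fun θ => (hF.gaussian.hasGaussianLaw_eval θ).memLp_two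
  have h1 := tendsto_integral_mul_of_tendsto_eLpNorm (fun n => hmem (φs n)) hX2
    (fun n => hmem (ψs n)) hY2 hXl hYl
  have h2 := tendsto_rieszInner hd hβ hφ hψ (fun n => memRiesz_testFunction hβ hβd (φs n))
    (fun n => memRiesz_testFunction hβ hβd (ψs n)) hφl hψl
  simp only [hF.covariance] at h1
  exact tendsto_nhds_unique h1 h2

lemma IsNoiseIntegral.map_eq (hβ : 0 < β) (hβd : β < d) [IsProbabilityMeasure P]
    (hF : IsRieszNoise P β F) {φ : ℝ × Space d → ℝ} {X : Ω → ℝ}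
    (hX : IsNoiseIntegral P β F φ X) :
    P.map X = gaussianReal 0 (rieszInner β φ φ).toNNReal := by
  rw [← hX.integral_mul hβ hβd hF hX]
  obtain ⟨hφ, hX2, φs, hφl, hXl⟩ := hX
  exact map_eq_gaussianReal_of_tendsto (fun n => hF.gaussian.hasGaussianLaw_eval (φs n))
    (fun n => hF.centered _) hX2 hXl

/-- Joint Gaussianity of the noise on test functions makes the approximating differences Gaussian,
and this passes to the `L²` limit. -/
lemma IsNoiseIntegral.map_sub_eq (hβ : 0 < β) (hβd : β < d) [IsProbabilityMeasure P]
    (hF : IsRieszNoise P β F) {φ ψ : ℝ × Space d → ℝ} {X Y : Ω → ℝ}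
    (hX : IsNoiseIntegral P β F φ X) (hY : IsNoiseIntegral P β F ψ Y) :
    P.map (fun ω => X ω - Y ω) = gaussianReal 0
      (rieszInner β φ φ - 2 * rieszInner β φ ψ + rieszInner β ψ ψ).toNNReal := by
  have hX2 := hX.2.1
  have hY2 := hY.2.1
  have hval : ∫ ω, (X ω - Y ω) * (X ω - Y ω) ∂P =
      rieszInner β φ φ - 2 * rieszInner β φ ψ + rieszInner β ψ ψ := by
    rw [← hX.integral_mul hβ hβd hF hX, ← hX.integral_mul hβ hβd hF hY,
      ← hY.integral_mul hβ hβd hF hY, ← integral_const_mul]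
    have hXX := hX2.integrable_mul hX2
    have hXY := hX2.integrable_mul hY2
    have hYY := hY2.integrable_mul hY2
    have hadd := integral_add (hXX.sub (hXY.const_mul 2)) hYY
    have hsub := integral_sub hXX (hXY.const_mul 2)
    simp only [Pi.sub_apply, Pi.mul_apply] at hadd hsub
    rw [← hsub, ← hadd]
    refine integral_congr_ae (ae_of_all _ fun ω => ?_)
    beta_reduce
    ring
  rw [← hval]
  obtain ⟨hφ, -, φs, hφl, hXl⟩ := hX
  obtain ⟨hψ, -, ψs, hψl, hYl⟩ := hY
  have hmem : ∀ θ, MemLp (F θ) 2 P := fun θ => (hF.gaussian.hasGaussianLaw_eval θ).memLp_two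
  refine map_eq_gaussianReal_of_tendsto (Zs := fun n ω => F (φs n) ω - F (ψs n) ω)
    (fun n => hF.gaussian.hasGaussianLaw_fun_sub)
    (fun n => ?_) (hX2.sub hY2) ?_
  · rw [integral_sub ((hmem _).integrable (by norm_num)) ((hmem _).integrable (by norm_num)),
      hF.centered, hF.centered, sub_zero]
  · refine tendsto_of_tendsto_of_tendsto_of_le_of_le tendsto_const_nhds
      (by simpa using hXl.add hYl) (fun n => zero_le) fun n => ?_
    have h := eLpNorm_sub_le (p := 2) (μ := P) ((hmem (φs n)).sub hX2).aestronglyMeasurable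
      ((hmem (ψs n)).sub hY2).aestronglyMeasurable (by norm_num)
    refine le_trans (le_of_eq ?_) h
    congr 1
    ext ω
    simp only [Pi.sub_apply]
    ring

/-- Markov's inequality for the moment of order `2m`, with `K` the standard Gaussian moment.
Arbitrary `m` is needed so that chaining can beat the number of dyadic points. -/
lemma exists_gaussian_tail (m : ℕ) : ∃ K : ℝ, 0 ≤ K ∧ ∀ (Z : Ω → ℝ) (v r : ℝ), AEMeasurable Z P →
    P.map Z = gaussianReal 0 v.toNNReal → 0 ≤ v → 0 < r →
      P {ω | r ≤ |Z ω|} ≤ ENNReal.ofReal (K * v ^ m / r ^ (2 * m)) := by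
  have hint : Integrable (fun y : ℝ => y ^ (2 * m)) (gaussianReal 0 1) := by
    have := (memLp_id_gaussianReal (μ := 0) (v := 1) (2 * m : ℕ)).integrable_norm_pow'
    simp only [id_eq] at this
    refine this.congr (ae_of_all _ fun y => ?_)
    simp only [Real.norm_eq_abs, (even_two_mul m).pow_abs]
  refine ⟨∫ y, y ^ (2 * m) ∂(gaussianReal 0 1),
    integral_nonneg fun y => (even_two_mul m).pow_nonneg y, fun Z v r hZ hlaw hv hr => ?_⟩
  have hset : MeasurableSet {y : ℝ | r ≤ |y|} := measurableSet_le measurable_const (by fun_prop)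
  have h1 : P {ω | r ≤ |Z ω|} = gaussianReal 0 v.toNNReal {y | r ≤ |y|} := by
    rw [← hlaw, Measure.map_apply_of_aemeasurable hZ hset]
    rfl
  have h2 : gaussianReal 0 v.toNNReal = (gaussianReal 0 1).map (fun y => √v * y) := by
    rw [gaussianReal_map_const_mul, mul_zero, mul_one]
    congr 1
    ext
    simp [Real.sq_sqrt hv, hv]
  rw [h1, h2, Measure.map_apply (by fun_prop) hset]
  have h3 : (fun y : ℝ => √v * y) ⁻¹' {y | r ≤ |y|} ⊆
      {y | ENNReal.ofReal (r ^ (2 * m)) ≤ ENNReal.ofReal (v ^ m * y ^ (2 * m))} := by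
    intro y hy
    have hy : r ≤ |√v * y| := hy
    refine ENNReal.ofReal_le_ofReal ?_
    calc r ^ (2 * m) ≤ |√v * y| ^ (2 * m) := by gcongr
      _ = v ^ m * y ^ (2 * m) := by
        rw [(even_two_mul m).pow_abs, mul_pow, pow_mul (√v), Real.sq_sqrt hv]
  have hrm : 0 < r ^ (2 * m) := by positivity
  have h4 := mul_meas_ge_le_lintegral₀ (μ := gaussianReal 0 1)
    (f := fun y => ENNReal.ofReal (v ^ m * y ^ (2 * m))) (by fun_prop)
    (ENNReal.ofReal (r ^ (2 * m)))
  rw [← ofReal_integral_eq_lintegral_ofReal (hint.const_mul _)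
    (ae_of_all _ fun y => mul_nonneg (by positivity) ((even_two_mul m).pow_nonneg y)),
    integral_const_mul] at h4
  refine (measure_mono h3).trans ?_
  rw [ENNReal.ofReal_div_of_pos hrm, ENNReal.le_div_iff_mul_le (Or.inl (by simpa using hrm))
    (Or.inl (by simp)), mul_comm, mul_comm (∫ y, y ^ (2 * m) ∂(gaussianReal 0 1))]
  exact h4

lemma gaussianReal_abs_lt_le (δ : ℝ) :
    gaussianReal 0 1 {y : ℝ | |y| < δ} ≤ ENNReal.ofReal (2 * δ) := by
  have hset : {y : ℝ | |y| < δ} = Ioo (-δ) δ := by ext y; simp [abs_lt]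
  rw [hset, gaussianReal_apply 0 (by norm_num)]
  calc ∫⁻ x in Ioo (-δ) δ, gaussianPDF 0 1 x ≤ ∫⁻ x in Ioo (-δ) δ, 1 := by
        refine lintegral_mono fun x => ?_
        rw [gaussianPDF]
        refine ENNReal.ofReal_le_one.2 ?_
        rw [gaussianPDFReal]
        refine mul_le_one₀ ?_ (Real.exp_nonneg _) ?_
        · refine inv_le_one_of_one_le₀ ?_
          rw [Real.one_le_sqrt]
          have := Real.pi_gt_three
          simp
          linarith
        · exact Real.exp_le_one_iff.2
            (div_nonpos_of_nonpos_of_nonneg (neg_nonpos.2 (sq_nonneg _)) (by simp))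
    _ = _ := by
        rw [setLIntegral_one, Real.volume_Ioo]
        congr 1
        ring

end Gaussian

/-! ### Chaining -/

section Chaining

variable {d : ℕ}

/-- The dyadic time `T + j / 2^n`. -/
noncomputable def dyadicTime (T : ℝ) (n j : ℕ) : ℝ := T + j / 2 ^ n

/-- The dyadic point `v / 2^n` of `ℝ^d`. -/
noncomputable def dyadicSpace (n : ℕ) (v : Fin d → ℕ) : Space d :=
  WithLp.toLp 2 fun i => (v i : ℝ) / 2 ^ n

/-- The indices of the dyadic points of generation `n` in the unit box. -/
def dyadicGrid (d n : ℕ) : Finset (ℕ × (Fin d → ℕ)) :=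
  Finset.range (2 ^ n) ×ˢ Fintype.piFinset fun _ => Finset.range (2 ^ n)

lemma card_dyadicGrid (d n : ℕ) : (dyadicGrid d n).card = (2 ^ (d + 1)) ^ n := by
  simp only [dyadicGrid, Finset.card_product, Finset.card_range, Fintype.card_piFinset,
    Finset.prod_const, Finset.card_univ, Fintype.card_fin]
  rw [← pow_succ', ← pow_mul, ← pow_mul, mul_comm]

lemma norm_le_of_abs_apply_le {z : Space d} {δ : ℝ} (h : ∀ i, |z i| ≤ δ) (hδ : 0 ≤ δ) :
    ‖z‖ ≤ d * δ := by
  rw [EuclideanSpace.norm_eq, Real.sqrt_le_left (by positivity)]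
  calc ∑ i, ‖z i‖ ^ 2 ≤ ∑ _i : Fin d, δ ^ 2 := by
        refine Finset.sum_le_sum fun i _ => ?_
        rw [Real.norm_eq_abs]
        have := h i
        gcongr
    _ = d * δ ^ 2 := by simp
    _ ≤ (d * δ) ^ 2 := by
        rw [mul_pow]
        gcongr
        rcases Nat.eq_zero_or_pos d with h | h
        · simp [h]
        · have : (1 : ℝ) ≤ d := by exact_mod_cast h
          nlinarith

lemma sub_half_div_two_pow (n j : ℕ) :
    0 ≤ (j : ℝ) / 2 ^ (n + 1) - ((j / 2 : ℕ) : ℝ) / 2 ^ n ∧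
      (j : ℝ) / 2 ^ (n + 1) - ((j / 2 : ℕ) : ℝ) / 2 ^ n ≤ (1 / 2) ^ n := by
  have h1 : (2 : ℝ) * ((j / 2 : ℕ) : ℝ) ≤ j := by exact_mod_cast Nat.mul_div_le j 2
  have h2 : (j : ℝ) ≤ 2 * ((j / 2 : ℕ) : ℝ) + 1 := by
    have : j ≤ 2 * (j / 2) + 1 := by omega
    exact_mod_cast this
  have e : (j : ℝ) / 2 ^ (n + 1) - ((j / 2 : ℕ) : ℝ) / 2 ^ n =
      (j - 2 * ((j / 2 : ℕ) : ℝ)) / 2 ^ (n + 1) := by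
    rw [pow_succ]
    field_simp
  rw [e]
  constructor
  · exact div_nonneg (by linarith) (by positivity)
  · rw [one_div, inv_pow, div_le_iff₀ (by positivity), pow_succ, inv_mul_cancel_left₀ (by positivity)]
    linarith

lemma sub_floor_div_two_pow (n : ℕ) {y : ℝ} (hy : 0 ≤ y) :
    0 ≤ y - (⌊2 ^ n * y⌋₊ : ℝ) / 2 ^ n ∧ y - (⌊2 ^ n * y⌋₊ : ℝ) / 2 ^ n ≤ (1 / 2) ^ n := by
  have h1 := Nat.floor_le (show 0 ≤ 2 ^ n * y by positivity)
  have h2 := Nat.lt_floor_add_one (2 ^ n * y)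
  have e : y - (⌊2 ^ n * y⌋₊ : ℝ) / 2 ^ n = (2 ^ n * y - ⌊2 ^ n * y⌋₊) / 2 ^ n := by
    field_simp
  rw [e]
  constructor
  · exact div_nonneg (by linarith) (by positivity)
  · rw [one_div, inv_pow, div_le_iff₀ (by positivity), inv_mul_cancel₀ (by positivity)]
    linarith

lemma floor_two_pow_half (n : ℕ) (y : ℝ) : ⌊2 ^ (n + 1) * y⌋₊ / 2 = ⌊2 ^ n * y⌋₊ := by
  have := Nat.floor_div_natCast (2 ^ (n + 1) * y) 2
  rw [← this]
  congr 1
  push_cast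
  rw [pow_succ]
  field_simp

lemma floor_two_pow_lt (n : ℕ) {y : ℝ} (hy : y ∈ Ico (0 : ℝ) 1) : ⌊2 ^ n * y⌋₊ < 2 ^ n := by
  have h2 : (0 : ℝ) < 2 ^ n := by positivity
  rw [Nat.floor_lt (mul_nonneg h2.le hy.1)]
  push_cast
  nlinarith [hy.2]

variable {Ω : Type*} {mΩ : MeasurableSpace Ω} {P : Measure Ω}

/-- Each point is joined to `(T, 0)` through its dyadic ancestors, and `B` is the event that some
dyadic increment is too large. No path regularity is assumed, so the last passage, from dyadic
approximations to `(t, x)`, holds only almost surely for each fixed point: the null set may depend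
on `(t, x)`, but `B` does not. The increment bounds do not see the absolute time, hence `Λ` is
uniform in `T`. -/
theorem exists_chaining_bound {ρ : ℝ} (hρ : 0 < ρ) {X : ℝ → Space d → Ω → ℝ}
    (hX : ∀ m : ℕ, ∃ K : ℝ, 0 ≤ K ∧ ∀ (t s δ r : ℝ) (x y : Space d), 0 < s → s ≤ t → 0 < δ →
      δ ≤ 1 → t - s ≤ δ → ‖x - y‖ ≤ d * δ → 0 < r →
      P {ω | r ≤ |X t x ω - X s y ω|} ≤ ENNReal.ofReal (K * (δ ^ ρ) ^ m / r ^ (2 * m)))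
    {ε : ℝ} (hε : 0 < ε) :
    ∃ Λ : ℝ, ∀ T : ℝ, 0 < T → ∃ B : Set Ω, P B ≤ ENNReal.ofReal ε ∧
      ∀ t ∈ Ico T (T + 1), ∀ x ∈ unitCube d, ∀ᵐ ω ∂P, ω ∉ B → |X t x ω - X T 0 ω| ≤ Λ := by
  -- Variances at scale `2^{-n}` are of order `θ^{4n}`, so standard deviations are `θ^{2n}`; testing
  -- increments against `l θ^n` leaves a spare factor `θ^n`.
  set θ : ℝ := (1 / 2) ^ (ρ / 4) with hθ
  have hθ0 : 0 < θ := by positivity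
  have hθ1 : θ < 1 := Real.rpow_lt_one (by norm_num) (by norm_num) (by positivity)
  have hδρ : ∀ n : ℕ, (((1 : ℝ) / 2) ^ n) ^ ρ = (θ ^ n) ^ 4 := by
    intro n
    rw [← Real.rpow_natCast (1 / 2) n, ← Real.rpow_mul (by norm_num), ← pow_mul,
      ← Real.rpow_natCast θ, hθ, ← Real.rpow_mul (by norm_num)]
    congr 1
    push_cast
    ring
  -- The moment order makes `2^{d+1} θ^{2m} < 1/2`: the tail bound outweighs the growth of the grid
  -- and the union bound is geometric of ratio `1/2`.
  obtain ⟨m, hm⟩ := exists_pow_lt_of_lt_one (y := θ ^ 2) (x := (2 * 2 ^ (d + 1) : ℝ)⁻¹)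
    (by positivity) (by nlinarith)
  obtain ⟨K, hK0, hK⟩ := hX m
  have hm0 : m ≠ 0 := by
    rintro rfl
    rw [pow_zero] at hm
    have : (2 * 2 ^ (d + 1) : ℝ)⁻¹ ≤ 1 := by
      refine inv_le_one_of_one_le₀ ?_
      have : (1 : ℝ) ≤ 2 ^ (d + 1) := one_le_pow₀ (by norm_num)
      linarith
    linarith
  obtain ⟨l, hl1, hl⟩ : ∃ l : ℝ, 1 ≤ l ∧ 2 * (2 ^ (d + 1) * K) / l ≤ ε := by
    refine ⟨max 1 (2 * (2 ^ (d + 1) * K) / ε), le_max_left _ _, ?_⟩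
    rw [div_le_iff₀ (lt_of_lt_of_le one_pos (le_max_left _ _)), ← div_le_iff₀' hε]
    exact le_max_right _ _
  have hl0 : 0 < l := by linarith
  -- The sum of the dyadic increments, plus `1` for the last passage from a fine dyadic point to
  -- `(t, x)`.
  refine ⟨l * (1 - θ)⁻¹ + 1, fun T hT => ?_⟩
  set Y : ℕ → ℕ × (Fin d → ℕ) → Ω → ℝ := fun n k =>
    X (dyadicTime T n k.1) (dyadicSpace n k.2) with hY
  set par : ℕ × (Fin d → ℕ) → ℕ × (Fin d → ℕ) := fun k => (k.1 / 2, fun i => k.2 i / 2) with hpar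
  set B : Set Ω := ⋃ n : ℕ, ⋃ k ∈ dyadicGrid d (n + 1),
    {ω | l * θ ^ n ≤ |Y (n + 1) k ω - Y n (par k) ω|} with hB
  have hstep : ∀ n k, P {ω | l * θ ^ n ≤ |Y (n + 1) k ω - Y n (par k) ω|} ≤
      ENNReal.ofReal (K / l * (θ ^ (2 * m)) ^ n) := by
    intro n k
    refine (hK _ _ ((1 / 2) ^ n) _ _ _ ?_ ?_ (by positivity) (pow_le_one₀ (by norm_num)
      (by norm_num)) ?_ ?_ (by positivity)).trans (ENNReal.ofReal_le_ofReal ?_)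
    · unfold dyadicTime
      positivity
    · have := (sub_half_div_two_pow n k.1).1
      simp only [dyadicTime, hpar]
      linarith
    · have := (sub_half_div_two_pow n k.1).2
      simp only [dyadicTime, hpar]
      linarith
    · refine norm_le_of_abs_apply_le (fun i => ?_) (by positivity)
      have := sub_half_div_two_pow n (k.2 i)
      simp only [dyadicSpace, hpar, PiLp.sub_apply]
      rw [abs_of_nonneg this.1]
      exact this.2
    · rw [hδρ]
      have hll : l ≤ l ^ (2 * m) := le_self_pow₀ hl1 (by positivity)
      have hpos : 0 < θ ^ n := by positivity
      have e : K * ((θ ^ n) ^ 4) ^ m / (l * θ ^ n) ^ (2 * m) =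
          K / l ^ (2 * m) * (θ ^ (2 * m)) ^ n := by
        rw [mul_pow, div_eq_iff (by positivity), ← pow_mul (θ ^ n) 4 m,
          show (θ ^ (2 * m)) ^ n = (θ ^ n) ^ (2 * m) by rw [← pow_mul, ← pow_mul, mul_comm]]
        field_simp
        rw [← pow_mul (θ ^ n) (2 * m) 2]
        ring_nf
      rw [e]
      gcongr
  refine ⟨B, ?_, fun t ht x hx => ?_⟩
  · calc P B ≤ ∑' n, P (⋃ k ∈ dyadicGrid d (n + 1),
            {ω | l * θ ^ n ≤ |Y (n + 1) k ω - Y n (par k) ω|}) := measure_iUnion_le _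
      _ ≤ ∑' n : ℕ, ENNReal.ofReal (2 ^ (d + 1) * K / l * (1 / 2) ^ n) := by
          refine ENNReal.tsum_le_tsum fun n => ?_
          refine (measure_biUnion_finset_le _ _).trans ?_
          refine (Finset.sum_le_card_nsmul _ _ _ fun k _ => hstep n k).trans ?_
          rw [card_dyadicGrid, nsmul_eq_mul, ← ENNReal.ofReal_natCast,
            ← ENNReal.ofReal_mul (by positivity)]
          refine ENNReal.ofReal_le_ofReal ?_
          push_cast
          have h1 : 2 ^ (d + 1) * θ ^ (2 * m) ≤ 1 / 2 := by
            rw [pow_mul]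
            have h2 : (0 : ℝ) < 2 ^ (d + 1) := by positivity
            calc 2 ^ (d + 1) * (θ ^ 2) ^ m ≤ 2 ^ (d + 1) * (2 * 2 ^ (d + 1) : ℝ)⁻¹ := by gcongr
              _ = 1 / 2 := by field_simp
          calc ((2 : ℝ) ^ (d + 1)) ^ (n + 1) * (K / l * (θ ^ (2 * m)) ^ n)
              = 2 ^ (d + 1) * K / l * (2 ^ (d + 1) * θ ^ (2 * m)) ^ n := by
                rw [pow_succ, mul_pow]
                ring
            _ ≤ 2 ^ (d + 1) * K / l * (1 / 2) ^ n := by gcongr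
      _ = ENNReal.ofReal (∑' n : ℕ, 2 ^ (d + 1) * K / l * (1 / 2) ^ n) := by
          rw [ENNReal.ofReal_tsum_of_nonneg (fun n => by positivity)]
          exact (summable_geometric_of_lt_one (by norm_num) (by norm_num)).mul_left _
      _ ≤ ENNReal.ofReal ε := by
          refine ENNReal.ofReal_le_ofReal ?_
          rw [tsum_mul_left, tsum_geometric_two]
          refine le_trans (le_of_eq ?_) hl
          ring
  · set k : ℕ → ℕ × (Fin d → ℕ) := fun n =>
      (⌊2 ^ n * (t - T)⌋₊, fun i => ⌊2 ^ n * x i⌋₊) with hk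
    have ht' : t - T ∈ Ico (0 : ℝ) 1 := ⟨by linarith [ht.1], by linarith [ht.2]⟩
    have hkpar : ∀ n, par (k (n + 1)) = k n := fun n => by
      simp only [hpar, hk, floor_two_pow_half]
    have hkmem : ∀ n, k n ∈ dyadicGrid d n := fun n => by
      simp only [dyadicGrid, Finset.mem_product, Finset.mem_range, Fintype.mem_piFinset, hk]
      exact ⟨floor_two_pow_lt n ht', fun i => floor_two_pow_lt n (hx i)⟩
    have hY0 : Y 0 (k 0) = X T 0 := by
      have h1 : ⌊(2 : ℝ) ^ 0 * (t - T)⌋₊ = 0 := by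
        have := floor_two_pow_lt 0 ht'
        omega
      have h2 : ∀ i, ⌊(2 : ℝ) ^ 0 * x i⌋₊ = 0 := fun i => by
        have := floor_two_pow_lt 0 (hx i)
        omega
      have h3 : dyadicSpace 0 (k 0).2 = (0 : Space d) := by
        ext i
        simp only [dyadicSpace, hk, h2 i]
        simp
      simp only [hY, h3]
      simp only [dyadicTime, hk, h1]
      simp
    have hchain : ∀ ω, ω ∉ B → ∀ N, |Y N (k N) ω - X T 0 ω| ≤ l * (1 - θ)⁻¹ := by
      intro ω hω N
      have hinc : ∀ n, |Y (n + 1) (k (n + 1)) ω - Y n (k n) ω| ≤ l * θ ^ n := by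
        intro n
        by_contra! h
        refine hω (mem_iUnion.2 ⟨n, mem_iUnion₂.2 ⟨k (n + 1), hkmem _, ?_⟩⟩)
        rw [← hkpar n] at h
        exact h.le
      have hsum : |Y N (k N) ω - X T 0 ω| ≤ ∑ n ∈ Finset.range N, l * θ ^ n := by
        rw [← hY0, ← Finset.sum_range_sub (fun n => Y n (k n) ω)]
        exact (Finset.abs_sum_le_sum_abs _ _).trans (Finset.sum_le_sum fun n _ => hinc n)
      refine hsum.trans ?_
      rw [← Finset.mul_sum]
      gcongr
      rw [← tsum_geometric_of_lt_one hθ0.le hθ1]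
      exact (summable_geometric_of_lt_one hθ0.le hθ1).sum_le_tsum _ fun n _ => by positivity
    -- Failure at `(t, x)` off `B` forces a jump of size at least `1` from the ancestor of every
    -- generation `N`; the probability of this tends to `0` in `N`.
    have hfar : ∀ N : ℕ, P {ω | ¬ (ω ∉ B → |X t x ω - X T 0 ω| ≤ l * (1 - θ)⁻¹ + 1)} ≤
        ENNReal.ofReal (K * ((θ ^ 4) ^ m) ^ N) := by
      intro N
      have hsub : {ω | ¬ (ω ∉ B → |X t x ω - X T 0 ω| ≤ l * (1 - θ)⁻¹ + 1)} ⊆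
          {ω | (1 : ℝ) ≤ |X t x ω - Y N (k N) ω|} := by
        intro ω hω
        have hω : ¬ (ω ∉ B → |X t x ω - X T 0 ω| ≤ l * (1 - θ)⁻¹ + 1) := hω
        push Not at hω
        have h1 := hchain ω hω.1 N
        have h2 := abs_sub_le (X t x ω) (Y N (k N) ω) (X T 0 ω)
        change (1 : ℝ) ≤ |X t x ω - Y N (k N) ω|
        linarith [hω.2]
      refine (measure_mono hsub).trans ?_
      have h1 := sub_floor_div_two_pow N ht'.1
      refine (hK _ _ ((1 / 2) ^ N) 1 _ _ ?_ ?_ (by positivity) (pow_le_one₀ (by norm_num)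
        (by norm_num)) ?_ ?_ one_pos).trans (ENNReal.ofReal_le_ofReal ?_)
      · unfold dyadicTime
        positivity
      · simp only [dyadicTime, hk]
        linarith [h1.1]
      · simp only [dyadicTime, hk]
        linarith [h1.2]
      · refine norm_le_of_abs_apply_le (fun i => ?_) (by positivity)
        have := sub_floor_div_two_pow N (hx i).1
        simp only [dyadicSpace, hk, PiLp.sub_apply]
        rw [abs_of_nonneg this.1]
        exact this.2
      · rw [hδρ, one_pow, div_one, ← pow_mul, ← pow_mul, ← pow_mul, ← pow_mul]
        apply le_of_eq
        ring_nf
    have hlim : Tendsto (fun N : ℕ => ENNReal.ofReal (K * ((θ ^ 4) ^ m) ^ N)) atTop (𝓝 0) := by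
      have h1 : (θ ^ 4) ^ m < 1 := pow_lt_one₀ (by positivity) (pow_lt_one₀ hθ0.le hθ1 (by norm_num))
        hm0
      have := (tendsto_pow_atTop_nhds_zero_of_lt_one (by positivity) h1).const_mul K
      rw [mul_zero] at this
      simpa using ENNReal.tendsto_ofReal this
    exact le_antisymm (ge_of_tendsto' hlim hfar) zero_le

end Chaining

/-! ### Blow-up -/

section BlowUp

variable {d : ℕ} {α κ : ℝ} {b : ℝ → ℝ}

lemma volume_unitCube_pos : 0 < volume (unitCube d) := by
  have hopen : IsOpen {z : Space d | ∀ i, z i ∈ Ioo (0 : ℝ) 1} := by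
    have : {z : Space d | ∀ i, z i ∈ Ioo (0 : ℝ) 1} =
        ⋂ i, (fun x : Space d => x i) ⁻¹' Ioo (0 : ℝ) 1 := by ext; simp
    rw [this]
    exact isOpen_iInter_of_finite fun i => isOpen_Ioo.preimage (by fun_prop)
  refine lt_of_lt_of_le (hopen.measure_pos volume ?_)
    (measure_mono fun z hz i => Ioo_subset_Ico_self (hz i))
  exact ⟨WithLp.toLp 2 fun _ => 1 / 2, fun i => by simp; norm_num⟩

/-- By monotonicity a zero of `b` at `s` would spread to all of `(a, s)`, where `1/b` would then be
infinite. -/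
lemma OsgoodCondition.pos_of_lt (hb0 : ∀ s, 0 ≤ b s) (hbm : MonotoneOn b (Ioi 0)) {a : ℝ}
    (ha : 0 < a) (hO : ∫⁻ s in Ioi a, (ENNReal.ofReal (b s))⁻¹ < ∞) {s : ℝ} (hs : a < s) :
    0 < b s := by
  refine lt_of_le_of_ne (hb0 s) fun h0 => ?_
  have hz : ∀ r ∈ Ioo a s, (ENNReal.ofReal (b r))⁻¹ = ∞ := by
    intro r hr
    have : b r ≤ b s := hbm (ha.trans hr.1) (ha.trans hs) hr.2.le
    have : b r = 0 := le_antisymm (by linarith) (hb0 r)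
    simp [this]
  have h1 : ∫⁻ r in Ioo a s, (ENNReal.ofReal (b r))⁻¹ ≤ ∫⁻ r in Ioi a, (ENNReal.ofReal (b r))⁻¹ :=
    lintegral_mono_set Ioo_subset_Ioi_self
  rw [setLIntegral_congr_fun measurableSet_Ioo hz, setLIntegral_const, Real.volume_Ioo,
    ENNReal.top_mul (by simpa using hs)] at h1
  exact absurd hO (not_lt.2 h1)

/-- Along the levels `2^k L`, with `L` large, the time that the flow of `c b` needs to double is
summable with small sum. -/
lemma OsgoodCondition.exists_level (hb0 : ∀ s, 0 ≤ b s) (hbm : MonotoneOn b (Ioi 0))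
    (hO : OsgoodCondition b) {c : ℝ} (hc : 0 < c) :
    ∃ L : ℝ, 0 < L ∧ ∀ k : ℕ, 0 < b (2 ^ k * L) ∧
      ∑ j ∈ Finset.range k, 2 ^ (j + 1) * L / (c * b (2 ^ j * L)) ≤ 1 / 2 := by
  obtain ⟨a, ha, hO⟩ := hO
  have hbpos := fun {s : ℝ} (hs : a < s) => OsgoodCondition.pos_of_lt hb0 hbm ha hO hs
  have hlim : Tendsto (fun n : ℕ => ∫⁻ s in Ioi (a + n), (ENNReal.ofReal (b s))⁻¹) atTop (𝓝 0) := by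
    have hanti : Antitone fun n : ℕ => Ioi (a + (n : ℝ)) := fun m n hmn => by
      refine Ioi_subset_Ioi ?_
      have : (m : ℝ) ≤ n := by exact_mod_cast hmn
      linarith
    have hempty : ⋂ n : ℕ, Ioi (a + (n : ℝ)) = ∅ := by
      refine eq_empty_of_forall_notMem fun s hs => ?_
      obtain ⟨n, hn⟩ := exists_nat_gt (s - a)
      have := mem_iInter.1 hs n
      simp only [mem_Ioi] at this
      linarith
    have hμ := tendsto_measure_iInter_atTop
      (μ := (volume : Measure ℝ).withDensity fun s => (ENNReal.ofReal (b s))⁻¹)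
      (s := fun n : ℕ => Ioi (a + (n : ℝ))) (fun n => measurableSet_Ioi.nullMeasurableSet) hanti
      ⟨0, by
        rw [withDensity_apply _ measurableSet_Ioi]
        simpa using hO.ne⟩
    rw [hempty, measure_empty] at hμ
    simpa only [withDensity_apply _ measurableSet_Ioi, Function.comp_def] using hμ
  -- The tail threshold `c/8` compensates the factor `4/c` lost below and yields total time `1/2`.
  -- The level is `L = 2(a + n)` because the comparison starts at `L/2`.
  obtain ⟨n, hn⟩ := ((tendsto_order.1 hlim).2 (ENNReal.ofReal (c / 8))
    (by simpa using by positivity)).exists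
  set L : ℝ := 2 * (a + n) with hL
  have haL : a ≤ L / 2 := by rw [hL]; have : (0 : ℝ) ≤ n := Nat.cast_nonneg n; linarith
  have hL0 : 0 < L := by linarith
  have hlev : ∀ k : ℕ, a < 2 ^ k * L := fun k => by
    have : (1 : ℝ) ≤ 2 ^ k := one_le_pow₀ (by norm_num)
    nlinarith
  refine ⟨L, hL0, fun k => ⟨hbpos (hlev k), ?_⟩⟩
  -- Monotonicity bounds `1/b(2^j L)` by `1/b` on the preceding dyadic interval `(2^{j-1}L, 2^j L]`,
  -- whose length is a quarter of `2^{j+1}L`.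
  have hterm : ∀ j : ℕ, ENNReal.ofReal (2 ^ (j + 1) * L / (c * b (2 ^ j * L))) ≤
      ENNReal.ofReal (4 / c) *
        ∫⁻ s in Ioc (2 ^ j * (L / 2)) (2 ^ (j + 1) * (L / 2)), (ENNReal.ofReal (b s))⁻¹ := by
    intro j
    have hbj := hbpos (hlev j)
    have h2j : (0 : ℝ) < 2 ^ j := by positivity
    calc ENNReal.ofReal (2 ^ (j + 1) * L / (c * b (2 ^ j * L)))
        = ENNReal.ofReal (4 / c) * ((ENNReal.ofReal (b (2 ^ j * L)))⁻¹ *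
            volume (Ioc ((2 : ℝ) ^ j * (L / 2)) (2 ^ (j + 1) * (L / 2)))) := by
          rw [Real.volume_Ioc, ← ENNReal.ofReal_inv_of_pos hbj, ← ENNReal.ofReal_mul (by positivity),
            ← ENNReal.ofReal_mul (by positivity)]
          congr 1
          rw [pow_succ]
          field_simp
          ring
      _ ≤ _ := by
          rw [← setLIntegral_const]
          gcongr ENNReal.ofReal (4 / c) * ?_
          refine setLIntegral_mono' measurableSet_Ioc fun s hs => ?_
          refine ENNReal.inv_le_inv.2 (ENNReal.ofReal_le_ofReal ?_)
          have e : (2 : ℝ) ^ (j + 1) * (L / 2) = 2 ^ j * L := by rw [pow_succ]; ring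
          refine hbm ?_ ?_ (hs.2.trans_eq e)
          · exact lt_trans (by positivity) hs.1
          · exact ha.trans (hlev j)
  have hsum : ∀ k : ℕ, ∑ j ∈ Finset.range k,
      ENNReal.ofReal (2 ^ (j + 1) * L / (c * b (2 ^ j * L))) ≤
      ENNReal.ofReal (4 / c) *
        ∫⁻ s in Ioc (L / 2) (2 ^ k * (L / 2)), (ENNReal.ofReal (b s))⁻¹ := by
    intro k
    induction k with
    | zero => simp
    | succ k ih =>
      rw [Finset.sum_range_succ]
      refine (add_le_add ih (hterm k)).trans ?_
      rw [← mul_add, ← lintegral_union measurableSet_Ioc, Ioc_union_Ioc_eq_Ioc]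
      · have : (1 : ℝ) ≤ 2 ^ k := one_le_pow₀ (by norm_num)
        nlinarith
      · rw [pow_succ]
        have : (0 : ℝ) < 2 ^ k := by positivity
        nlinarith
      · rw [disjoint_left]
        intro s hs hs'
        exact absurd hs.2 (not_le.2 hs'.1)
  have hfin : ∑ j ∈ Finset.range k,
      ENNReal.ofReal (2 ^ (j + 1) * L / (c * b (2 ^ j * L))) ≤ ENNReal.ofReal (1 / 2) := by
    calc _ ≤ ENNReal.ofReal (4 / c) *
        ∫⁻ s in Ioi (a + n), (ENNReal.ofReal (b s))⁻¹ := by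
          refine (hsum k).trans ?_
          gcongr
          rw [show a + n = L / 2 by rw [hL]; ring]
          exact Ioc_subset_Ioi_self
      _ ≤ ENNReal.ofReal (4 / c) * ENNReal.ofReal (c / 8) := by gcongr
      _ = ENNReal.ofReal (1 / 2) := by
          rw [← ENNReal.ofReal_mul (by positivity)]
          congr 1
          field_simp
          norm_num
  rw [← ENNReal.ofReal_sum_of_nonneg, ENNReal.ofReal_le_ofReal_iff (by norm_num)] at hfin
  · exact hfin
  · intro j _
    have := hbpos (hlev j)
    positivity

/-- A function that dominates `L + ∫∫ G b(v)` on a unit box, with `L` large, does not exist. -/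
theorem exists_blowUp_level (hd : 0 < d) (hα : 0 < α) (hα2 : α ≤ 2) (hκ : 0 < κ)
    (hb0 : ∀ s, 0 ≤ b s) (hbm : MonotoneOn b (Ioi 0))
    (hO : OsgoodCondition b) :
    ∃ L : ℝ, 0 < L ∧ ∀ (T : ℝ) (v : ℝ × Space d → ℝ), 0 < T →
      ¬ ∀ᵐ p : ℝ × Space d, p ∈ Ico T (T + 1) ×ˢ unitCube d →
        IntegrableOn (fun q : ℝ × Space d => stableKernel α κ (p.1 - q.1) (p.2 - q.2) * b (v q))
          (Ioo (0 : ℝ) p.1 ×ˢ univ) ∧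
        L + ∫ q in Ioo (0 : ℝ) p.1 ×ˢ (univ : Set (Space d)),
          stableKernel α κ (p.1 - q.1) (p.2 - q.2) * b (v q) ≤ v p := by
  obtain ⟨c, hc, hcube⟩ := exists_lower_bound_stableKernel_unitCube hd hα hα2 hκ (d := d)
  obtain ⟨L, hL, hlev⟩ := hO.exists_level hb0 hbm hc
  refine ⟨L, hL, fun T v hT hp => ?_⟩
  set S : ℕ → ℝ := fun k => ∑ j ∈ Finset.range k, 2 ^ (j + 1) * L / (c * b (2 ^ j * L)) with hS
  have hS0 : ∀ k, 0 ≤ S k := fun k => Finset.sum_nonneg fun j _ => by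
    have := (hlev j).1
    positivity
  have hS1 : ∀ k, S k ≤ 1 / 2 := fun k => (hlev k).2
  -- Once `v ≥ 2^k L`, the source over the window from `T + S k` to `T + S (k+1)` contributes at
  -- least `c (S (k+1) - S k) b(2^k L) = 2^{k+1} L` at later times. Statements hold only almost
  -- everywhere, which suffices for the next integral.
  have hkey : ∀ k : ℕ, ∀ᵐ p : ℝ × Space d, p ∈ Ico (T + S k) (T + 1) ×ˢ unitCube d →
      2 ^ k * L ≤ v p := by
    intro k
    induction k with
    | zero =>
      filter_upwards [hp] with p hp' hmem
      have hmem' : p ∈ Ico T (T + 1) ×ˢ unitCube d := by simpa [hS] using hmem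
      obtain ⟨-, h2⟩ := hp' hmem'
      refine le_trans ?_ h2
      rw [pow_zero, one_mul]
      refine le_add_of_nonneg_right (setIntegral_nonneg
        (measurableSet_Ioo.prod MeasurableSet.univ) fun q hq => ?_)
      exact mul_nonneg (stableKernel_nonneg hd hα hα2 hκ (by linarith [hq.1.2]) _) (hb0 _)
    | succ k ih =>
      filter_upwards [hp] with p hp' hmem
      have hSk : S (k + 1) = S k + 2 ^ (k + 1) * L / (c * b (2 ^ k * L)) :=
        Finset.sum_range_succ _ _
      have hbk := (hlev k).1
      have hinc : 0 < 2 ^ (k + 1) * L / (c * b (2 ^ k * L)) := by positivity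
      have hmem' : p ∈ Ico T (T + 1) ×ˢ unitCube d :=
        ⟨⟨by linarith [hmem.1.1, hS0 (k + 1)], hmem.1.2⟩, hmem.2⟩
      obtain ⟨h1, h2⟩ := hp' hmem'
      have hsub : Ioo (T + S k) (T + S (k + 1)) ×ˢ unitCube d ⊆ Ioo (0 : ℝ) p.1 ×ˢ univ := by
        intro q hq
        exact ⟨⟨by linarith [hq.1.1, hS0 k], by linarith [hq.1.2, hmem.1.1]⟩, mem_univ _⟩
      have hset : MeasurableSet (Ioo (T + S k) (T + S (k + 1)) ×ˢ unitCube d) :=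
        measurableSet_Ioo.prod measurableSet_unitCube
      have hlow : 2 ^ (k + 1) * L ≤ ∫ q in Ioo (0 : ℝ) p.1 ×ˢ (univ : Set (Space d)),
          stableKernel α κ (p.1 - q.1) (p.2 - q.2) * b (v q) := by
        have hge : ∫ q in Ioo (T + S k) (T + S (k + 1)) ×ˢ unitCube d,
            stableKernel α κ (p.1 - q.1) (p.2 - q.2) * b (v q) ≤
            ∫ q in Ioo (0 : ℝ) p.1 ×ˢ (univ : Set (Space d)),
          stableKernel α κ (p.1 - q.1) (p.2 - q.2) * b (v q) := by
          refine setIntegral_mono_set h1 ?_ (Eventually.of_forall hsub)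
          filter_upwards [ae_restrict_mem (measurableSet_Ioo.prod MeasurableSet.univ)] with q hq
          exact mul_nonneg (stableKernel_nonneg hd hα hα2 hκ (by linarith [hq.1.2]) _) (hb0 _)
        refine le_trans ?_ hge
        have hi1 := h1.mono_set hsub
        have hae : ∀ᵐ q ∂(volume.restrict (Ioo (T + S k) (T + S (k + 1)) ×ˢ unitCube d)),
            stableKernel α κ (p.1 - q.1) (p.2 - q.2) * b (2 ^ k * L) ≤
            stableKernel α κ (p.1 - q.1) (p.2 - q.2) * b (v q) := by
          filter_upwards [ae_restrict_mem hset, ae_restrict_of_ae ih] with q hq hih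
          have hvq := hih ⟨⟨hq.1.1.le, by linarith [hq.1.2, hS1 (k + 1)]⟩, hq.2⟩
          have hLk : 0 < 2 ^ k * L := by positivity
          refine mul_le_mul_of_nonneg_left (hbm hLk (hLk.trans_le hvq) hvq) ?_
          exact stableKernel_nonneg hd hα hα2 hκ (by linarith [hq.1.2, hmem.1.1]) _
        have hmeas : Measurable fun q : ℝ × Space d =>
            stableKernel α κ (p.1 - q.1) (p.2 - q.2) :=
          measurable_stableKernel.comp (f := fun q : ℝ × Space d => (p.1 - q.1, p.2 - q.2))
            (by fun_prop)
        have hi2 : IntegrableOn (fun q : ℝ × Space d =>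
            stableKernel α κ (p.1 - q.1) (p.2 - q.2) * b (2 ^ k * L))
            (Ioo (T + S k) (T + S (k + 1)) ×ˢ unitCube d) := by
          refine Integrable.mono' hi1 (hmeas.mul_const _).aestronglyMeasurable ?_
          filter_upwards [hae, ae_restrict_mem hset] with q hq hq'
          rw [Real.norm_of_nonneg]
          · exact hq
          · exact mul_nonneg (stableKernel_nonneg hd hα hα2 hκ
              (by linarith [hq'.1.2, hmem.1.1]) _) (hb0 _)
        refine le_trans ?_ (integral_mono_ae hi2 hi1 hae)
        have hi3 : IntegrableOn (fun q : ℝ × Space d => stableKernel α κ (p.1 - q.1) (p.2 - q.2))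
            (Ioo (T + S k) (T + S (k + 1)) ×ˢ unitCube d) := by
          have := hi2.mul_const (b (2 ^ k * L))⁻¹
          refine this.congr (ae_of_all _ fun q => ?_)
          beta_reduce
          rw [mul_inv_cancel_right₀ hbk.ne']
        rw [integral_mul_const, Measure.volume_eq_prod, setIntegral_prod _
          (by rwa [Measure.volume_eq_prod] at hi3)]
        have hi4 : IntegrableOn (fun s : ℝ => ∫ y in unitCube d,
            stableKernel α κ (p.1 - s) (p.2 - y)) (Ioo (T + S k) (T + S (k + 1))) := by
          rw [IntegrableOn, Measure.volume_eq_prod, ← Measure.prod_restrict] at hi3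
          exact hi3.integral_prod_left
        have hc2 : ∫ s in Ioo (T + S k) (T + S (k + 1)), c ≤
            ∫ s in Ioo (T + S k) (T + S (k + 1)), ∫ y in unitCube d,
            stableKernel α κ (p.1 - s) (p.2 - y) := by
          refine setIntegral_mono_on (integrableOn_const (by simp)) hi4 measurableSet_Ioo
            fun s hs => ?_
          refine hcube (p.1 - s) ⟨by linarith [hs.2, hmem.1.1], ?_⟩ p.2 hmem.2
          linarith [hs.1, hS0 k, hmem.1.2]
        have hval : ∫ s in Ioo (T + S k) (T + S (k + 1)), c =
            2 ^ (k + 1) * L / b (2 ^ k * L) := by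
          rw [setIntegral_const, Real.volume_real_Ioo_of_le (by linarith), hSk, smul_eq_mul]
          field_simp
          ring
        calc 2 ^ (k + 1) * L = 2 ^ (k + 1) * L / b (2 ^ k * L) * b (2 ^ k * L) :=
              (div_mul_cancel₀ _ hbk.ne').symm
          _ ≤ _ := by
            rw [← hval]
            gcongr
      linarith
  have hall : ∀ᵐ p : ℝ × Space d, ∀ k : ℕ, p ∈ Ico (T + S k) (T + 1) ×ˢ unitCube d →
      2 ^ k * L ≤ v p := ae_all_iff.2 hkey
  have hpos : 0 < volume (Ico (T + 1 / 2) (T + 1) ×ˢ unitCube d) := by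
    rw [Measure.volume_eq_prod, Measure.prod_prod]
    refine ENNReal.mul_pos ?_ volume_unitCube_pos.ne'
    rw [Real.volume_Ico]
    norm_num
  obtain ⟨p, hpmem, hpall⟩ : ∃ p ∈ Ico (T + 1 / 2) (T + 1) ×ˢ unitCube d, ∀ k : ℕ,
      p ∈ Ico (T + S k) (T + 1) ×ˢ unitCube d → 2 ^ k * L ≤ v p := by
    by_contra! hcon
    have : volume (Ico (T + 1 / 2) (T + 1) ×ˢ unitCube d) = 0 := by
      refine measure_mono_null (fun p hp => ?_) (ae_iff.1 hall)
      obtain ⟨k, hk1, hk2⟩ := hcon p hp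
      intro h
      exact absurd (h k hk1) (not_le.2 hk2)
    exact hpos.ne' this
  -- A point of the last half of the box lies after every `T + S k`, so a finite real value `v p`
  -- would have to exceed all levels.
  obtain ⟨k, hk⟩ := pow_unbounded_of_one_lt (v p / L) (one_lt_two)
  have h1 := hpall k ⟨⟨by linarith [hpmem.1.1, hS1 k], hpmem.1.2⟩, hpmem.2⟩
  rw [div_lt_iff₀ hL] at hk
  linarith

end BlowUp

/-! ### An event on which asymptotically orthogonal Gaussians are not positive is null -/

section Orthogonal

/-- Bounded asymptotically orthogonal sequences converge weakly to zero. -/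
lemma tendsto_inner_zero_of_pairwise {H : Type*} [NormedAddCommGroup H] [InnerProductSpace ℝ H]
    [CompleteSpace H] {z : ℕ → H} (hz : ∀ n, ‖z n‖ ≤ 1)
    (h : ∀ m, Tendsto (fun n => inner ℝ (z n) (z m)) atTop (𝓝 0)) (y : H) :
    Tendsto (fun n => inner ℝ (z n) y) atTop (𝓝 0) := by
  set K := Submodule.span ℝ (range z) with hK
  have hspan : ∀ w ∈ K, Tendsto (fun n => inner ℝ (z n) w) atTop (𝓝 0) := by
    intro w hw
    induction hw using Submodule.span_induction with
    | mem w hw =>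
      obtain ⟨m, rfl⟩ := hw
      exact h m
    | zero => simp
    | add v w _ _ hv hw => simpa [inner_add_right] using hv.add hw
    | smul c w _ hw => simpa [inner_smul_right] using hw.const_mul c
  set C := K.topologicalClosure with hC
  have : CompleteSpace C := K.isClosed_topologicalClosure.completeSpace_coe
  -- Only the projection of `y` to the closed span matters, and it can be approximated by finite
  -- combinations of the `z m`, with an error uniform in `n`.
  have hproj : ∀ n, inner ℝ (z n) y = inner ℝ (z n) (C.starProjection y) := by
    intro n
    have hzn : z n ∈ C := K.le_topologicalClosure (Submodule.subset_span ⟨n, rfl⟩)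
    have := C.starProjection_inner_eq_zero y (z n) hzn
    rw [real_inner_comm, inner_sub_right] at this
    linarith
  simp_rw [hproj]
  set w := C.starProjection y
  have hw : w ∈ closure (K : Set H) := by
    have : w ∈ (C : Set H) := C.starProjection_apply_mem y
    rwa [hC, Submodule.topologicalClosure_coe] at this
  rw [Metric.tendsto_atTop]
  intro ε hε
  obtain ⟨v, hv, hvw⟩ := Metric.mem_closure_iff.1 hw (ε / 2) (by positivity)
  obtain ⟨N, hN⟩ := Metric.tendsto_atTop.1 (hspan v hv) (ε / 2) (by positivity)
  refine ⟨N, fun n hn => ?_⟩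
  have h1 := hN n hn
  rw [Real.dist_0_eq_abs] at h1 ⊢
  have h2 : |inner ℝ (z n) (w - v)| < ε / 2 := by
    refine (abs_real_inner_le_norm _ _).trans_lt ?_
    rw [dist_eq_norm] at hvw
    nlinarith [hz n, norm_nonneg (w - v), norm_nonneg (z n)]
  have h3 : inner ℝ (z n) w = inner ℝ (z n) (w - v) + inner ℝ (z n) v := by
    rw [← inner_add_right, sub_add_cancel]
  rw [h3]
  exact (abs_add_le _ _).trans_lt (by linarith)

variable {Ω : Type*} {mΩ : MeasurableSpace Ω} {P : Measure Ω} [IsProbabilityMeasure P]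

lemma tendsto_setIntegral_zero_of_pairwise {Z : ℕ → Ω → ℝ} (hZ : ∀ n, MemLp (Z n) 2 P)
    (hZ1 : ∀ n, ∫ ω, Z n ω * Z n ω ∂P ≤ 1)
    (h : ∀ m, Tendsto (fun n => ∫ ω, Z n ω * Z m ω ∂P) atTop (𝓝 0))
    {E : Set Ω} (hE : MeasurableSet E) :
    Tendsto (fun n => ∫ ω in E, Z n ω ∂P) atTop (𝓝 0) := by
  have hin : ∀ n (g : Ω → ℝ) (hg : MemLp g 2 P),
      inner ℝ ((hZ n).toLp (Z n)) (hg.toLp g) = ∫ ω, Z n ω * g ω ∂P := by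
    intro n g hg
    rw [L2.inner_def]
    refine integral_congr_ae ?_
    filter_upwards [(hZ n).coeFn_toLp, hg.coeFn_toLp] with ω h1 h2
    rw [h1, h2]
    simp [mul_comm]
  have h1E : MemLp (E.indicator fun _ => (1 : ℝ)) 2 P :=
    memLp_indicator_const 2 hE 1 (Or.inr (measure_ne_top _ _))
  have := tendsto_inner_zero_of_pairwise (z := fun n => (hZ n).toLp (Z n)) (fun n => ?_)
    (fun m => ?_) (h1E.toLp _)
  · refine this.congr fun n => ?_
    rw [hin, ← integral_indicator hE]
    congr 1
    ext ω
    by_cases hω : ω ∈ E <;> simp [hω]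
  · have h1 := hin n _ (hZ n)
    rw [real_inner_self_eq_norm_sq] at h1
    have h2 := hZ1 n
    rw [← h1] at h2
    exact (sq_le_one_iff₀ (norm_nonneg _)).1 h2
  · simpa only [hin] using h m

/-- An event on which asymptotically orthogonal standard Gaussians are, up to small probability,
asymptotically nonpositive is a null event. -/
theorem measure_eq_zero_of_gaussian_nonpos {Z : ℕ → Ω → ℝ} (hZ : ∀ n, MemLp (Z n) 2 P)
    (hZ1 : ∀ n, ∫ ω, Z n ω * Z n ω ∂P ≤ 1)
    (hg : ∀ᶠ n in atTop, P.map (Z n) = gaussianReal 0 1)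
    (h : ∀ m, Tendsto (fun n => ∫ ω, Z n ω * Z m ω ∂P) atTop (𝓝 0))
    {E : Set Ω} (hE : MeasurableSet E)
    (hpos : ∀ ε : ℝ, 0 < ε → ∃ c : ℕ → ℝ, Tendsto c atTop (𝓝 0) ∧
      ∀ᶠ n in atTop, P (E ∩ {ω | c n ≤ Z n ω}) ≤ ENNReal.ofReal ε) : P E = 0 := by
  have hint := tendsto_setIntegral_zero_of_pairwise hZ hZ1 h hE
  -- Based on `|Z| + Z = 2 Z⁺` on `E`. Off `D` one has `|Z| ≥ δ`; off `A` the right side is at most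
  -- `2|c n|`; on `A` it is at most `1/η + η Z²`. Since `P A ≤ η²` and the second moment is at most
  -- `1`, these last contributions total at most `2η`.
  have key : ∀ δ η : ℝ, 0 < δ → 0 < η → δ * (P.real E - 2 * δ) ≤ 2 * η := by
    intro δ η hδ hη
    obtain ⟨c, hc, hcn⟩ := hpos (η ^ 2) (by positivity)
    have hlim : Tendsto (fun n => 2 * |c n| + 2 * η - ∫ ω in E, Z n ω ∂P) atTop
        (𝓝 (2 * |0| + 2 * η - 0)) :=
      ((hc.abs.const_mul 2).add_const _).sub hint
    rw [abs_zero, mul_zero, zero_add, sub_zero] at hlim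
    refine ge_of_tendsto hlim ?_
    filter_upwards [hcn, hg] with n hn hgn
    -- Measurable hulls are taken because `Z n` is only almost everywhere measurable; this changes
    -- no probability.
    set A := toMeasurable P (E ∩ {ω | c n ≤ Z n ω})
    set D := toMeasurable P {ω | |Z n ω| < δ}
    have hAm : MeasurableSet A := measurableSet_toMeasurable _ _
    have hDm : MeasurableSet D := measurableSet_toMeasurable _ _
    have hA : P.real A ≤ η ^ 2 := by
      rw [measureReal_def, measure_toMeasurable]
      exact ENNReal.toReal_le_of_le_ofReal (by positivity) hn
    have hD : P.real D ≤ 2 * δ := by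
      rw [measureReal_def, measure_toMeasurable]
      refine ENNReal.toReal_le_of_le_ofReal (by positivity) ?_
      refine le_trans (le_of_eq ?_) (gaussianReal_abs_lt_le δ)
      rw [← hgn, Measure.map_apply_of_aemeasurable (hZ n).aestronglyMeasurable.aemeasurable]
      · rfl
      · exact measurableSet_lt measurable_norm measurable_const
    have hZi : Integrable (Z n) P := (hZ n).integrable one_le_two
    have hZZ : Integrable (fun ω => Z n ω * Z n ω) P := (hZ n).integrable_mul (hZ n)
    have hcst : ∀ {S : Set Ω}, MeasurableSet S → Integrable (S.indicator fun _ => (1 : ℝ)) P :=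
      fun hS => (integrable_const _).indicator hS
    have hI : ∀ {S : Set Ω}, MeasurableSet S →
        ∫ ω, S.indicator (fun _ => (1 : ℝ)) ω ∂P = P.real S := fun hS => by
      rw [integral_indicator_const _ hS, smul_eq_mul, mul_one]
    have hED : Integrable (fun ω => E.indicator (fun _ => (1 : ℝ)) ω -
        D.indicator (fun _ => (1 : ℝ)) ω) P := (hcst hE).sub (hcst hDm)
    have hAZ : Integrable (fun ω => η⁻¹ * A.indicator (fun _ => (1 : ℝ)) ω +
        η * (Z n ω * Z n ω)) P := ((hcst hAm).const_mul _).add (hZZ.const_mul _)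
    have hmono : ∫ ω, (δ * (E.indicator (fun _ => (1 : ℝ)) ω - D.indicator (fun _ => (1 : ℝ)) ω)
        + E.indicator (Z n) ω) ∂P ≤
        ∫ ω, (2 * |c n| + (η⁻¹ * A.indicator (fun _ => (1 : ℝ)) ω + η * (Z n ω * Z n ω))) ∂P := by
      refine integral_mono ((hED.const_mul δ).add (hZi.indicator hE))
        ((integrable_const _).add hAZ) fun ω => ?_
      have hsq := mul_nonneg hη.le (mul_self_nonneg (Z n ω))
      have hηi : 0 < η⁻¹ := inv_pos.2 hη
      have hAη : 0 ≤ η⁻¹ * A.indicator (fun _ => (1 : ℝ)) ω :=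
        mul_nonneg hηi.le (indicator_nonneg (fun _ _ => zero_le_one) _)
      have hc0 := abs_nonneg (c n)
      have hDδ : 0 ≤ δ * D.indicator (fun _ => (1 : ℝ)) ω :=
        mul_nonneg hδ.le (indicator_nonneg (fun _ _ => zero_le_one) _)
      beta_reduce
      by_cases hω : ω ∈ E
      · rw [indicator_of_mem hω, indicator_of_mem hω]
        have hlow : δ * (1 - D.indicator (fun _ => (1 : ℝ)) ω) ≤ |Z n ω| := by
          by_cases hωD : |Z n ω| < δ
          · have : ω ∈ D := subset_toMeasurable _ _ hωD
            rw [indicator_of_mem this]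
            simp
          · rw [not_lt] at hωD
            linarith
        refine (add_le_add_left hlow _).trans ?_
        by_cases hωA : c n ≤ Z n ω
        · have : ω ∈ A := subset_toMeasurable _ _ ⟨hω, hωA⟩
          rw [indicator_of_mem this, mul_one]
          have h1 : 2 * |Z n ω| ≤ η⁻¹ + η * (Z n ω * Z n ω) := by
            have h2 : η⁻¹ + η * (Z n ω * Z n ω) - 2 * |Z n ω| = η⁻¹ * (η * |Z n ω| - 1) ^ 2 := by
              rw [← abs_mul_abs_self (Z n ω)]
              field_simp
              ring
            have := mul_nonneg hηi.le (sq_nonneg (η * |Z n ω| - 1))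
            linarith
          linarith [le_abs_self (Z n ω)]
        · rw [not_le] at hωA
          have h1 := le_abs_self (c n)
          rcases abs_cases (Z n ω) with h2 | h2 <;> linarith
      · rw [indicator_of_notMem hω, indicator_of_notMem hω]
        linarith
    rw [integral_add (hED.const_mul δ) (hZi.indicator hE),
      integral_const_mul, integral_sub (hcst hE) (hcst hDm), hI hE, hI hDm,
      integral_indicator hE,
      integral_add (integrable_const _) hAZ,
      integral_add ((hcst hAm).const_mul _) (hZZ.const_mul _), integral_const_mul,
      integral_const_mul, hI hAm, integral_const] at hmono
    simp only [probReal_univ, one_smul] at hmono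
    have h1 : η⁻¹ * P.real A ≤ η := by
      rw [inv_mul_le_iff₀ hη]
      nlinarith
    have h2 : η * ∫ ω, Z n ω * Z n ω ∂P ≤ η := by
      nlinarith [hZ1 n]
    rw [← integral_const_mul] at h2
    have h3 := mul_le_mul_of_nonneg_left hD hδ.le
    nlinarith
  have hle : P.real E ≤ 0 := by
    refine le_of_forall_pos_le_add fun ε hε => ?_
    have h1 : ε / 2 * (P.real E - 2 * (ε / 2)) ≤ 0 := by
      refine le_of_forall_pos_le_add fun η hη => ?_
      linarith [key (ε / 2) (η / 2) (by positivity) (by positivity)]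
    by_contra hcon
    rw [not_le] at hcon
    have : 0 < ε / 2 * (P.real E - 2 * (ε / 2)) := mul_pos (by positivity) (by linarith)
    linarith
  exact (measureReal_eq_zero_iff).1 (le_antisymm hle measureReal_nonneg)

end Orthogonal

/-! ### A large noise integral excludes a global solution -/

section Explosion

/-- Integrability and a lower bound, rewritten in terms of a lower Lebesgue integral. -/
lemma integrableOn_and_add_integral_le_iff {S : Type*} [MeasurableSpace S] {μ : Measure S}
    {s : Set S} (hs : MeasurableSet s) {f : S → ℝ} (hf : Measurable f) (hf0 : ∀ q ∈ s, 0 ≤ f q)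
    {L v : ℝ} (hL : 0 < L) :
    (IntegrableOn f s μ ∧ L + ∫ q in s, f q ∂μ ≤ v) ↔
      ∫⁻ q in s, ENNReal.ofReal (f q) ∂μ < ∞ ∧
        ENNReal.ofReal L + ∫⁻ q in s, ENNReal.ofReal (f q) ∂μ ≤ ENNReal.ofReal v := by
  have h0 : 0 ≤ᵐ[μ.restrict s] f := (ae_restrict_mem hs).mono hf0
  have hiff : IntegrableOn f s μ ↔ ∫⁻ q in s, ENNReal.ofReal (f q) ∂μ < ∞ := by
    rw [IntegrableOn, Integrable, hasFiniteIntegral_iff_ofReal h0]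
    exact and_iff_right hf.aestronglyMeasurable
  rw [hiff]
  refine and_congr_right fun hfin => ?_
  have hI : 0 ≤ ∫ q in s, f q ∂μ := integral_nonneg_of_ae h0
  rw [← ofReal_integral_eq_lintegral_ofReal (hiff.2 hfin) h0,
    ← ENNReal.ofReal_add hL.le hI]
  constructor
  · exact fun h => ENNReal.ofReal_le_ofReal h
  · intro h
    rcases le_or_gt 0 v with hv | hv
    · exact (ENNReal.ofReal_le_ofReal_iff hv).1 h
    · rw [ENNReal.ofReal_of_nonpos hv.le, nonpos_iff_eq_zero, ENNReal.ofReal_eq_zero] at h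
      linarith

variable {d : ℕ} {α κ σ : ℝ} {b : ℝ → ℝ} {Ω : Type*} {mΩ : MeasurableSpace Ω} {P : Measure Ω}
  [IsProbabilityMeasure P]

/-- If the blow-up level `L` is exceeded by the noise on a unit box, the mild equation cannot hold
there. -/
theorem measure_inter_le_of_blowUp_level (hd : 0 < d) (hα : 0 < α) (hα2 : α ≤ 2) (hκ : 0 < κ)
    (hσ : 0 < σ) (hb0 : ∀ s, 0 ≤ b s) (hbc : Continuous b) {L : ℝ} (hL0 : 0 < L)
    (hL : ∀ (T : ℝ) (v : ℝ × Space d → ℝ), 0 < T →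
      ¬ ∀ᵐ p : ℝ × Space d, p ∈ Ico T (T + 1) ×ˢ unitCube d →
        IntegrableOn (fun q : ℝ × Space d => stableKernel α κ (p.1 - q.1) (p.2 - q.2) * b (v q))
          (Ioo (0 : ℝ) p.1 ×ˢ univ) ∧
        L + ∫ q in Ioo (0 : ℝ) p.1 ×ˢ (univ : Set (Space d)),
          stableKernel α κ (p.1 - q.1) (p.2 - q.2) * b (v q) ≤ v p)
    {v : ℝ × Space d → Ω → ℝ} (hv : Measurable fun q : (ℝ × Space d) × Ω => v q.1 q.2)
    {X : ℝ → Space d → Ω → ℝ} {E B : Set Ω}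
    (hmild : ∀ t x, 0 < t → ∀ᵐ ω ∂P, ω ∈ E →
      IntegrableOn (fun q : ℝ × Space d => stableKernel α κ (t - q.1) (x - q.2) * b (v q ω))
        (Ioo (0 : ℝ) t ×ˢ univ) ∧
      (∫ q in Ioo (0 : ℝ) t ×ˢ (univ : Set (Space d)),
        stableKernel α κ (t - q.1) (x - q.2) * b (v q ω)) + σ * X t x ω ≤ v (t, x) ω)
    {T Λ : ℝ} (hT : 0 < T)
    (hB : ∀ t ∈ Ico T (T + 1), ∀ x ∈ unitCube d, ∀ᵐ ω ∂P, ω ∉ B →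
      |X t x ω - X T 0 ω| ≤ Λ) :
    P (E ∩ {ω | L / σ + Λ ≤ X T 0 ω}) ≤ P B := by
  set A := E ∩ {ω | L / σ + Λ ≤ X T 0 ω} ∩ Bᶜ with hA
  suffices h : P A = 0 by
    calc P (E ∩ {ω | L / σ + Λ ≤ X T 0 ω}) ≤ P (A ∪ B) := measure_mono fun ω hω => by
          by_cases hωB : ω ∈ B
          · exact Or.inr hωB
          · exact Or.inl ⟨hω, hωB⟩
      _ ≤ P A + P B := measure_union_le _ _
      _ = P B := by rw [h, zero_add]
  have hset : ∀ t : ℝ, MeasurableSet (Ioo (0 : ℝ) t ×ˢ (univ : Set (Space d))) :=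
    fun t => measurableSet_Ioo.prod MeasurableSet.univ
  have hGb : ∀ (p : ℝ × Space d) ω, Measurable fun q : ℝ × Space d =>
      stableKernel α κ (p.1 - q.1) (p.2 - q.2) * b (v q ω) := fun p ω =>
    (measurable_stableKernel.comp (f := fun q : ℝ × Space d => (p.1 - q.1, p.2 - q.2))
      (by fun_prop)).mul (hbc.measurable.comp (hv.comp (by fun_prop :
        Measurable fun q : ℝ × Space d => (q, ω))))
  have hGb0 : ∀ (p : ℝ × Space d) ω, ∀ q ∈ Ioo (0 : ℝ) p.1 ×ˢ (univ : Set (Space d)),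
      0 ≤ stableKernel α κ (p.1 - q.1) (p.2 - q.2) * b (v q ω) := fun p ω q hq =>
    mul_nonneg (stableKernel_nonneg hd hα hα2 hκ (by linarith [hq.1.2]) _) (hb0 _)
  -- The lower integral is jointly measurable in point and sample without any integrability
  -- assumption, which makes the set of good pairs measurable.
  set J : (ℝ × Space d) × Ω → ℝ≥0∞ := fun r =>
    ∫⁻ q in Ioo (0 : ℝ) r.1.1 ×ˢ (univ : Set (Space d)),
      ENNReal.ofReal (stableKernel α κ (r.1.1 - q.1) (r.1.2 - q.2) * b (v q r.2)) with hJ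
  have hJm : Measurable J := by
    have hfun : Measurable fun r : ((ℝ × Space d) × Ω) × (ℝ × Space d) =>
        ENNReal.ofReal (stableKernel α κ (r.1.1.1 - r.2.1) (r.1.1.2 - r.2.2) *
          b (v r.2 r.1.2)) := by
      refine ENNReal.measurable_ofReal.comp (Measurable.mul ?_ ?_)
      · exact measurable_stableKernel.comp
          (f := fun r : ((ℝ × Space d) × Ω) × (ℝ × Space d) =>
            (r.1.1.1 - r.2.1, r.1.1.2 - r.2.2)) (by fun_prop)
      · exact hbc.measurable.comp (hv.comp (by fun_prop :
          Measurable fun r : ((ℝ × Space d) × Ω) × (ℝ × Space d) => (r.2, r.1.2)))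
    have hind : MeasurableSet {r : ((ℝ × Space d) × Ω) × (ℝ × Space d) |
        0 < r.2.1 ∧ r.2.1 < r.1.1.1} := by
      have hs : Measurable fun r : ((ℝ × Space d) × Ω) × (ℝ × Space d) => r.2.1 := by fun_prop
      have ht : Measurable fun r : ((ℝ × Space d) × Ω) × (ℝ × Space d) => r.1.1.1 := by fun_prop
      exact (measurableSet_lt measurable_const hs).inter (measurableSet_lt hs ht)
    have := (hfun.indicator hind).lintegral_prod_right' (ν := (volume : Measure (ℝ × Space d)))
    convert this using 2 with r
    simp only [hJ]
    rw [← lintegral_indicator (hset _)]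
    refine lintegral_congr fun q => ?_
    simp only [indicator, mem_prod, mem_Ioo, mem_univ, and_true, mem_ofPred_eq]
  have hgood : MeasurableSet {r : (ℝ × Space d) × Ω | r.1 ∈ Ico T (T + 1) ×ˢ unitCube d →
      J r < ∞ ∧ ENNReal.ofReal L + J r ≤ ENNReal.ofReal (v r.1 r.2)} := by
    have h1 : MeasurableSet {r : (ℝ × Space d) × Ω | r.1 ∈ Ico T (T + 1) ×ˢ unitCube d} :=
      (measurableSet_Ico.prod measurableSet_unitCube).preimage measurable_fst
    have h2 : MeasurableSet {r : (ℝ × Space d) × Ω |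
        J r < ∞ ∧ ENNReal.ofReal L + J r ≤ ENNReal.ofReal (v r.1 r.2)} :=
      (measurableSet_lt hJm measurable_const).inter
        (measurableSet_le (hJm.const_add _) (ENNReal.measurable_ofReal.comp hv))
    exact h1.imp h2
  have hall : ∀ p : ℝ × Space d, ∀ᵐ ω ∂(P.restrict A), p ∈ Ico T (T + 1) ×ˢ unitCube d →
      J (p, ω) < ∞ ∧ ENNReal.ofReal L + J (p, ω) ≤ ENNReal.ofReal (v p ω) := by
    intro p
    refine (ae_restrict_iff (hgood.preimage (measurable_prodMk_left (x := p)))).2 ?_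
    by_cases hp : p ∈ Ico T (T + 1) ×ˢ unitCube d
    · filter_upwards [hmild p.1 p.2 (hT.trans_le hp.1.1), hB p.1 hp.1 p.2 hp.2]
        with ω h1 h2 hωA _
      obtain ⟨⟨hωE, hωX⟩, hωB⟩ := hωA
      obtain ⟨h3, h4⟩ := h1 hωE
      refine (integrableOn_and_add_integral_le_iff (hset p.1) (hGb p ω) (hGb0 p ω) hL0).1
        ⟨h3, le_trans ?_ h4⟩
      rw [add_comm]
      refine add_le_add_right ?_ _
      have h5 := (abs_le.1 (h2 hωB)).1
      have h6 : L / σ ≤ X p.1 p.2 ω := by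
        have : L / σ + Λ ≤ X T 0 ω := hωX
        linarith
      rwa [div_le_iff₀ hσ, mul_comm] at h6
    · exact ae_of_all _ fun ω _ h => absurd h hp
  -- The mild equation is known at each point for almost every sample, whereas the blow-up argument
  -- fixes a sample and needs almost every point.
  have hswap := (Measure.ae_ae_comm (p := fun (p : ℝ × Space d) (ω : Ω) =>
    p ∈ Ico T (T + 1) ×ˢ unitCube d →
      J (p, ω) < ∞ ∧ ENNReal.ofReal L + J (p, ω) ≤ ENNReal.ofReal (v p ω)) hgood).1 (ae_of_all (volume : Measure (ℝ × Space d)) hall)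
  have hfalse : ∀ᵐ _ω ∂(P.restrict A), False := by
    filter_upwards [hswap] with ω hω
    refine hL T (fun q => v q ω) hT ?_
    filter_upwards [hω] with p hp hpm
    exact (integrableOn_and_add_integral_le_iff (hset p.1) (hGb p ω) (hGb0 p ω) hL0).2 (hp hpm)
  have : P.restrict A = 0 := by
    rw [← ae_eq_bot]
    exact Filter.empty_mem_iff_bot.1 hfalse
  exact Measure.restrict_eq_zero.1 this

end Explosion

/-! ### Nonexistence of global solutions -/

section Global

variable {d : ℕ} {α β κ σ : ℝ} {Ω : Type*} {mΩ : MeasurableSpace Ω} {P : Measure Ω}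
  [IsProbabilityMeasure P] {F : 𝓓(posSpaceTime d, ℝ) → Ω → ℝ} {X : ℝ → Space d → Ω → ℝ}

/-- The increments of the stochastic convolution have Gaussian tails. -/
lemma exists_tail_increment_le (hα : 0 < α) (hα2 : α ≤ 2) (hβ : 0 < β) (hβd : β < d)
    (hβα : β < α) (hκ : 0 < κ) (hF : IsRieszNoise P β F)
    (hX : ∀ t x, 0 < t → IsNoiseIntegral P β F (convolutionKernel α κ t x) (X t x)) :
    ∃ ρ : ℝ, 0 < ρ ∧ ∀ m : ℕ, ∃ K : ℝ, 0 ≤ K ∧ ∀ (t s δ r : ℝ) (x y : Space d), 0 < s → s ≤ t →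
      0 < δ → δ ≤ 1 → t - s ≤ δ → ‖x - y‖ ≤ d * δ → 0 < r →
      P {ω | r ≤ |X t x ω - X s y ω|} ≤ ENNReal.ofReal (K * (δ ^ ρ) ^ m / r ^ (2 * m)) := by
  obtain ⟨C, hC, ρ, hρ, hinc⟩ := exists_convCov_increment_le hβ hβd hα hα2 hβα hκ (d := d)
  refine ⟨ρ, hρ, fun m => ?_⟩
  obtain ⟨K, hK, htail⟩ := exists_gaussian_tail (P := P) m
  refine ⟨K * C ^ m, by positivity, fun t s δ r x y hs hst hδ hδ1 hts hxy hr => ?_⟩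
  have ht := hs.trans_le hst
  have hcov : ∀ {t s : ℝ} (x y : Space d), 0 < s → s ≤ t →
      rieszInner β (convolutionKernel α κ t x) (convolutionKernel α κ s y) =
        convCov d α β κ t s (x - y) := fun x y hs hst =>
    rieszInner_convolutionKernel hβ hβd hα hα2 hβα hκ hs hst x y
  have hmap := IsNoiseIntegral.map_sub_eq hβ hβd hF (hX t x ht) (hX s y hs)
  have hXt := (hX t x ht).2.1
  have hXs := (hX s y hs).2.1
  have htt : Integrable (fun ω => X t x ω * X t x ω) P := hXt.integrable_mul hXt
  have hts' : Integrable (fun ω => X t x ω * X s y ω) P := hXt.integrable_mul hXs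
  have hss : Integrable (fun ω => X s y ω * X s y ω) P := hXs.integrable_mul hXs
  have hdiff : Integrable (fun ω => X t x ω * X t x ω - 2 * (X t x ω * X s y ω)) P :=
    htt.sub (hts'.const_mul 2)
  -- The variance of the increment is nonnegative, so the truncation `toNNReal` in its law is
  -- harmless and its power can be bounded monotonically.
  have hv0 : 0 ≤ rieszInner β (convolutionKernel α κ t x) (convolutionKernel α κ t x) -
      2 * rieszInner β (convolutionKernel α κ t x) (convolutionKernel α κ s y) +
      rieszInner β (convolutionKernel α κ s y) (convolutionKernel α κ s y) := by
    rw [← (hX t x ht).integral_mul hβ hβd hF (hX t x ht),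
      ← (hX t x ht).integral_mul hβ hβd hF (hX s y hs),
      ← (hX s y hs).integral_mul hβ hβd hF (hX s y hs), ← integral_const_mul,
      ← integral_sub htt (hts'.const_mul 2), ← integral_add hdiff hss]
    refine integral_nonneg fun ω => ?_
    have := sq_nonneg (X t x ω - X s y ω)
    change 0 ≤ X t x ω * X t x ω - 2 * (X t x ω * X s y ω) + X s y ω * X s y ω
    linarith
  refine (htail (fun ω => X t x ω - X s y ω) _ r
    (hXt.aestronglyMeasurable.sub hXs.aestronglyMeasurable).aemeasurable hmap hv0 hr).trans ?_
  refine ENNReal.ofReal_le_ofReal ?_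
  have hle := hinc t s δ (x - y) hs.le hst hδ hδ1 hts hxy
  rw [hcov x x ht le_rfl, hcov x y hs hst, hcov y y hs le_rfl, sub_self, sub_self] at hv0 ⊢
  rw [mul_assoc, ← mul_pow]
  gcongr

/-- The normalized stochastic convolution at the origin at integer times, and its Gaussian
properties. -/
lemma normalized_convolution (hα : 0 < α) (hα2 : α ≤ 2) (hβ : 0 < β) (hβd : β < d)
    (hβα : β < α) (hκ : 0 < κ) (hF : IsRieszNoise P β F)
    (hX : ∀ t x, 0 < t → IsNoiseIntegral P β F (convolutionKernel α κ t x) (X t x))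
    (hX0 : X 0 0 = 0) {Z : ℕ → Ω → ℝ}
    (hZ : ∀ n ω, Z n ω = (√(convCov d α β κ n n 0))⁻¹ * X n 0 ω) :
    (∀ n, MemLp (Z n) 2 P) ∧ (∀ n, ∫ ω, Z n ω * Z n ω ∂P ≤ 1) ∧
      (∀ᶠ n in atTop, P.map (Z n) = gaussianReal 0 1) ∧
      ∀ m, Tendsto (fun n => ∫ ω, Z n ω * Z m ω ∂P) atTop (𝓝 0) := by
  set V : ℕ → ℝ := fun n => convCov d α β κ n n 0 with hV
  have hVlim : Tendsto V atTop atTop := tendsto_convCov_atTop hβ hβd hβα hκ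
  have hcov : ∀ {n m : ℕ}, 0 < m → m ≤ n →
      ∫ ω, X n 0 ω * X m 0 ω ∂P = convCov d α β κ n m 0 := by
    intro n m hm hmn
    have hm' : (0 : ℝ) < m := Nat.cast_pos.2 hm
    have hmn' : (m : ℝ) ≤ n := Nat.cast_le.2 hmn
    rw [(hX n 0 (hm'.trans_le hmn')).integral_mul hβ hβd hF (hX m 0 hm'),
      rieszInner_convolutionKernel hβ hβd hα hα2 hβα hκ hm' hmn', sub_zero]
    rfl
  have hZfun : ∀ n, Z n = fun ω => (√(V n))⁻¹ * X n 0 ω := fun n => funext (hZ n)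
  have hZ0 : ∀ ω, Z 0 ω = 0 := fun ω => by rw [hZ, Nat.cast_zero, hX0]; simp
  have hmul : ∀ n m, ∫ ω, Z n ω * Z m ω ∂P =
      (√(V n))⁻¹ * (√(V m))⁻¹ * ∫ ω, X n 0 ω * X m 0 ω ∂P := by
    intro n m
    rw [← integral_const_mul]
    refine integral_congr_ae (ae_of_all _ fun ω => ?_)
    beta_reduce
    rw [hZ, hZ]
    ring
  refine ⟨fun n => ?_, fun n => ?_, ?_, fun m => ?_⟩
  · rcases Nat.eq_zero_or_pos n with rfl | hn
    · rw [show Z 0 = 0 from funext hZ0]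
      exact MemLp.zero
    · rw [hZfun]
      exact (hX n 0 (Nat.cast_pos.2 hn)).2.1.const_mul _
  · rcases Nat.eq_zero_or_pos n with rfl | hn
    · simp [hZ0]
    · rw [hmul, hcov hn le_rfl, ← mul_inv]
      have hVn : 0 ≤ V n := convCov_zero_nonneg hβ hβd hκ (Nat.cast_nonneg n)
      rw [Real.mul_self_sqrt hVn]
      exact inv_mul_le_one
  · filter_upwards [hVlim.eventually_gt_atTop 0, eventually_gt_atTop 0] with n hVn hn
    have hXn := hX n 0 (Nat.cast_pos.2 hn)
    have hmap := IsNoiseIntegral.map_eq hβ hβd hF hXn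
    rw [← hXn.integral_mul hβ hβd hF hXn, hcov hn le_rfl] at hmap
    rw [hZfun, ← Function.comp_def (fun y => (√(V n))⁻¹ * y) (X n 0),
      ← AEMeasurable.map_map_of_aemeasurable (by fun_prop)
        hXn.2.1.aestronglyMeasurable.aemeasurable, hmap, gaussianReal_map_const_mul, mul_zero]
    congr 1
    rw [← NNReal.coe_inj]
    simp only [NNReal.coe_mul, NNReal.coe_mk, NNReal.coe_one]
    rw [Real.coe_toNNReal _ hVn.le, inv_pow, Real.sq_sqrt hVn.le]
    exact inv_mul_cancel₀ hVn.ne'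
  · rcases Nat.eq_zero_or_pos m with rfl | hm
    · simp [hZ0]
    -- For `n ≥ m` the covariance is between `0` and `V m`, so the correlation is at most `√(V m / V
    -- n)`.
    · have hlim : Tendsto (fun n => (√(V n))⁻¹ * ((√(V m))⁻¹ * V m)) atTop (𝓝 0) := by
        rw [← zero_mul ((√(V m))⁻¹ * V m)]
        exact (tendsto_inv_atTop_zero.comp
          (Real.tendsto_sqrt_atTop.comp hVlim)).mul_const _
      refine squeeze_zero' ?_ ?_ hlim
      · filter_upwards [eventually_ge_atTop m] with n hn
        rw [hmul, hcov hm hn]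
        exact mul_nonneg (by positivity) (convCov_zero_nonneg hβ hβd hκ (Nat.cast_nonneg m))
      · filter_upwards [eventually_ge_atTop m] with n hn
        rw [hmul, hcov hm hn, mul_assoc]
        gcongr
        exact convCov_zero_le hβ hβd hβα hκ (Nat.cast_nonneg m) (Nat.cast_le.2 hn)

end Global

theorem mainTheorem4 {d : ℕ} {Ω : Type*} {mΩ : MeasurableSpace Ω} (P : Measure Ω)
    [IsProbabilityMeasure P] (ℱ : Filtration ℝ≥0 mΩ)
    (α β κ σ : ℝ) (hα : 0 < α) (hα2 : α ≤ 2) (hβ : 0 < β) (hβd : β < d) (hβα : β < α)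
    (hκ : 0 < κ) (hσ : 0 < σ)
    (F : 𝓓(posSpaceTime d, ℝ) → Ω → ℝ) (hF : IsRieszNoise P β F)
    (b : ℝ → ℝ) (hb0 : ∀ s, 0 ≤ b s) (hbL : LocallyLipschitz b) (hbm : MonotoneOn b (Ioi 0))
    (u₀ : Space d → ℝ) (hu₀c : Continuous u₀) (hu₀ : ∀ x, 0 ≤ u₀ x)
    (hO : OsgoodCondition b)
    (u : ℝ≥0 → Space d → Ω → ℝ) (τ : Ω → WithTop ℝ≥0)
    (hu : IsLocalSolution P ℱ α β κ σ F b u₀ u τ) :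
    ∀ᵐ ω ∂P, τ ω < ⊤ := by
  have hd : 0 < d := by exact_mod_cast hβ.trans hβd
  set E : Set Ω := {ω | τ ω = ⊤} with hE
  have hEm : MeasurableSet E := by
    have : E = ⋂ n : ℕ, {ω | τ ω ≤ ((n : ℝ≥0) : WithTop ℝ≥0)}ᶜ := by
      ext ω
      simp only [hE, mem_ofPred_eq, mem_iInter, mem_compl_iff, not_le]
      constructor
      · intro h n
        rw [h]
        exact WithTop.coe_lt_top _
      · intro h
        by_contra hne
        obtain ⟨r, hr⟩ := WithTop.ne_top_iff_exists.1 hne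
        obtain ⟨n, hn⟩ := exists_nat_ge r
        have := h n
        rw [← hr, WithTop.coe_lt_coe] at this
        exact absurd hn (not_le.2 this)
    rw [this]
    exact MeasurableSet.iInter fun n => (ℱ.le _ _ (hu.stopping _)).compl
  -- The value `0` for `t ≤ 0` makes the normalized variable of index `0` vanish. On `E` the
  -- equation holds at all positive times; it is kept as an inequality after discarding the
  -- nonnegative term of `u₀`.
  have hex : ∀ (t : ℝ) (x : Space d), ∃ X : Ω → ℝ, (t ≤ 0 → X = 0) ∧ (0 < t →
      IsNoiseIntegral P β F (convolutionKernel α κ t x) X ∧ ∀ᵐ ω ∂P, ω ∈ E →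
        IntegrableOn (fun q : ℝ × Space d =>
          stableKernel α κ (t - q.1) (x - q.2) * b (u q.1.toNNReal q.2 ω))
          (Ioo (0 : ℝ) t ×ˢ univ) ∧
        (∫ q in Ioo (0 : ℝ) t ×ˢ (univ : Set (Space d)),
          stableKernel α κ (t - q.1) (x - q.2) * b (u q.1.toNNReal q.2 ω)) + σ * X ω ≤
          u t.toNNReal x ω) := by
    intro t x
    rcases le_or_gt t 0 with ht | ht
    · exact ⟨0, fun _ => rfl, fun h => absurd ht (not_le.2 h)⟩
    · obtain ⟨X, hX, hmild⟩ := hu.mild t.toNNReal x (Real.toNNReal_pos.2 ht)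
      rw [Real.coe_toNNReal _ ht.le] at hX hmild
      refine ⟨X, fun h => absurd h (not_le.2 ht), fun _ => ⟨hX, ?_⟩⟩
      filter_upwards [hmild] with ω hω hωE
      have hτ : τ ω = ⊤ := hωE
      obtain ⟨-, h2, h3⟩ := hω (by rw [hτ]; exact WithTop.coe_lt_top _)
      refine ⟨h2, ?_⟩
      have h4 : 0 ≤ ∫ y, stableKernel α κ t (x - y) * u₀ y :=
        integral_nonneg fun y => mul_nonneg (stableKernel_nonneg hd hα hα2 hκ ht _) (hu₀ y)
      rw [h3]
      linarith
  choose X hX0 hXpos using hex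
  have hXn : ∀ t x, 0 < t → IsNoiseIntegral P β F (convolutionKernel α κ t x) (X t x) :=
    fun t x ht => (hXpos t x ht).1
  obtain ⟨ρ, hρ, htail⟩ := exists_tail_increment_le hα hα2 hβ hβd hβα hκ hF hXn
  obtain ⟨L, hL0, hL⟩ := exists_blowUp_level (d := d) hd hα hα2 hκ hb0 hbm hO
  have hv : Measurable fun q : (ℝ × Space d) × Ω => u q.1.1.toNNReal q.1.2 q.2 :=
    hu.measurable.comp (f := fun q : (ℝ × Space d) × Ω => (q.1.1.toNNReal, q.1.2, q.2))
      (by fun_prop)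
  obtain ⟨hZ2, hZ1, hZg, hZo⟩ := normalized_convolution hα hα2 hβ hβd hβα hκ hF hXn
    (hX0 0 0 le_rfl) (Z := fun n ω => (√(convCov d α β κ n n 0))⁻¹ * X n 0 ω) fun _ _ => rfl
  have hVlim : Tendsto (fun n : ℕ => convCov d α β κ n n 0) atTop atTop :=
    tendsto_convCov_atTop hβ hβd hβα hκ
  have hE0 : P E = 0 := by
    refine measure_eq_zero_of_gaussian_nonpos hZ2 hZ1 hZg hZo hEm fun ε hε => ?_
    -- It is crucial that `Λ` depends on `ε` but not on `n`: dividing the fixed level `L/σ + Λ` by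
    -- the growing standard deviation gives thresholds tending to `0`.
    obtain ⟨Λ, hΛ⟩ := exists_chaining_bound hρ htail hε
    refine ⟨fun n => (√(convCov d α β κ n n 0))⁻¹ * (L / σ + Λ), ?_, ?_⟩
    · rw [← zero_mul (L / σ + Λ)]
      exact (tendsto_inv_atTop_zero.comp (Real.tendsto_sqrt_atTop.comp hVlim)).mul_const _
    · filter_upwards [hVlim.eventually_gt_atTop 0, eventually_gt_atTop 0] with n hVn hn
      have hn' : (0 : ℝ) < n := Nat.cast_pos.2 hn
      obtain ⟨B, hB, hBX⟩ := hΛ n hn'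
      refine le_trans (measure_mono ?_) ((measure_inter_le_of_blowUp_level hd hα hα2 hκ hσ hb0
        hbL.continuous hL0 hL (v := fun q ω => u q.1.toNNReal q.2 ω) hv
        (fun t x ht => (hXpos t x ht).2) hn' hBX).trans hB)
      refine inter_subset_inter_right _ fun ω hω => ?_
      exact le_of_mul_le_mul_left hω (inv_pos.2 (Real.sqrt_pos.2 hVn))
  filter_upwards [measure_eq_zero_iff_ae_notMem.1 hE0] with ω hω
  exact lt_top_iff_ne_top.2 hω
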